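/- Let $\Gamma=\langle a,b,t\mid tat^{-1}=ab,\ tbt^{-1}=bab\rangle$ be the group of the figure eight knot, with meridian $m=t$, longitude $\ell=[a,b]=aba^{-1}b^{-1}$ and fibre group $F_2=\langle a,b\rangle$. For a finitely generated group $G$ let $X(G)=X(G,\mathrm{SL}(3,\mathbb C))$ be the variety of characters $\chi_\rho\colon g\mapsto\operatorname{tr}\rho(g)$ of representations $\rho\colon G\to \mathrm{SL}(3,\mathbb C)$, an algebraic subset of $\mathbb C^{G}$. A character is called irreducible if it is the character of an irreducible representation. For $n\in\mathbb Z$ let $\pi_1(K(n))=\Gamma/\langle\!\langle m^n\ell\rangle\!\rangle$ be the fundamental group of the Dehn filling $K(n)$, and let $D(3,3,4)=\langle k,l\mid k^3,l^3,(kl)^4\rangle$. The Zariski closure of the set of irreducible characters of $\Gamma$ has exactly three irreducible components $V_0,V_1,V_2$, labelled so that $\chi(a)=\chi(a^{-1})$ and $\chi(b)=\chi(b^{-1})$ on $V_0$, $\chi(a)=\chi(a^{-1})=1$ on $V_1$, and $\chi(b)=\chi(b^{-1})=1$ on $V_2$. They have the following properties. 1. Every element of $V_1$ (respectively $V_2$)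 is the character of a representation that factors through the surjection $\Gamma\to\pi_1(K(-3))$ (respectively $\Gamma\to\pi_1(K(3))$), and moreover through a surjection of $\pi_1(K(-3))$ (respectively $\pi_1(K(3))$) onto $D(3,3,4)$ that does not depend on the character. 2. Put $(\nu,\bar\nu,\zeta)=(\chi(t^{-1}),\chi(t),\chi(b^{-1}))$ for $\chi\in V_1$ and $(\nu,\bar\nu,\zeta)=(\chi(t),\chi(t^{-1}),\chi(a))$ for $\chi\in V_2$. For $i=1,2$, $\chi\mapsto(\nu,\bar\nu,\zeta)$ is an isomorphism of affine algebraic sets from $V_i$ onto the hypersurface in $\mathbb C^3$ $$\zeta^2-(\nu\bar\nu-2)\zeta+\nu^3+\bar\nu^3-5\nu\bar\nu+5=0 .$$ 3. For $i=1,2$, all characters in $V_i$ are irreducible except for the three with $(\nu,\bar\nu,\zeta)=(2,2,1),\ (2\varpi,2\varpi^2,1),\ (2\varpi^2,2\varpi,1)$, where $\varpi=e^{2\pi i/3}$. In the parameters of $V_1$, and also in those of $V_2$, these three points are the image of $V_1\cap V_2$, and $V_1\cap V_2=V_0\cap V_1\cap V_2$. 4. For $i=1,2$, $V_i\cap V_0$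 is the set of $\chi\in V_i$ at which the discriminant with respect to $\zeta$ of the equation in 2 vanishes, that is, $$\nu^2\bar\nu^2-4\nu^3-4\bar\nu^3+16\nu\bar\nu-16=0 .$$ 5. The restriction map $X(\Gamma)\to X(F_2)$ maps $V_1\cap V_2$ onto a single point, at which $\chi(a)=\chi(a^{-1})=\chi(b)=\chi(b^{-1})=1$. -/

import Mathlib

noncomputable section

namespace FigEight

/-! ### Affine algebraic sets in `ℂ^σ` (the index set `σ` may be infinite) -/

/-- Zariski closed subsets of `ℂ^σ`. -/
def IsAlgebraicSet {σ : Type*} (V : Set (σ → ℂ)) : Prop :=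
  ∃ I : Ideal (MvPolynomial σ ℂ), V = MvPolynomial.zeroLocus ℂ I

/-- The Zariski closure of a subset of `ℂ^σ`. -/
def zariskiClosure {σ : Type*} (S : Set (σ → ℂ)) : Set (σ → ℂ) :=
  MvPolynomial.zeroLocus ℂ (MvPolynomial.vanishingIdeal ℂ S)

/-- Irreducible algebraic sets: nonempty, and not a union of two proper algebraic subsets. -/
def IsIrreducibleAlgebraicSet {σ : Type*} (V : Set (σ → ℂ)) : Prop :=
  IsAlgebraicSet V ∧ V.Nonempty ∧
    ∀ A B : Set (σ → ℂ), IsAlgebraicSet A → IsAlgebraicSet B → V ⊆ A ∪ B → V ⊆ A ∨ V ⊆ B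

/-- The irreducible components of `Z`: the maximal irreducible algebraic subsets of `Z`. -/
def irredComponents {σ : Type*} (Z : Set (σ → ℂ)) : Set (Set (σ → ℂ)) :=
  {V | Maximal (fun U : Set (σ → ℂ) => IsIrreducibleAlgebraicSet U ∧ U ⊆ Z) V}

/-- Polynomial maps `ℂ^σ → ℂ^τ`. -/
def IsPolynomialMap {σ τ : Type*} (F : (σ → ℂ) → (τ → ℂ)) : Prop :=
  ∃ P : τ → MvPolynomial σ ℂ, ∀ x i, F x i = MvPolynomial.eval x (P i)

/-- `F` restricts to an isomorphism of affine algebraic sets from `V` onto `W`: both `F` and an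
inverse `G` of its restriction `V → W` are given by polynomials. -/
def IsAlgebraicIso {σ τ : Type*} (F : (σ → ℂ) → (τ → ℂ)) (V : Set (σ → ℂ)) (W : Set (τ → ℂ)) :
    Prop :=
  IsPolynomialMap F ∧ Set.MapsTo F V W ∧
    ∃ G : (τ → ℂ) → (σ → ℂ), IsPolynomialMap G ∧ Set.MapsTo G W V ∧
      (∀ x ∈ V, G (F x) = x) ∧ (∀ y ∈ W, F (G y) = y)

/-! ### Representations in `SL(3, ℂ)` and their characters -/

/-- The group `SL(3, ℂ)`. -/
abbrev SL3 : Type := Matrix.SpecialLinearGroup (Fin 3) ℂ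

/-- The character `g ↦ tr ρ(g)` of a representation in `SL(3, ℂ)`. -/
def character {G : Type*} [Group G] (ρ : G →* SL3) : G → ℂ :=
  fun g => Matrix.trace (ρ g : Matrix (Fin 3) (Fin 3) ℂ)

/-- A representation is irreducible if no proper nonzero subspace of `ℂ³` is invariant. -/
def IsIrreducibleRep {G : Type*} [Group G] (ρ : G →* SL3) : Prop :=
  ∀ W : Submodule ℂ (Fin 3 → ℂ),
    (∀ g : G, ∀ v ∈ W, (ρ g : Matrix (Fin 3) (Fin 3) ℂ).mulVec v ∈ W) → W = ⊥ ∨ W = ⊤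

/-- The variety of characters `X(G, SL(3, ℂ))`, as a set of functions on `G`. Its regular
functions are the polynomials in the evaluations `χ ↦ χ g`, so it carries the algebraic structure
induced from `ℂ^G`. -/
def characters (G : Type*) [Group G] : Set (G → ℂ) :=
  {χ | ∃ ρ : G →* SL3, χ = character ρ}

/-- The set of irreducible characters. -/
def irredCharacters (G : Type*) [Group G] : Set (G → ℂ) :=
  {χ | ∃ ρ : G →* SL3, IsIrreducibleRep ρ ∧ χ = character ρ}

/-! ### The figure eight knot group -/

/-- The relators of `⟨a, b, t ∣ t a t⁻¹ = a b, t b t⁻¹ = b a b⟩`, where `a`, `b`, `t` are the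
generators numbered `0`, `1`, `2`. -/
def knotRelators : Set (FreeGroup (Fin 3)) :=
  {FreeGroup.of 2 * FreeGroup.of 0 * (FreeGroup.of 2)⁻¹ * (FreeGroup.of 0 * FreeGroup.of 1)⁻¹,
   FreeGroup.of 2 * FreeGroup.of 1 * (FreeGroup.of 2)⁻¹ *
     (FreeGroup.of 1 * FreeGroup.of 0 * FreeGroup.of 1)⁻¹}

/-- The group `Γ` of the figure eight knot. -/
abbrev KnotGroup : Type := PresentedGroup knotRelators

/-- First free generator of the group of the fibre. -/
def a : KnotGroup := PresentedGroup.of 0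

/-- Second free generator of the group of the fibre. -/
def b : KnotGroup := PresentedGroup.of 1

/-- The meridian `t`. -/
def t : KnotGroup := PresentedGroup.of 2

/-- The longitude `[a, b] = a b a⁻¹ b⁻¹` that goes with the meridian `t`. -/
def longitude : KnotGroup := a * b * a⁻¹ * b⁻¹

/-- The group `F₂ = ⟨a, b⟩` of the fibre. -/
def fibreGroup : Subgroup KnotGroup := Subgroup.closure {a, b}

/-- Restriction of functions from `Γ` to `F₂`. -/
def restrictToFibre (χ : KnotGroup → ℂ) : fibreGroup → ℂ := fun g => χ g

/-- The kernel of `Γ → π₁(K(n))`, the normal closure of `tⁿ · longitude`. -/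
def fillingKernel (n : ℤ) : Subgroup KnotGroup := Subgroup.normalClosure {t ^ n * longitude}

instance (n : ℤ) : (fillingKernel n).Normal := Subgroup.normalClosure_normal

/-- The fundamental group of the Dehn filling `K(n)` of integral slope `n`. -/
abbrev FillingGroup (n : ℤ) : Type := KnotGroup ⧸ fillingKernel n

/-- The surjection `Γ → π₁(K(n))`. -/
def toFilling (n : ℤ) : KnotGroup →* FillingGroup n := QuotientGroup.mk' (fillingKernel n)

/-- The triangle group `D(p, q, r) = ⟨k, l ∣ k^p, l^q, (k l)^r⟩`. -/
abbrev TriangleGroup (p q r : ℕ) : Type :=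
  PresentedGroup ({FreeGroup.of 0 ^ p, FreeGroup.of 1 ^ q, (FreeGroup.of 0 * FreeGroup.of 1) ^ r} :
    Set (FreeGroup (Fin 2)))

/-! ### Parameters -/

/-- The parameters `(ν, ν̄, ζ) = (χ(t⁻¹), χ(t), χ(b⁻¹))` used on the component `V₁`. -/
def param₁ (χ : KnotGroup → ℂ) : Fin 3 → ℂ := ![χ (t⁻¹), χ t, χ (b⁻¹)]

/-- The parameters `(ν, ν̄, ζ) = (χ(t), χ(t⁻¹), χ(a))` used on the component `V₂`. -/
def param₂ (χ : KnotGroup → ℂ) : Fin 3 → ℂ := ![χ t, χ (t⁻¹), χ a]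

/-- The hypersurface `ζ² - (ν ν̄ - 2) ζ + ν³ + ν̄³ - 5 ν ν̄ + 5 = 0` in `ℂ³`, with coordinates
`(x 0, x 1, x 2) = (ν, ν̄, ζ)`. -/
def hypersurface : Set (Fin 3 → ℂ) :=
  {x | x 2 ^ 2 - (x 0 * x 1 - 2) * x 2 + x 0 ^ 3 + x 1 ^ 3 - 5 * (x 0 * x 1) + 5 = 0}

/-- The discriminant `ν² ν̄² - 4 ν³ - 4 ν̄³ + 16 ν ν̄ - 16` of the equation of `hypersurface`, as a
quadratic equation for `ζ`. -/
def discriminant (x : Fin 3 → ℂ) : ℂ :=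
  x 0 ^ 2 * x 1 ^ 2 - 4 * x 0 ^ 3 - 4 * x 1 ^ 3 + 16 * (x 0 * x 1) - 16

/-- The primitive cube root of unity `exp (2πi/3)`. -/
def ϖ : ℂ := Complex.exp (2 * Real.pi * Complex.I / 3)

/-- The three exceptional parameter values `(ν, ν̄, ζ)`. -/
def exceptionalPoints : Set (Fin 3 → ℂ) :=
  {![2, 2, 1], ![2 * ϖ, 2 * ϖ ^ 2, 1], ![2 * ϖ ^ 2, 2 * ϖ, 1]}

/-- Every element of `V` is the character of a representation of `Γ` that factors through
`Γ → π₁(K(n))`, and more precisely through a surjection, the same for all elements of `V`, of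
`π₁(K(n))` onto the triangle group `D(3, 3, 4)`. -/
def FactorsThroughFilling (V : Set (KnotGroup → ℂ)) (n : ℤ) : Prop :=
  ∃ q : FillingGroup n →* TriangleGroup 3 3 4, Function.Surjective q ∧
    ∀ χ ∈ V, ∃ σ : TriangleGroup 3 3 4 →* SL3, χ = character ((σ.comp q).comp (toFilling n))

end FigEight

end

/-! Write A, B, T for the images of a, b, t. Conjugation by t is the monodromy of the fibre, so many
short words in a and b have equal traces. Together with the Cayley-Hamilton identity this gives (tr
B - tr B⁻¹)(1 - tr A) = 0, (tr B - tr B⁻¹)(1 - tr A⁻¹) = 0 and (tr A - tr A⁻¹)(1 - tr B) = 0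
(`tr_fibre_relations`). Hence every character is symmetric on a and b, or has χ(a) = χ(a⁻¹) = 1, or
has χ(b) = χ(b⁻¹) = 1. These cases lead to V₀, V₁ and V₂. The automorphism `flip`, which inverts t
and fixes the longitude, exchanges V₁ and V₂.

For V₁, if tr A = tr A⁻¹ = 1 and tr B ≠ 1, then k = a⁻¹t and l = a⁻¹t² have the characteristic
polynomial λ³ - 1, and kl has λ³ - λ² + λ - 1 (`tr_eq_zero_of_tr_eq_one`, `isTriangleRep_of_tr`).
Thus the representation factors through D(3,3,4), where the longitude becomes t³. Every trace of a
word in two matrices is a polynomial in ten traces (`isTracePolynomial_wordVal`). For the pair (k,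
l) six of these are constant, two are ν and ν̄, and the two commutator traces χ(b) and χ(b⁻¹) are
the roots of a quadratic with coefficients in ν and ν̄ (`tr_comm_add`, `tr_comm_mul`). So (ν, ν̄, ζ)
determines the character polynomially. Conversely, explicit matrices realise each point of the
hypersurface (`exists_isTriangleRep`). A reducible representation of this kind has a common
eigenvector, possibly after dualising, and this forces an exceptional point. At the exceptional
points the character belongs to a sum of a line and a plane on which a² is central but not scalar,
and no irreducible representation can have it.

For V₀, a symmetric character is invariant under the endomorphism a ↦ a⁻¹, b ↦ b⁻¹, t ↦ tb. For
irreducible ρ it is therefore implemented by an involution J (`exists_involution_intertwiner`). With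
U = JT⁻¹ the three generators are words in J and U, and the knot relations reduce to the single
condition that J commutes with U²JU⁻¹JU². In the basis v, Uv, U²v, where v spans the 1-eigenspace of
J, this condition becomes one equation on an irreducible surface in ℂ³, and V₀ is the closure of its
image (`IsIrreducibleRep.character_mem_image_symmetricSurface`).

The discriminant of the quadratic is (χ(b) - χ(b⁻¹))² on V₁, so it vanishes exactly where the
character is symmetric. On V₁ ∩ V₂ one has ζ = 1 and νν̄ = 4, and this leaves only the three
exceptional points. They lie on V₀ by explicit parameters and have the same restriction to the fibre
group. -/

noncomputable section

namespace FigEight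

open Matrix

/-! ### Trace identities in `SL(3, ℂ)` -/

/-- Polarisation of the Cayley-Hamilton identity for matrices of size three. -/
theorem mul_mul_self_eq {R : Type*} [CommRing R] (A X : Matrix (Fin 3) (Fin 3) R) :
    A * X * A = -(A.adjugate * X) - X * A.adjugate + A.adjugate.trace • X + X.trace • A.adjugate
      + (A * X).trace • A + ((A.adjugate * X).trace - A.adjugate.trace * X.trace) • 1 := by
  ext i j
  fin_cases i <;> fin_cases j <;>
    simp [Matrix.adjugate_fin_three, Matrix.trace_fin_three, Matrix.mul_apply, Fin.sum_univ_three,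
      Matrix.vecMul, dotProduct] <;> ring

/-- The trace on `SL(3, ℂ)`. -/
def tr (A : SL3) : ℂ := Matrix.trace (A : Matrix (Fin 3) (Fin 3) ℂ)

theorem character_apply {G : Type*} [Group G] (ρ : G →* SL3) (g : G) :
    character ρ g = tr (ρ g) := rfl

theorem tr_one : tr 1 = 3 := by simp [tr]

theorem tr_mul_comm (A B : SL3) : tr (A * B) = tr (B * A) := by
  rw [tr, tr, Matrix.SpecialLinearGroup.coe_mul, Matrix.SpecialLinearGroup.coe_mul,
    Matrix.trace_mul_comm]

theorem tr_conj (A B : SL3) : tr (A * B * A⁻¹) = tr B := by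
  rw [tr_mul_comm]; simp

theorem tr_eq_of_conj {A B : SL3} (C : SL3) (h : C * A = B * C) : tr A = tr B := by
  rw [← tr_conj C A, h]; simp

theorem coe_mul_mul_self (g x : SL3) :
    (g * x * g : Matrix (Fin 3) (Fin 3) ℂ) = -((g⁻¹ : SL3) * x : Matrix (Fin 3) (Fin 3) ℂ)
      - x * (g⁻¹ : SL3) + tr g⁻¹ • (x : Matrix (Fin 3) (Fin 3) ℂ)
      + tr x • ((g⁻¹ : SL3) : Matrix (Fin 3) (Fin 3) ℂ) + tr (g * x) • (g : Matrix (Fin 3) (Fin 3) ℂ)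
      + (tr (g⁻¹ * x) - tr g⁻¹ * tr x) • 1 := by
  have := mul_mul_self_eq (g : Matrix (Fin 3) (Fin 3) ℂ) x
  simpa [tr, Matrix.SpecialLinearGroup.coe_inv] using this

/-- This is the reduction rule for traces of words: two occurrences of `g` are traded for at most
one `g⁻¹`, and every word on the right is shorter than the word on the left. -/
theorem tr_mul_mul_mul (g x y : SL3) :
    tr (g * x * g * y) = -tr (g⁻¹ * x * y) - tr (x * g⁻¹ * y) + tr g⁻¹ * tr (x * y)
      + tr x * tr (g⁻¹ * y) + tr (g * x) * tr (g * y)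
      + (tr (g⁻¹ * x) - tr g⁻¹ * tr x) * tr y := by
  have := congrArg (fun M => Matrix.trace (M * (y : Matrix (Fin 3) (Fin 3) ℂ)))
    (coe_mul_mul_self g x)
  simpa [tr, add_mul, sub_mul, Matrix.trace_add, Matrix.trace_sub] using this

/-- The trace of the Cayley-Hamilton identity multiplied by `y`. -/
theorem tr_mul_self_mul (g y : SL3) :
    tr (g * g * y) = tr g * tr (g * y) - tr g⁻¹ * tr y + tr (g⁻¹ * y) := by
  have h := tr_mul_mul_mul g 1 y
  simp only [mul_one, one_mul, tr_one] at h
  rw [h]; ring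

/-! ### Traces of words are polynomials in ten traces -/

/-- The ten traces that generate the algebra of trace functions of pairs. -/
def tenTraces (A B : SL3) : Fin 10 → ℂ :=
  ![tr A, tr A⁻¹, tr B, tr B⁻¹, tr (A * B), tr (A * B)⁻¹, tr (A * B⁻¹), tr (A⁻¹ * B),
    tr (A * B * A⁻¹ * B⁻¹), tr (B * A * B⁻¹ * A⁻¹)]

/-- Functions of pairs of matrices that are polynomials in the ten traces. -/
def IsTracePolynomial (f : SL3 → SL3 → ℂ) : Prop :=
  ∃ Q : MvPolynomial (Fin 10) ℂ, ∀ A B, f A B = MvPolynomial.eval (tenTraces A B) Q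

namespace IsTracePolynomial

variable {f g : SL3 → SL3 → ℂ}

theorem add (hf : IsTracePolynomial f) (hg : IsTracePolynomial g) :
    IsTracePolynomial fun A B => f A B + g A B := by
  obtain ⟨P, hP⟩ := hf
  obtain ⟨Q, hQ⟩ := hg
  exact ⟨P + Q, fun A B => by simp [hP, hQ]⟩

theorem mul (hf : IsTracePolynomial f) (hg : IsTracePolynomial g) :
    IsTracePolynomial fun A B => f A B * g A B := by
  obtain ⟨P, hP⟩ := hf
  obtain ⟨Q, hQ⟩ := hg
  exact ⟨P * Q, fun A B => by simp [hP, hQ]⟩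

theorem neg (hf : IsTracePolynomial f) : IsTracePolynomial fun A B => - f A B := by
  obtain ⟨P, hP⟩ := hf
  exact ⟨-P, fun A B => by simp [hP]⟩

theorem sub (hf : IsTracePolynomial f) (hg : IsTracePolynomial g) :
    IsTracePolynomial fun A B => f A B - g A B := by
  obtain ⟨P, hP⟩ := hf
  obtain ⟨Q, hQ⟩ := hg
  exact ⟨P - Q, fun A B => by simp [hP, hQ]⟩

theorem const (c : ℂ) : IsTracePolynomial fun _ _ => c := ⟨MvPolynomial.C c, by simp⟩

theorem coord (i : Fin 10) : IsTracePolynomial fun A B => tenTraces A B i :=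
  ⟨MvPolynomial.X i, by simp⟩

theorem of_eq (hf : IsTracePolynomial f) (h : ∀ A B, g A B = f A B) : IsTracePolynomial g := by
  obtain ⟨P, hP⟩ := hf
  exact ⟨P, fun A B => by rw [h, hP]⟩

end IsTracePolynomial

/-- The letters `A, A⁻¹, B, B⁻¹`. -/
def letter (A B : SL3) : Fin 4 → SL3 := ![A, A⁻¹, B, B⁻¹]

/-- The inverse letter. -/
def letterInv : Fin 4 → Fin 4 := ![1, 0, 3, 2]

theorem letter_inv (A B : SL3) (i : Fin 4) : letter A B (letterInv i) = (letter A B i)⁻¹ := by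
  fin_cases i <;> simp [letter, letterInv]

/-- The value of a word. -/
def wordVal (A B : SL3) (L : List (Fin 4)) : SL3 := (L.map (letter A B)).prod

theorem wordVal_append (A B : SL3) (L M : List (Fin 4)) :
    wordVal A B (L ++ M) = wordVal A B L * wordVal A B M := by
  simp [wordVal]

theorem wordVal_cons (A B : SL3) (i : Fin 4) (M : List (Fin 4)) :
    wordVal A B (i :: M) = letter A B i * wordVal A B M := by
  simp [wordVal]

theorem wordVal_nil (A B : SL3) : wordVal A B [] = 1 := rfl

theorem exists_repeated_letter {α : Type*} [DecidableEq α] (L : List α) (h : ¬ L.Nodup) :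
    ∃ (g : α) (p x y : List α), L = p ++ g :: (x ++ g :: y) := by
  induction L with
  | nil => simp at h
  | cons c L ih =>
    by_cases hc : c ∈ L
    · obtain ⟨x, y, rfl⟩ := List.append_of_mem hc
      exact ⟨c, [], x, y, rfl⟩
    · have : ¬ L.Nodup := fun hL => h (List.nodup_cons.2 ⟨hc, hL⟩)
      obtain ⟨g, p, x, y, rfl⟩ := ih this
      exact ⟨g, c :: p, x, y, rfl⟩

/-- In a cyclic word of length three any two letters are adjacent, and three distinct letters out of
two inverse pairs contain a full pair. So such a word cancels. -/
theorem three_letters : ∀ i j k : Fin 4, i ≠ j → i ≠ k → j ≠ k →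
    j = letterInv i ∨ k = letterInv j ∨ i = letterInv k := by decide

/-- A cyclic word that uses all four letters once and does not cancel is a commutator of two
letters. -/
theorem four_letters : ∀ i j k l : Fin 4, i ≠ j → i ≠ k → i ≠ l → j ≠ k → j ≠ l → k ≠ l →
    j = letterInv i ∨ k = letterInv j ∨ l = letterInv k ∨ i = letterInv l ∨
      (k = letterInv i ∧ l = letterInv j ∧ i ≠ j ∧ i ≠ letterInv j) := by decide

theorem isTracePolynomial_wordVal (L : List (Fin 4)) :
    IsTracePolynomial fun A B => tr (wordVal A B L) := by
  induction hn : L.length using Nat.strong_induction_on generalizing L with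
  | _ n ih =>
  subst hn
  replace ih : ∀ M : List (Fin 4), M.length < L.length →
      IsTracePolynomial fun A B => tr (wordVal A B M) := fun M hM => ih _ hM M rfl
  -- Without repetition the length is at most four. After cyclic cancellation there remain letters,
  -- products of two letters and commutators, whose traces are all on the list.
  by_cases hL : L.Nodup
  · match L, hL, ih with
    | [], _, _ => exact (IsTracePolynomial.const 3).of_eq fun A B => by simp [wordVal_nil, tr_one]
    | [i], _, _ =>
      have key : ∀ i : Fin 4, ∃ k : Fin 10, ∀ A B,
          tr (wordVal A B [i]) = tenTraces A B k := by
        intro i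
        refine ⟨![0, 1, 2, 3] i, fun A B => ?_⟩
        fin_cases i <;> simp [wordVal, letter, tenTraces]
      obtain ⟨k, hk⟩ := key i
      exact (IsTracePolynomial.coord k).of_eq hk
    | [i, j], hL, _ =>
      by_cases hij : j = letterInv i
      · exact (IsTracePolynomial.const 3).of_eq fun A B => by
          simp [wordVal, hij, letter_inv, tr_one]
      · have key : ∀ i j : Fin 4, i ≠ j → j ≠ letterInv i → ∃ k : Fin 10, ∀ A B,
            tr (wordVal A B [i, j]) = tenTraces A B k := by
          intro i j h1 h2
          -- The zeros in this table, and in the one for commutators below, are placeholders for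
          -- pairs of equal or inverse letters, which the hypotheses exclude.
          refine ⟨![![0, 0, 4, 6], ![0, 0, 7, 5], ![4, 7, 0, 0], ![6, 5, 0, 0]] i j,
            fun A B => ?_⟩
          fin_cases i <;> fin_cases j <;>
            first
            | exact absurd rfl h1
            | exact absurd rfl h2
            | simp [wordVal, letter, tenTraces]; done
            | simp [wordVal, letter, tenTraces, tr_mul_comm]
        obtain ⟨k, hk⟩ := key i j (by simpa using hL) hij
        exact (IsTracePolynomial.coord k).of_eq hk
    | [i, j, k], hL, ih =>
      have h3 := three_letters i j k (by simp at hL; tauto) (by simp at hL; tauto)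
        (by simp at hL; tauto)
      rcases h3 with h | h | h
      · exact (ih [k] (by simp)).of_eq fun A B => by simp [wordVal, h, letter_inv]
      · exact (ih [i] (by simp)).of_eq fun A B => by simp [wordVal, h, letter_inv]
      · refine (ih [j] (by simp)).of_eq fun A B => ?_
        simp only [wordVal, h, letter_inv, List.map_cons, List.map_nil, List.prod_cons,
          List.prod_nil, mul_one]
        rw [tr_mul_comm]; simp
    | [i, j, k, l], hL, ih =>
      have h4 := four_letters i j k l (by simp at hL; tauto) (by simp at hL; tauto)
        (by simp at hL; tauto) (by simp at hL; tauto) (by simp at hL; tauto) (by simp at hL; tauto)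
      rcases h4 with h | h | h | h | ⟨hk, hl, h1, h2⟩
      · exact (ih [k, l] (by simp)).of_eq fun A B => by simp [wordVal, h, letter_inv]
      · exact (ih [i, l] (by simp)).of_eq fun A B => by simp [wordVal, h, letter_inv]
      · exact (ih [i, j] (by simp)).of_eq fun A B => by simp [wordVal, h, letter_inv]
      · refine (ih [j, k] (by simp)).of_eq fun A B => ?_
        simp only [wordVal, h, letter_inv, List.map_cons, List.map_nil, List.prod_cons,
          List.prod_nil, mul_one]
        rw [tr_mul_comm]; simp [mul_assoc]
      · have key : ∀ i j : Fin 4, i ≠ j → i ≠ letterInv j → ∃ k : Fin 10, ∀ A B,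
            tr (wordVal A B [i, j, letterInv i, letterInv j]) = tenTraces A B k := by
          intro i j h1 h2
          refine ⟨![![0, 0, 8, 9], ![0, 0, 9, 8], ![9, 8, 0, 0], ![8, 9, 0, 0]] i j,
            fun A B => ?_⟩
          fin_cases i <;> fin_cases j <;>
            first
            | exact absurd rfl h1
            | exact absurd rfl h2
            | (simp [wordVal, letter, letterInv, tenTraces, mul_assoc]; done)
            | (simp only [wordVal, letter, letterInv, tenTraces, mul_assoc]
               simp
               first
               | (apply tr_eq_of_conj A; group; done)
               | (apply tr_eq_of_conj A⁻¹; group; done)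
               | (apply tr_eq_of_conj B; group; done)
               | (apply tr_eq_of_conj B⁻¹; group; done)
               | (apply tr_eq_of_conj (A * B); group))
        obtain ⟨m, hm⟩ := key i j h1 h2
        subst hk hl
        exact (IsTracePolynomial.coord m).of_eq hm
    | i :: j :: k :: l :: m :: M, hL, _ =>
      have := hL.length_le_card
      simp at this
      omega
  -- The word p g x g y has the trace of g x g (y p), to which `tr_mul_mul_mul` applies.
  · obtain ⟨g, p, x, y, rfl⟩ := exists_repeated_letter L hL
    have hlen : (p ++ g :: (x ++ g :: y)).length = p.length + x.length + y.length + 2 := by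
      simp; omega
    rw [hlen] at ih
    have e (A B) := letter_inv A B g
    have h1 := ih (letterInv g :: (x ++ (y ++ p))) (by simp; omega)
    have h2 := ih (x ++ letterInv g :: (y ++ p)) (by simp; omega)
    have h3 := ih [letterInv g] (by simp)
    have h4 := ih (x ++ (y ++ p)) (by simp; omega)
    have h5 := ih x (by omega)
    have h6 := ih (letterInv g :: (y ++ p)) (by simp; omega)
    have h7 := ih (g :: x) (by simp; omega)
    have h8 := ih (g :: (y ++ p)) (by simp; omega)
    have h9 := ih (letterInv g :: x) (by simp; omega)
    have h10 := ih (y ++ p) (by simp; omega)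
    refine ((((((h1.neg.sub h2).add (h3.mul h4)).add (h5.mul h6)).add (h7.mul h8))).add
      ((h9.sub (h3.mul h5)).mul h10)).of_eq fun A B => ?_
    simp only [wordVal_append, wordVal_cons, wordVal_nil, mul_one, e]
    have := tr_mul_mul_mul (letter A B g) (wordVal A B x) (wordVal A B y * wordVal A B p)
    simp only [mul_assoc] at this ⊢
    rw [tr_mul_comm (wordVal A B p)]
    simp only [mul_assoc]
    exact this

/-- The word is chosen before the representation. This is what makes the resulting trace polynomial
uniform in `ρ`. -/
theorem exists_wordVal_eq {G : Type*} [Group G] {u v : G}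
    (h : Subgroup.closure {u, v} = ⊤) (g : G) :
    ∃ L : List (Fin 4), ∀ ρ : G →* SL3, ρ g = wordVal (ρ u) (ρ v) L := by
  have hg : g ∈ Subgroup.closure {u, v} := h ▸ Subgroup.mem_top g
  induction hg using Subgroup.closure_induction with
  | mem x hx =>
    rcases hx with rfl | rfl
    · exact ⟨[0], fun ρ => by simp [wordVal, letter]⟩
    · exact ⟨[2], fun ρ => by simp [wordVal, letter]⟩
  | one => exact ⟨[], fun ρ => by simp [wordVal]⟩
  | mul x y _ _ hx hy =>
    obtain ⟨L, hL⟩ := hx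
    obtain ⟨M, hM⟩ := hy
    exact ⟨L ++ M, fun ρ => by rw [wordVal_append, map_mul, hL, hM]⟩
  | inv x _ hx =>
    obtain ⟨L, hL⟩ := hx
    refine ⟨(L.map letterInv).reverse, fun ρ => ?_⟩
    rw [map_inv, hL, wordVal, wordVal, List.prod_inv_reverse, List.map_reverse, List.map_map,
      List.map_map]
    congr 3
    funext i
    simp [letter_inv]

/-- Characters of a group with two generators are polynomials in ten of their values. -/
theorem exists_tracePolynomial {G : Type*} [Group G] {u v : G}
    (h : Subgroup.closure {u, v} = ⊤) (g : G) :
    ∃ Q : MvPolynomial (Fin 10) ℂ, ∀ ρ : G →* SL3,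
      tr (ρ g) = MvPolynomial.eval (tenTraces (ρ u) (ρ v)) Q := by
  obtain ⟨L, hL⟩ := exists_wordVal_eq h g
  obtain ⟨Q, hQ⟩ := isTracePolynomial_wordVal L
  exact ⟨Q, fun ρ => by rw [hL]; exact hQ _ _⟩

theorem character_eq_of_tenTraces_eq {G : Type*} [Group G] {u v : G}
    (h : Subgroup.closure {u, v} = ⊤) (ρ σ : G →* SL3)
    (e : tenTraces (ρ u) (ρ v) = tenTraces (σ u) (σ v)) : character ρ = character σ := by
  funext g
  obtain ⟨Q, hQ⟩ := exists_tracePolynomial h g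
  rw [character_apply, character_apply, hQ, hQ, e]

end FigEight

end

noncomputable section

namespace FigEight

open Matrix

/-! ### Irreducible representations -/

section Irreducible

variable {G : Type*} [Group G]

/-- The linear representation on `ℂ³` given by a homomorphism to `SL(3, ℂ)`. -/
def linearRep (ρ : G →* SL3) : Representation ℂ G (Fin 3 → ℂ) where
  toFun g := Matrix.toLin' (ρ g : Matrix (Fin 3) (Fin 3) ℂ)
  map_one' := by simp; rfl
  map_mul' g h := by simp [Matrix.toLin'_mul, Module.End.mul_eq_comp]

theorem linearRep_apply (ρ : G →* SL3) (g : G) (v : Fin 3 → ℂ) :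
    linearRep ρ g v = (ρ g : Matrix (Fin 3) (Fin 3) ℂ) *ᵥ v := by
  simp [linearRep]

/-- The extension of a representation to the group algebra. -/
def groupAlgebraRep (ρ : G →* SL3) : MonoidAlgebra ℂ G →ₐ[ℂ] Matrix (Fin 3) (Fin 3) ℂ :=
  MonoidAlgebra.lift ℂ _ G
    { toFun := fun g => (ρ g : Matrix (Fin 3) (Fin 3) ℂ), map_one' := by simp, map_mul' := by simp }

theorem groupAlgebraRep_of (ρ : G →* SL3) (g : G) :
    groupAlgebraRep ρ (MonoidAlgebra.of ℂ G g) = ρ g := by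
  simp [groupAlgebraRep]

theorem toLin'_groupAlgebraRep (ρ : G →* SL3) (x : MonoidAlgebra ℂ G) :
    Matrix.toLin' (groupAlgebraRep ρ x) = (linearRep ρ).asAlgebraHom x := by
  induction x using MonoidAlgebra.induction_on with
  | of g => rw [groupAlgebraRep_of, Representation.asAlgebraHom_of]; rfl
  | add x y hx hy => rw [map_add, map_add, map_add, hx, hy]
  | smul r x hx => rw [map_smul, map_smul, map_smul, hx]

theorem IsIrreducibleRep.isIrreducible {ρ : G →* SL3} (h : IsIrreducibleRep ρ) :
    (linearRep ρ).IsIrreducible where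
  exists_pair_ne := by
    refine ⟨⊥, ⊤, fun hbt => ?_⟩
    have := congrArg Subrepresentation.toSubmodule hbt
    exact bot_ne_top (α := Submodule ℂ (Fin 3 → ℂ)) this
  eq_bot_or_eq_top W := by
    rcases h W.toSubmodule (fun g v hv => by
      rw [← linearRep_apply]; exact W.apply_mem_toSubmodule g hv) with h | h
    · exact Or.inl (Subrepresentation.toSubmodule_injective h)
    · exact Or.inr (Subrepresentation.toSubmodule_injective h)

/-- Burnside's theorem: the matrices of an irreducible representation span the matrix algebra. -/
theorem IsIrreducibleRep.groupAlgebraRep_surjective {ρ : G →* SL3} (h : IsIrreducibleRep ρ) :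
    Function.Surjective (groupAlgebraRep ρ) := by
  intro M
  have := h.isIrreducible
  have hs : IsSimpleModule (MonoidAlgebra ℂ G) (linearRep ρ).asModule :=
    (Representation.irreducible_iff_isSimpleModule_asModule _).1 this
  have hend := IsSimpleModule.algebraMap_end_bijective_of_isAlgClosed
    (A := MonoidAlgebra ℂ G) (V := (linearRep ρ).asModule) ℂ
  let V := (linearRep ρ).asModule
  -- By Schur's lemma the endomorphisms of the module are the scalars, so every matrix is linear
  -- over them. Jacobson density then yields an element of the group algebra that agrees with `M` on
  -- the three basis vectors.
  let f : Module.End (Module.End (MonoidAlgebra ℂ G) V) V :=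
    { toFun := fun v => (linearRep ρ).asModuleEquiv.symm (M *ᵥ (linearRep ρ).asModuleEquiv v)
      map_add' := fun v w => by simp [Matrix.mulVec_add]
      map_smul' := fun e v => by
        obtain ⟨c, rfl⟩ := hend.2 e
        have hc (w : (linearRep ρ).asModule) : (algebraMap ℂ
          (Module.End (MonoidAlgebra ℂ G) (linearRep ρ).asModule) c) • w = c • w := rfl
        rw [RingHom.id_apply, hc, hc, map_smul, Matrix.mulVec_smul, map_smul] }
  classical
  obtain ⟨r, hr⟩ := jacobson_density (R := MonoidAlgebra ℂ G) (M := V) f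
    (Finset.univ.image fun i : Fin 3 => (linearRep ρ).asModuleEquiv.symm (Pi.single i 1))
  refine ⟨r, Matrix.toLin'.injective ?_⟩
  rw [toLin'_groupAlgebraRep]
  refine (Pi.basisFun ℂ (Fin 3)).ext fun i => ?_
  have h1 := hr ((linearRep ρ).asModuleEquiv.symm (Pi.single i 1))
    (Finset.mem_image_of_mem _ (Finset.mem_univ i))
  have h2 := congrArg (linearRep ρ).asModuleEquiv h1
  rw [Representation.asModuleEquiv_map_smul, LinearEquiv.apply_symm_apply] at h2
  simp only [Pi.basisFun_apply]
  rw [← h2]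
  simp [f]

theorem groupAlgebraRep_trace_mul (ρ σ : G →* SL3) (h : character ρ = character σ)
    (x : MonoidAlgebra ℂ G) :
    (groupAlgebraRep ρ x).trace = (groupAlgebraRep σ x).trace := by
  induction x using MonoidAlgebra.induction_on with
  | of g => rw [groupAlgebraRep_of, groupAlgebraRep_of]; exact congrFun h g
  | add x y hx hy => rw [map_add, map_add, Matrix.trace_add, Matrix.trace_add, hx, hy]
  | smul r x hx => rw [map_smul, map_smul, Matrix.trace_smul, Matrix.trace_smul, hx]

/-- The kernel of an irreducible representation of the group algebra contains the radical of the
trace form of its character. -/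
theorem IsIrreducibleRep.groupAlgebraRep_eq_zero {ρ : G →* SL3} (h : IsIrreducibleRep ρ)
    (x : MonoidAlgebra ℂ G) (hx : ∀ y, (groupAlgebraRep ρ (x * y)).trace = 0) :
    groupAlgebraRep ρ x = 0 := by
  refine Matrix.ext_iff_trace_mul_right.2 fun M => ?_
  obtain ⟨y, rfl⟩ := h.groupAlgebraRep_surjective M
  rw [← map_mul, hx, zero_mul, Matrix.trace_zero]

/-- The kernel of `σ` lies in the radical of the trace form, and this form depends only on the
character. Here `σ` may be reducible, and this is essential at the exceptional points. -/
theorem IsIrreducibleRep.groupAlgebraRep_eq_zero_of_character_eq {ρ σ : G →* SL3}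
    (h : IsIrreducibleRep ρ) (hc : character ρ = character σ) {x : MonoidAlgebra ℂ G}
    (hx : groupAlgebraRep σ x = 0) : groupAlgebraRep ρ x = 0 := by
  refine h.groupAlgebraRep_eq_zero x fun y => ?_
  rw [groupAlgebraRep_trace_mul ρ σ hc, map_mul, hx, zero_mul, Matrix.trace_zero]

/-- Irreducible representations with the same character are intertwined by a nonzero matrix. -/
theorem exists_intertwiner {ρ σ : G →* SL3} (hρ : IsIrreducibleRep ρ) (hσ : IsIrreducibleRep σ)
    (hc : character ρ = character σ) :
    ∃ J : Matrix (Fin 3) (Fin 3) ℂ, J ≠ 0 ∧ ∀ g, J * ρ g = σ g * J := by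
  -- The element `x j` lifts the matrix unit with entry (j, 0). The matrix units of column 0 span a
  -- copy of `ρ`, so e_j ↦ σ(x j) w is equivariant for every `w`.
  choose x hx using fun j : Fin 3 => hρ.groupAlgebraRep_surjective (Matrix.single j 0 1)
  have hx0 : groupAlgebraRep σ (x 0) ≠ 0 := by
    intro h0
    have := hρ.groupAlgebraRep_eq_zero_of_character_eq hc h0
    rw [hx] at this
    have := congrFun (congrFun this 0) 0
    simp at this
  obtain ⟨w, hw⟩ : ∃ w, groupAlgebraRep σ (x 0) *ᵥ w ≠ 0 := by
    by_contra! hall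
    exact hx0 (Matrix.toLin'.injective (LinearMap.ext fun w => by simpa using hall w))
  refine ⟨Matrix.of fun i j => (groupAlgebraRep σ (x j) *ᵥ w) i, fun hJ => hw ?_, fun g => ?_⟩
  · funext i
    exact congrFun (congrFun hJ i) 0
  · have key (j : Fin 3) : (σ g : Matrix (Fin 3) (Fin 3) ℂ) * groupAlgebraRep σ (x j)
        = ∑ i, (ρ g : Matrix (Fin 3) (Fin 3) ℂ) i j • groupAlgebraRep σ (x i) := by
      have h0 : groupAlgebraRep ρ (MonoidAlgebra.of ℂ G g * x j -
          ∑ i, (ρ g : Matrix (Fin 3) (Fin 3) ℂ) i j • x i) = 0 := by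
        rw [map_sub, map_mul, groupAlgebraRep_of, map_sum, sub_eq_zero]
        simp only [map_smul, hx]
        ext k l
        rw [Matrix.sum_apply]
        by_cases hl : l = 0
        · subst hl
          simp [Matrix.single_apply]
        · rw [Matrix.mul_single_apply_of_ne _ _ _ _ _ hl]
          simp [Ne.symm hl]
      have h1 := hσ.groupAlgebraRep_eq_zero_of_character_eq hc.symm h0
      rw [map_sub, map_mul, groupAlgebraRep_of, map_sum, sub_eq_zero] at h1
      simpa only [map_smul] using h1
    ext i j
    have h2 := congrFun (congrArg (· *ᵥ w) (key j)) i
    simp only [← Matrix.mulVec_mulVec, Matrix.sum_mulVec, Matrix.smul_mulVec, Finset.sum_apply,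
      Pi.smul_apply, smul_eq_mul] at h2
    rw [Matrix.mul_apply, Matrix.mul_apply]
    simp only [Matrix.of_apply]
    rw [Matrix.mulVec, dotProduct] at h2
    rw [h2]
    exact Finset.sum_congr rfl fun k _ => mul_comm _ _

/-- Schur's lemma. -/
theorem IsIrreducibleRep.exists_eq_smul_one {ρ : G →* SL3} (h : IsIrreducibleRep ρ)
    (M : Matrix (Fin 3) (Fin 3) ℂ) (hM : ∀ g, M * ρ g = ρ g * M) : ∃ c : ℂ, M = c • 1 := by
  have hall (N : Matrix (Fin 3) (Fin 3) ℂ) : M * N = N * M := by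
    obtain ⟨x, rfl⟩ := h.groupAlgebraRep_surjective N
    induction x using MonoidAlgebra.induction_on with
    | of g => rw [groupAlgebraRep_of]; exact hM g
    | add x y hx hy => rw [map_add, mul_add, add_mul, hx, hy]
    | smul r x hx => rw [map_smul, mul_smul_comm, smul_mul_assoc, hx]
  refine ⟨M 0 0, Matrix.ext fun i j => ?_⟩
  have h1 := congrFun (congrFun (hall (Matrix.single j 0 1)) i) 0
  rw [Matrix.mul_single_apply_same] at h1
  by_cases hij : i = j
  · subst hij
    rw [Matrix.single_mul_apply_same] at h1
    simpa using h1
  · rw [Matrix.single_mul_apply_of_ne _ _ _ _ _ hij] at h1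
    simpa [hij] using h1

/-- If the character of an irreducible representation is also the character of a representation in
which `c` acts centrally, then `c` acts by a scalar. -/
theorem IsIrreducibleRep.exists_eq_smul_one_of_character_eq {ρ σ : G →* SL3}
    (h : IsIrreducibleRep ρ) (hc : character ρ = character σ) (c : G)
    (hcent : ∀ g, σ c * σ g = σ g * σ c) :
    ∃ z : ℂ, (ρ c : Matrix (Fin 3) (Fin 3) ℂ) = z • 1 := by
  refine h.exists_eq_smul_one _ fun g => ?_
  have := h.groupAlgebraRep_eq_zero_of_character_eq hc
    (x := MonoidAlgebra.of ℂ G (c * g) - MonoidAlgebra.of ℂ G (g * c)) (by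
      rw [map_sub, groupAlgebraRep_of, groupAlgebraRep_of, map_mul, map_mul, hcent, sub_self])
  rw [map_sub, groupAlgebraRep_of, groupAlgebraRep_of, sub_eq_zero] at this
  simpa using this

/-- The contragredient representation. -/
def dualRep (ρ : G →* SL3) : G →* SL3 where
  toFun g := (ρ g⁻¹).transpose
  map_one' := by ext i j; simp [Matrix.SpecialLinearGroup.transpose]
  map_mul' g h := by
    refine Subtype.ext ?_
    rw [_root_.mul_inv_rev, map_mul]
    exact Matrix.transpose_mul _ _

theorem tr_dualRep (ρ : G →* SL3) (g : G) : tr (dualRep ρ g) = tr (ρ g⁻¹) := by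
  exact Matrix.trace_transpose _

/-- All elements of the group have a common eigenvector. -/
def HasCommonEigenvector (ρ : G →* SL3) : Prop :=
  ∃ v : Fin 3 → ℂ, v ≠ 0 ∧ ∀ g, ∃ c : ℂ, (ρ g : Matrix (Fin 3) (Fin 3) ℂ) *ᵥ v = c • v

/-- An invariant subspace is a line or a plane. In the case of a plane, its annihilator is an
invariant line of the contragredient representation. -/
theorem hasCommonEigenvector_of_not_irreducible {ρ : G →* SL3} (h : ¬ IsIrreducibleRep ρ) :
    HasCommonEigenvector ρ ∨ HasCommonEigenvector (dualRep ρ) := by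
  simp only [IsIrreducibleRep, not_forall, not_or] at h
  obtain ⟨W, hW, hbot, htop⟩ := h
  have hlt : Module.finrank ℂ W < 3 := by
    have := Submodule.finrank_lt htop
    simpa using this
  have hpos : 0 < Module.finrank ℂ W := by
    rw [Nat.pos_iff_ne_zero]
    intro h0
    exact hbot (Submodule.finrank_eq_zero.1 h0)
  rcases (show Module.finrank ℂ W = 1 ∨ Module.finrank ℂ W = 2 by omega) with h1 | h2
  · left
    obtain ⟨⟨v, hv⟩, hv0, hspan⟩ := finrank_eq_one_iff'.1 h1
    refine ⟨v, fun h => hv0 (Subtype.ext h), fun g => ?_⟩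
    obtain ⟨c, hc⟩ := hspan ⟨_, hW g v hv⟩
    exact ⟨c, (congrArg Subtype.val hc).symm⟩
  · right
    obtain ⟨f, hf0, hf⟩ := Submodule.exists_le_ker_of_lt_top W (lt_top_iff_ne_top.2 htop)
    have hker : W = LinearMap.ker f := by
      refine Submodule.eq_of_le_of_finrank_le hf ?_
      have hlt' : Module.finrank ℂ (LinearMap.ker f) < 3 := by
        have := Submodule.finrank_lt (s := LinearMap.ker f) (by
          rwa [Ne, LinearMap.ker_eq_top])
        simpa using this
      omega
    obtain ⟨u, hu⟩ : ∃ u, f u ≠ 0 := by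
      by_contra! hall
      exact hf0 (LinearMap.ext hall)
    let φ : Fin 3 → ℂ := fun i => f (Pi.single i 1)
    have hφ (w : Fin 3 → ℂ) : f w = φ ⬝ᵥ w := by
      conv_lhs => rw [← Finset.univ_sum_single w, map_sum]
      refine Finset.sum_congr rfl fun i _ => ?_
      rw [← mul_one (w i), ← smul_eq_mul, Pi.single_smul', map_smul, smul_eq_mul, smul_eq_mul,
        mul_one, mul_comm]
    refine ⟨φ, fun h => hu (by rw [hφ, h, zero_dotProduct]), fun g => ?_⟩
    have hfg (w : Fin 3 → ℂ) : f ((ρ g⁻¹ : Matrix (Fin 3) (Fin 3) ℂ) *ᵥ w)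
        = (f ((ρ g⁻¹ : Matrix (Fin 3) (Fin 3) ℂ) *ᵥ u) / f u) * f w := by
      have hw : w - (f w / f u) • u ∈ W := by
        rw [hker, LinearMap.mem_ker]; simp [hu]
      have h3 := hW g⁻¹ _ hw
      rw [hker, LinearMap.mem_ker, Matrix.mulVec_sub, Matrix.mulVec_smul, map_sub, map_smul,
        sub_eq_zero, smul_eq_mul] at h3
      rw [h3]; ring
    refine ⟨f ((ρ g⁻¹ : Matrix (Fin 3) (Fin 3) ℂ) *ᵥ u) / f u, ?_⟩
    funext i
    have h4 := hfg (Pi.single i 1)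
    rw [hφ ((ρ g⁻¹ : Matrix (Fin 3) (Fin 3) ℂ) *ᵥ Pi.single i 1), Matrix.dotProduct_mulVec,
      dotProduct_single_one] at h4
    change ((ρ g⁻¹ : Matrix (Fin 3) (Fin 3) ℂ)ᵀ *ᵥ φ) i = _
    rw [Matrix.mulVec_transpose, h4]
    rfl

theorem IsIrreducibleRep.comp_of_surjective {H : Type*} [Group H] {ρ : G →* SL3}
    (h : IsIrreducibleRep ρ) (f : H →* G) (hf : Function.Surjective f) :
    IsIrreducibleRep (ρ.comp f) := fun W hW => h W fun g v hv => by
  obtain ⟨x, rfl⟩ := hf g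
  exact hW x v hv

end Irreducible

end FigEight

end

noncomputable section

namespace FigEight

open MvPolynomial

/-! ### Zariski closed sets -/

section Zariski

variable {σ τ : Type*}

theorem mem_zariskiClosure {S : Set (σ → ℂ)} {x : σ → ℂ} :
    x ∈ zariskiClosure S ↔ ∀ f : MvPolynomial σ ℂ, (∀ s ∈ S, eval s f = 0) → eval x f = 0 := by
  simp [zariskiClosure, mem_zeroLocus_iff, mem_vanishingIdeal_iff, aeval_eq_eval]

theorem subset_zariskiClosure (S : Set (σ → ℂ)) : S ⊆ zariskiClosure S :=
  fun _ hx => mem_zariskiClosure.2 fun _ hf => hf _ hx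

theorem isAlgebraicSet_zariskiClosure (S : Set (σ → ℂ)) : IsAlgebraicSet (zariskiClosure S) :=
  ⟨_, rfl⟩

theorem isAlgebraicSet_iff {V : Set (σ → ℂ)} : IsAlgebraicSet V ↔ zariskiClosure V ⊆ V := by
  constructor
  · rintro ⟨I, rfl⟩ x hx
    rw [mem_zeroLocus_iff]
    intro p hp
    rw [aeval_eq_eval]
    exact mem_zariskiClosure.1 hx p fun s hs => by
      have := mem_zeroLocus_iff.1 hs p hp
      rwa [aeval_eq_eval] at this
  · intro h
    exact ⟨_, Set.Subset.antisymm (subset_zariskiClosure V) h⟩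

theorem zariskiClosure_min {S A : Set (σ → ℂ)} (h : S ⊆ A) (hA : IsAlgebraicSet A) :
    zariskiClosure S ⊆ A := fun _ hx =>
  isAlgebraicSet_iff.1 hA (mem_zariskiClosure.2 fun f hf =>
    mem_zariskiClosure.1 hx f fun s hs => hf s (h hs))

theorem IsAlgebraicSet.exists_eval_ne_zero {A : Set (σ → ℂ)} (hA : IsAlgebraicSet A) {x : σ → ℂ}
    (hx : x ∉ A) : ∃ f : MvPolynomial σ ℂ, (∀ s ∈ A, eval s f = 0) ∧ eval x f ≠ 0 := by
  by_contra! h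
  exact hx (isAlgebraicSet_iff.1 hA (mem_zariskiClosure.2 h))

theorem isAlgebraicSet_of_forall {V : Set (σ → ℂ)}
    (h : ∀ x ∉ V, ∃ f : MvPolynomial σ ℂ, (∀ s ∈ V, eval s f = 0) ∧ eval x f ≠ 0) :
    IsAlgebraicSet V := by
  refine isAlgebraicSet_iff.2 fun x hx => ?_
  by_contra hxV
  obtain ⟨f, hf, hfx⟩ := h x hxV
  exact hfx (mem_zariskiClosure.1 hx f hf)

theorem isAlgebraicSet_setOf_eq (f g : MvPolynomial σ ℂ) :
    IsAlgebraicSet {x : σ → ℂ | eval x f = eval x g} :=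
  isAlgebraicSet_of_forall fun x hx => ⟨f - g, fun s hs => by simpa [sub_eq_zero] using hs,
    by simpa [sub_eq_zero] using hx⟩

theorem IsAlgebraicSet.inter {A B : Set (σ → ℂ)} (hA : IsAlgebraicSet A) (hB : IsAlgebraicSet B) :
    IsAlgebraicSet (A ∩ B) := by
  refine isAlgebraicSet_of_forall fun x hx => ?_
  by_cases hxA : x ∈ A
  · obtain ⟨f, hf, hfx⟩ := hB.exists_eval_ne_zero fun hxB => hx ⟨hxA, hxB⟩
    exact ⟨f, fun s hs => hf s hs.2, hfx⟩
  · obtain ⟨f, hf, hfx⟩ := hA.exists_eval_ne_zero hxA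
    exact ⟨f, fun s hs => hf s hs.1, hfx⟩

theorem isAlgebraicSet_iInter {ι : Type*} {A : ι → Set (σ → ℂ)} (hA : ∀ i, IsAlgebraicSet (A i)) :
    IsAlgebraicSet (⋂ i, A i) := by
  refine isAlgebraicSet_of_forall fun x hx => ?_
  simp only [Set.mem_iInter, not_forall] at hx
  obtain ⟨i, hi⟩ := hx
  obtain ⟨f, hf, hfx⟩ := (hA i).exists_eval_ne_zero hi
  exact ⟨f, fun s hs => hf s (Set.mem_iInter.1 hs i), hfx⟩

theorem IsAlgebraicSet.union {A B : Set (σ → ℂ)} (hA : IsAlgebraicSet A) (hB : IsAlgebraicSet B) :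
    IsAlgebraicSet (A ∪ B) := by
  refine isAlgebraicSet_of_forall fun x hx => ?_
  rw [Set.mem_union, not_or] at hx
  obtain ⟨f, hf, hfx⟩ := hA.exists_eval_ne_zero hx.1
  obtain ⟨g, hg, hgx⟩ := hB.exists_eval_ne_zero hx.2
  refine ⟨f * g, fun s hs => ?_, by simp [hfx, hgx]⟩
  rcases hs with hs | hs
  · simp [hf s hs]
  · simp [hg s hs]

theorem IsPolynomialMap.isAlgebraicSet_preimage {F : (σ → ℂ) → (τ → ℂ)} (hF : IsPolynomialMap F)
    {A : Set (τ → ℂ)} (hA : IsAlgebraicSet A) : IsAlgebraicSet (F ⁻¹' A) := by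
  obtain ⟨P, hP⟩ := hF
  have key (x : σ → ℂ) (f : MvPolynomial τ ℂ) : eval x (bind₁ P f) = eval (F x) f := by
    rw [← aeval_eq_eval, ← aeval_eq_eval, aeval_bind₁]
    congr 2
    funext i
    rw [hP x i, ← aeval_eq_eval]
  refine isAlgebraicSet_of_forall fun x hx => ?_
  obtain ⟨f, hf, hfx⟩ := hA.exists_eval_ne_zero hx
  exact ⟨bind₁ P f, fun s hs => by rw [key]; exact hf _ hs, by rwa [key]⟩

theorem isIrreducibleAlgebraicSet_of_mul {V : Set (σ → ℂ)} (hV : IsAlgebraicSet V)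
    (hne : V.Nonempty)
    (h : ∀ f g : MvPolynomial σ ℂ, (∀ s ∈ V, eval s f * eval s g = 0) →
      (∀ s ∈ V, eval s f = 0) ∨ ∀ s ∈ V, eval s g = 0) : IsIrreducibleAlgebraicSet V := by
  refine ⟨hV, hne, fun A B hA hB hAB => ?_⟩
  by_contra! hcon
  obtain ⟨⟨x, hxV, hxA⟩, ⟨y, hyV, hyB⟩⟩ := And.imp Set.not_subset.1 Set.not_subset.1 hcon
  obtain ⟨f, hf, hfx⟩ := hA.exists_eval_ne_zero hxA
  obtain ⟨g, hg, hgy⟩ := hB.exists_eval_ne_zero hyB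
  rcases h f g (fun s hs => by
    rcases hAB hs with hs | hs
    · simp [hf s hs]
    · simp [hg s hs]) with h | h
  · exact hfx (h x hxV)
  · exact hgy (h y hyV)

theorem IsIrreducibleAlgebraicSet.image {F : (σ → ℂ) → (τ → ℂ)} (hF : IsPolynomialMap F)
    {V : Set (σ → ℂ)} (hV : IsIrreducibleAlgebraicSet V) (hW : IsAlgebraicSet (F '' V)) :
    IsIrreducibleAlgebraicSet (F '' V) := by
  refine ⟨hW, hV.2.1.image F, fun A B hA hB hAB => ?_⟩
  rcases hV.2.2 _ _ (hF.isAlgebraicSet_preimage hA) (hF.isAlgebraicSet_preimage hB)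
    (fun x hx => hAB ⟨x, hx, rfl⟩) with h | h
  · exact Or.inl (Set.image_subset_iff.2 h)
  · exact Or.inr (Set.image_subset_iff.2 h)

theorem isAlgebraicSet_singleton (x : σ → ℂ) : IsAlgebraicSet {x} := by
  refine isAlgebraicSet_of_forall fun y hy => ?_
  obtain ⟨i, hi⟩ := Function.ne_iff.1 hy
  exact ⟨X i - C (x i), fun s hs => by simp [Set.mem_singleton_iff.1 hs],
    by simpa [sub_eq_zero] using hi⟩

theorem isAlgebraicSet_empty : IsAlgebraicSet (∅ : Set (σ → ℂ)) :=
  isAlgebraicSet_of_forall fun _ _ => ⟨1, by simp, by simp⟩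

theorem isAlgebraicSet_of_finite {S : Set (σ → ℂ)} (hS : S.Finite) : IsAlgebraicSet S := by
  induction S, hS using Set.Finite.induction_on with
  | empty => exact isAlgebraicSet_empty
  | insert _ _ ih => rw [Set.insert_eq]; exact (isAlgebraicSet_singleton _).union ih

/-- An irreducible set is the closure of the complement of a closed subset that it is not
contained in. -/
theorem IsIrreducibleAlgebraicSet.subset_zariskiClosure_diff {V A : Set (σ → ℂ)}
    (hV : IsIrreducibleAlgebraicSet V) (hA : IsAlgebraicSet A) (h : ¬ V ⊆ A) :
    V ⊆ zariskiClosure (V \ A) := by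
  refine (hV.2.2 _ A (isAlgebraicSet_zariskiClosure (V \ A)) hA fun x hx => ?_).resolve_right h
  by_cases hxA : x ∈ A
  · exact Or.inr hxA
  · exact Or.inl (subset_zariskiClosure _ ⟨hx, hxA⟩)

theorem irredComponents_union_three {V : Fin 3 → Set (σ → ℂ)}
    (hV : ∀ i, IsIrreducibleAlgebraicSet (V i)) (hne : ∀ i j, V i ⊆ V j → i = j) :
    irredComponents (V 0 ∪ V 1 ∪ V 2) = Set.range V := by
  have hsub (i : Fin 3) : V i ⊆ V 0 ∪ V 1 ∪ V 2 := by
    fin_cases i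
    · exact Set.subset_union_left.trans Set.subset_union_left
    · exact Set.subset_union_right.trans Set.subset_union_left
    · exact Set.subset_union_right
  have hle (U : Set (σ → ℂ)) (hU : IsIrreducibleAlgebraicSet U) (h : U ⊆ V 0 ∪ V 1 ∪ V 2) :
      ∃ i, U ⊆ V i := by
    rcases hU.2.2 _ _ ((hV 0).1.union (hV 1).1) (hV 2).1 h with h | h
    · rcases hU.2.2 _ _ (hV 0).1 (hV 1).1 h with h | h
      · exact ⟨0, h⟩
      · exact ⟨1, h⟩
    · exact ⟨2, h⟩
  ext U
  constructor
  · rintro ⟨⟨hU, hUV⟩, hmax⟩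
    obtain ⟨i, hi⟩ := hle U hU hUV
    exact ⟨i, Set.Subset.antisymm (hmax ⟨hV i, hsub i⟩ hi) hi⟩
  · rintro ⟨i, rfl⟩
    refine ⟨⟨hV i, hsub i⟩, fun W hW hiW => ?_⟩
    obtain ⟨j, hj⟩ := hle W hW.1 hW.2
    have := hne i j (hiW.trans hj)
    subst this
    exact hj

end Zariski

end FigEight

end

noncomputable section

namespace FigEight

open scoped Matrix

/-! ### The figure eight knot group -/

theorem t_mul_a : t * a * t⁻¹ = a * b := by
  have : (PresentedGroup.mk knotRelators) _ = 1 :=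
    PresentedGroup.one_of_mem (rels := knotRelators)
      (x := FreeGroup.of 2 * FreeGroup.of 0 * (FreeGroup.of 2)⁻¹ *
        (FreeGroup.of 0 * FreeGroup.of 1)⁻¹) (by simp [knotRelators])
  rw [map_mul, map_inv, mul_inv_eq_one] at this
  exact this

theorem t_mul_b : t * b * t⁻¹ = b * a * b := by
  have : (PresentedGroup.mk knotRelators) _ = 1 :=
    PresentedGroup.one_of_mem (rels := knotRelators)
      (x := FreeGroup.of 2 * FreeGroup.of 1 * (FreeGroup.of 2)⁻¹ *
        (FreeGroup.of 1 * FreeGroup.of 0 * FreeGroup.of 1)⁻¹) (by simp [knotRelators])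
  rw [map_mul, map_inv, mul_inv_eq_one] at this
  exact this

/-- A homomorphism from the knot group is given by elements that satisfy the two relations. -/
def knotLift {H : Type*} [Group H] (A B T : H) (h₁ : T * A * T⁻¹ = A * B)
    (h₂ : T * B * T⁻¹ = B * A * B) : KnotGroup →* H :=
  PresentedGroup.toGroup (f := ![A, B, T]) (by
    rintro r (rfl | rfl)
    · simp only [map_mul, map_inv, FreeGroup.lift_apply_of]
      simp [h₁]
    · simp only [map_mul, map_inv, FreeGroup.lift_apply_of]
      simp [h₂])

section knotLift

variable {H : Type*} [Group H] {A B T : H} (h₁ : T * A * T⁻¹ = A * B) (h₂ : T * B * T⁻¹ = B * A * B)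

@[simp] theorem knotLift_a : knotLift A B T h₁ h₂ a = A := PresentedGroup.toGroup.of _
@[simp] theorem knotLift_b : knotLift A B T h₁ h₂ b = B := PresentedGroup.toGroup.of _
@[simp] theorem knotLift_t : knotLift A B T h₁ h₂ t = T := PresentedGroup.toGroup.of _

end knotLift

theorem b_eq : b = a⁻¹ * t * a * t⁻¹ := by
  rw [mul_assoc, mul_assoc, ← mul_assoc t, t_mul_a]; simp

theorem knotGroup_hom_ext {H : Type*} [Group H] {f g : KnotGroup →* H} (ha : f a = g a)
    (ht : f t = g t) : f = g := by
  have hb : f b = g b := by rw [b_eq]; simp [ha, ht]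
  refine PresentedGroup.ext fun i => ?_
  fin_cases i
  · exact ha
  · exact hb
  · exact ht

theorem closure_a_t : Subgroup.closure {a, t} = (⊤ : Subgroup KnotGroup) := by
  have ha : a ∈ Subgroup.closure {a, t} := Subgroup.subset_closure (by simp)
  have ht : t ∈ Subgroup.closure {a, t} := Subgroup.subset_closure (by simp)
  have hb : b ∈ Subgroup.closure {a, t} := by
    rw [b_eq]
    exact mul_mem (mul_mem (mul_mem (inv_mem ha) ht) ha) (inv_mem ht)
  rw [eq_top_iff, ← PresentedGroup.closure_range_of, Subgroup.closure_le]
  rintro _ ⟨i, rfl⟩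
  fin_cases i
  · exact ha
  · exact hb
  · exact ht

theorem t_inv_mul_a {H : Type*} [Group H] {A B T : H} (h₁ : T * A * T⁻¹ = A * B)
    (h₂ : T * B * T⁻¹ = B * A * B) : T⁻¹ * A * T = A * A * B⁻¹ := by
  have h₃ : T * (A * A * B⁻¹) * T⁻¹ = A := by
    calc T * (A * A * B⁻¹) * T⁻¹
        = (T * A * T⁻¹) * (T * A * T⁻¹) * (T * B * T⁻¹)⁻¹ := by group
      _ = A := by rw [h₁, h₂]; group
  calc T⁻¹ * A * T = T⁻¹ * (T * (A * A * B⁻¹) * T⁻¹) * T := by rw [h₃]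
    _ = A * A * B⁻¹ := by group

theorem t_inv_mul_b {H : Type*} [Group H] {A B T : H} (h₁ : T * A * T⁻¹ = A * B)
    (h₂ : T * B * T⁻¹ = B * A * B) : T⁻¹ * B * T = B * A⁻¹ := by
  have h₃ : T * (B * A⁻¹) * T⁻¹ = B := by
    calc T * (B * A⁻¹) * T⁻¹
        = (T * B * T⁻¹) * (T * A * T⁻¹)⁻¹ := by group
      _ = B := by rw [h₁, h₂]; group
  calc T⁻¹ * B * T = T⁻¹ * (T * (B * A⁻¹) * T⁻¹) * T := by rw [h₃]
    _ = B * A⁻¹ := by group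

/-- The orientation reversing symmetry of the knot group. -/
def flipHom : KnotGroup →* KnotGroup :=
  knotLift (a * b * a⁻¹) a⁻¹ t⁻¹
    (by
      calc t⁻¹ * (a * b * a⁻¹) * t⁻¹⁻¹
          = (t⁻¹ * a * t) * (t⁻¹ * b * t) * (t⁻¹ * a * t)⁻¹ := by group
        _ = _ := by rw [t_inv_mul_a t_mul_a t_mul_b, t_inv_mul_b t_mul_a t_mul_b]; group)
    (by
      calc t⁻¹ * a⁻¹ * t⁻¹⁻¹ = (t⁻¹ * a * t)⁻¹ := by group
        _ = _ := by rw [t_inv_mul_a t_mul_a t_mul_b]; group)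

/-- The inverse of `flipHom`. -/
def flipInvHom : KnotGroup →* KnotGroup :=
  knotLift b⁻¹ (b * a * b⁻¹) t⁻¹
    (by
      calc t⁻¹ * b⁻¹ * t⁻¹⁻¹ = (t⁻¹ * b * t)⁻¹ := by group
        _ = _ := by rw [t_inv_mul_b t_mul_a t_mul_b]; group)
    (by
      calc t⁻¹ * (b * a * b⁻¹) * t⁻¹⁻¹
          = (t⁻¹ * b * t) * (t⁻¹ * a * t) * (t⁻¹ * b * t)⁻¹ := by group
        _ = _ := by rw [t_inv_mul_a t_mul_a t_mul_b, t_inv_mul_b t_mul_a t_mul_b]; group)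

/-- The orientation reversing symmetry of the knot group, as an automorphism. -/
def flip : KnotGroup ≃* KnotGroup :=
  MonoidHom.toMulEquiv flipHom flipInvHom
    (knotGroup_hom_ext (by simp [flipHom, flipInvHom]; group) (by simp [flipHom, flipInvHom]))
    (knotGroup_hom_ext (by simp [flipHom, flipInvHom]) (by simp [flipHom, flipInvHom]))

@[simp] theorem flip_a : flip a = a * b * a⁻¹ := by simp [flip, flipHom]
@[simp] theorem flip_b : flip b = a⁻¹ := by simp [flip, flipHom]
@[simp] theorem flip_t : flip t = t⁻¹ := by simp [flip, flipHom]

theorem flip_longitude : flip longitude = longitude := by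
  simp only [longitude, map_mul, map_inv, flip_a, flip_b]
  group

/-- The endomorphism of the knot group that inverts `a` and `b`. -/
def fibreInversion : KnotGroup →* KnotGroup :=
  knotLift a⁻¹ b⁻¹ (t * b)
    (by
      calc t * b * a⁻¹ * (t * b)⁻¹
          = (t * b * t⁻¹) * (t * a * t⁻¹)⁻¹ * (t * b * t⁻¹)⁻¹ := by group
        _ = _ := by rw [t_mul_a, t_mul_b]; group)
    (by
      calc t * b * b⁻¹ * (t * b)⁻¹ = (t * b * t⁻¹)⁻¹ := by group
        _ = _ := by rw [t_mul_b]; group)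

@[simp] theorem fibreInversion_a : fibreInversion a = a⁻¹ := knotLift_a _ _
@[simp] theorem fibreInversion_b : fibreInversion b = b⁻¹ := knotLift_b _ _
@[simp] theorem fibreInversion_t : fibreInversion t = t * b := knotLift_t _ _

theorem fibreInversion_surjective : Function.Surjective fibreInversion := by
  rw [← MonoidHom.range_eq_top, eq_top_iff, ← closure_a_t, Subgroup.closure_le]
  rintro _ (rfl | rfl)
  · exact ⟨a⁻¹, by simp⟩
  · exact ⟨t * b, by simp⟩

/-! ### Trace relations for representations of the knot group -/

theorem tr_inv_eq_of_conj {A B : SL3} (C : SL3) (h : C * A = B * C) : tr A⁻¹ = tr B⁻¹ := by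
  refine tr_eq_of_conj C ?_
  rw [eq_inv_mul_iff_mul_eq, ← mul_assoc, ← h, mul_inv_cancel_right]

/-- The characteristic polynomial is λ³ - 1. -/
theorem sq_eq_of_tr {g : SL3} (h : tr g = 0) (h' : tr g⁻¹ = 0) : g ^ 3 = 1 := by
  have key : g * g = g⁻¹ := by
    refine Subtype.ext ?_
    have := coe_mul_mul_self g 1
    simp only [mul_one, tr_one, h, h'] at this
    rw [Matrix.SpecialLinearGroup.coe_mul]
    rw [Matrix.SpecialLinearGroup.coe_one, mul_one, mul_one, one_mul] at this
    rw [this]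
    module
  rw [pow_succ, pow_two, key, inv_mul_cancel]

/-- The characteristic polynomial λ³ - λ² + λ - 1 = (λ - 1)(λ² + 1) divides λ⁴ - 1. -/
theorem pow_four_eq_of_tr {g : SL3} (h : tr g = 1) (h' : tr g⁻¹ = 1) : g ^ 4 = 1 := by
  have key : (g * g : Matrix (Fin 3) (Fin 3) ℂ) = (g⁻¹ : SL3) + (g : Matrix (Fin 3) (Fin 3) ℂ) - 1 := by
    have := coe_mul_mul_self g 1
    simp only [mul_one, tr_one, h, h'] at this
    rw [Matrix.SpecialLinearGroup.coe_one, mul_one, mul_one, one_mul] at this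
    rw [this]
    module
  have hg : ((g⁻¹ : SL3) : Matrix (Fin 3) (Fin 3) ℂ) * g = 1 := by
    rw [← Matrix.SpecialLinearGroup.coe_mul, inv_mul_cancel, Matrix.SpecialLinearGroup.coe_one]
  have key3 : g * g * g = g⁻¹ := by
    refine Subtype.ext ?_
    rw [Matrix.SpecialLinearGroup.coe_mul, Matrix.SpecialLinearGroup.coe_mul, key, sub_mul, add_mul,
      hg, key, one_mul]
    abel
  rw [pow_succ, pow_succ, pow_two, key3, inv_mul_cancel]

section relations

variable {A B T : SL3} (h₁ : T * A * T⁻¹ = A * B) (h₂ : T * B * T⁻¹ = B * A * B)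
include h₁ h₂

/-- The monodromy makes A conjugate to AB, B to BAB, and AB⁻¹ to B⁻¹. The Cayley-Hamilton identities
for the squares of B, B⁻¹ and AB then contain only tr A, tr B and the traces of their inverses, and
they factor. These products are the source of the three components. -/
theorem tr_fibre_relations :
    (tr B - tr B⁻¹) * (1 - tr A) = 0 ∧ (tr B - tr B⁻¹) * (1 - tr A⁻¹) = 0 ∧
      (tr A - tr A⁻¹) * (1 - tr B) = 0 := by
  have e1 : tr (A * B) = tr A := by rw [← h₁, tr_conj]
  have e1' : tr (A * B)⁻¹ = tr A⁻¹ := by rw [← h₁]; simp [← mul_assoc, tr_conj]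
  have e2 : tr (B * A * B) = tr B := by rw [← h₂, tr_conj]
  have e2' : tr (B * A * B)⁻¹ = tr B⁻¹ := by rw [← h₂]; simp [← mul_assoc, tr_conj]
  have c : T * (A * B⁻¹) = B⁻¹ * T := by
    calc T * (A * B⁻¹) = (T * A * T⁻¹) * (T * B * T⁻¹)⁻¹ * T := by group
      _ = _ := by rw [h₁, h₂]; group
  have e3 : tr (A * B⁻¹) = tr B⁻¹ := tr_eq_of_conj T c
  have e3' : tr (B * A⁻¹) = tr B := by
    have := tr_inv_eq_of_conj T c
    simpa using this
  have e4 : tr (A * B * B * A * B) = tr A := by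
    rw [← e1]
    refine (tr_eq_of_conj T ?_).symm
    calc T * (A * B) = (T * A * T⁻¹) * (T * B * T⁻¹) * T := by group
      _ = _ := by rw [h₁, h₂]; group
  refine ⟨?_, ?_, ?_⟩
  · have h := tr_mul_self_mul B A
    rw [tr_mul_comm (B * B) A, ← mul_assoc, tr_mul_comm (A * B) B, ← mul_assoc, e2,
      tr_mul_comm B A, e1, tr_mul_comm B⁻¹ A, e3] at h
    linear_combination h
  · have h := tr_mul_self_mul B⁻¹ A⁻¹
    have h5 : tr (B⁻¹ * B⁻¹ * A⁻¹) = tr B⁻¹ := by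
      rw [← e2']
      exact tr_eq_of_conj B (by group)
    have h6 : tr (B⁻¹ * A⁻¹) = tr A⁻¹ := by rw [← e1', mul_inv_rev]
    rw [inv_inv, h5, h6, e3'] at h
    linear_combination -h
  · have h := tr_mul_self_mul (A * B) B
    have h5 : tr (A * B * (A * B) * B) = tr A := by
      rw [← e4]
      exact tr_eq_of_conj (A * B * B) (by group)
    have h6 : tr (A * B * B) = tr B := by
      rw [← e2, tr_mul_comm (B * A) B, ← mul_assoc]
      exact tr_eq_of_conj (B * B) (by group)
    have h7 : tr ((A * B)⁻¹ * B) = tr A⁻¹ := by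
      refine tr_eq_of_conj B ?_
      group
    rw [h5, e1, h6, e1', h7] at h
    linear_combination h

theorem tr_meridian_relations :
    tr (A * T) = tr T ∧ tr (A * T)⁻¹ = tr T⁻¹ ∧ tr (B * T) = tr T ∧ tr (B * T)⁻¹ = tr T⁻¹ := by
  have hTA : T * A = A * B * T := by rw [← h₁]; group
  have c₁ : B * (T * A) = T * B := by
    calc B * (T * A) = (B * A * B) * T := by rw [hTA]; group
      _ = _ := by rw [← h₂]; group
  have c₂ : A * (B * T) = T * A := by rw [hTA]; group
  have c₃ : T * (A * T) = (T * A) * T := by group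
  exact ⟨(tr_eq_of_conj T c₃).trans (tr_eq_of_conj B c₁),
    (tr_inv_eq_of_conj T c₃).trans (tr_inv_eq_of_conj B c₁),
    tr_eq_of_conj A c₂, tr_inv_eq_of_conj A c₂⟩

/-- Representations with symmetric values on the fibre have a character that is invariant under
`fibreInversion`. -/
theorem tenTraces_fibreInversion (hA : tr A = tr A⁻¹) (hB : tr B = tr B⁻¹) :
    tenTraces A⁻¹ (T * B) = tenTraces A T := by
  obtain ⟨m₁, m₁', m₂, m₂'⟩ := tr_meridian_relations h₁ h₂
  have hTB : T * B = B * A * B * T := by rw [← h₂]; group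
  have c₁ : B * (T * B) = (B * T) * B := by group
  have c₂ : T * (B * (A⁻¹ * (T * B))) = B * T * (T * B) := by
    calc T * (B * (A⁻¹ * (T * B))) = (T * B * T⁻¹) * (T * A * T⁻¹)⁻¹ * T * (T * B) := by group
      _ = _ := by rw [h₁, h₂]; group
  have c₃ : B * (A⁻¹ * (T * B)) = (B * A⁻¹ * T) * B := by group
  have c₄ : T * (B * A⁻¹ * T) = (B * T) * T := by
    calc T * (B * A⁻¹ * T) = (T * B * T⁻¹) * (T * A * T⁻¹)⁻¹ * T * T := by group
      _ = _ := by rw [h₁, h₂]; group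
  have hAT : A * T = T * (A * A * B⁻¹) := by rw [← t_inv_mul_a h₁ h₂]; group
  have c₅ : B * (A * (T * B)) = (B * T * (A * A * B⁻¹)) * B := by
    calc B * (A * (T * B)) = B * (A * T) * B := by group
      _ = _ := by rw [hAT]; group
  have c₆ : B⁻¹ * (B * T * (A * A * B⁻¹)) = (T * (A * A)) * B⁻¹ := by group
  have e₀ : tr (T * B) = tr T := (tr_eq_of_conj B c₁).trans m₂
  have e₀' : tr (T * B)⁻¹ = tr T⁻¹ := (tr_inv_eq_of_conj B c₁).trans m₂'
  have e₁ : tr (A⁻¹ * (T * B)) = tr T :=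
    ((tr_eq_of_conj B c₃).trans (tr_eq_of_conj T c₄)).trans m₂
  have e₁' : tr (A⁻¹ * (T * B))⁻¹ = tr T⁻¹ :=
    ((tr_inv_eq_of_conj B c₃).trans (tr_inv_eq_of_conj T c₄)).trans m₂'
  have e₂ : tr (A * (T * B)) = tr (A⁻¹ * T) := by
    rw [tr_eq_of_conj B c₅, tr_eq_of_conj B⁻¹ c₆, tr_mul_comm, tr_mul_self_mul, m₁, hA]
    ring
  have e₂' : tr (A⁻¹ * (T * B)⁻¹) = tr (A * T⁻¹) := by
    have h := tr_inv_eq_of_conj B c₅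
    rw [tr_inv_eq_of_conj B⁻¹ c₆] at h
    have h' : tr (A⁻¹ * (T * B)⁻¹) = tr (A * (T * B))⁻¹ := by
      rw [tr_mul_comm, mul_inv_rev A]
    have h'' : tr (T * (A * A))⁻¹ = tr (A⁻¹ * A⁻¹ * T⁻¹) := by
      congr 1; group
    have m : tr (A⁻¹ * T⁻¹) = tr T⁻¹ := by rw [← m₁', mul_inv_rev, tr_mul_comm]
    rw [h', h, h'', tr_mul_self_mul, inv_inv, m, hA]
    ring
  have e₃ : A⁻¹ * (T * B) * A⁻¹⁻¹ * (T * B)⁻¹ = A⁻¹ * B * A := by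
    calc A⁻¹ * (T * B) * A⁻¹⁻¹ * (T * B)⁻¹
        = A⁻¹ * ((T * B * T⁻¹) * (T * A * T⁻¹) * (T * B * T⁻¹)⁻¹) := by group
      _ = _ := by rw [h₁, h₂]; group
  have e₄ : A * T * A⁻¹ * T⁻¹ = A * B⁻¹ * A⁻¹ := by
    calc A * T * A⁻¹ * T⁻¹ = A * (T * A * T⁻¹)⁻¹ := by group
      _ = _ := by rw [h₁]; group
  have e₅ : T * B * A⁻¹ * (T * B)⁻¹ * A⁻¹⁻¹ = A⁻¹ * B⁻¹ * A := by
    calc T * B * A⁻¹ * (T * B)⁻¹ * A⁻¹⁻¹ = (A⁻¹ * (T * B) * A⁻¹⁻¹ * (T * B)⁻¹)⁻¹ := by group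
      _ = _ := by rw [e₃]; group
  have e₆ : T * A * T⁻¹ * A⁻¹ = A * B * A⁻¹ := by rw [h₁]
  have f₁ : tr (A⁻¹ * B * A) = tr B := by simpa using tr_conj A⁻¹ B
  have f₂ : tr (A⁻¹ * B⁻¹ * A) = tr B⁻¹ := by simpa using tr_conj A⁻¹ B⁻¹
  simp only [tenTraces]
  rw [e₀, e₀', e₁, e₁', e₃, e₅, e₄, e₆, m₁, m₁', f₁, f₂, tr_conj, tr_conj, e₂', inv_inv, e₂, ← hA,
    ← hB]

/-- Vanishing of the traces that correspond to the generators of the triangle group. -/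
theorem tr_eq_zero_of_tr_eq_one (hA : tr A = 1) (hA' : tr A⁻¹ = 1) (hB : tr B ≠ 1) :
    tr (A⁻¹ * T) = 0 ∧ tr (A⁻¹ * T)⁻¹ = 0 ∧ tr (A⁻¹ * T * T) = 0 ∧ tr (A⁻¹ * T * T)⁻¹ = 0 := by
  obtain ⟨m₁, m₁', m₂, m₂'⟩ := tr_meridian_relations h₁ h₂
  have hBT : B * T = A⁻¹ * T * A := by
    calc B * T = A⁻¹ * (A * B) * T := by group
      _ = _ := by rw [← h₁]; group
  have e₁ : B⁻¹ * A⁻¹ * B⁻¹ * T = T * B⁻¹ := by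
    calc B⁻¹ * A⁻¹ * B⁻¹ * T = (B * A * B)⁻¹ * T := by group
      _ = _ := by rw [← h₂]; group
  have e₂ : tr (B * A⁻¹ * T) = tr T := by
    rw [← t_inv_mul_b h₁ h₂, ← m₂]
    exact tr_eq_of_conj T (by group)
  have e₃ : tr (A⁻¹ * B * T) = tr (A⁻¹ * T) := by
    rw [mul_assoc, hBT]
    exact tr_eq_of_conj A (by group)
  have e₄ : tr (B⁻¹ * A⁻¹) = 1 := by
    rw [← mul_inv_rev, ← h₁, ← hA']
    exact tr_inv_eq_of_conj T⁻¹ (by group)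
  have e₅ : tr (B * A⁻¹) = tr B := by
    rw [← t_inv_mul_b h₁ h₂]
    exact tr_eq_of_conj T (by group)
  -- All other terms cancel and tr(A⁻¹T)(tr B - 1) = 0 remains. This is where tr B ≠ 1 enters.
  have h := tr_mul_mul_mul B⁻¹ A⁻¹ T
  rw [inv_inv, e₁, e₂, e₃, e₄, e₅, m₂, hA', tr_mul_comm T] at h
  have hg : tr (A⁻¹ * T) = 0 := by
    have : tr (A⁻¹ * T) * (tr B - 1) = 0 := by linear_combination -h
    exact (mul_eq_zero.1 this).resolve_right (sub_ne_zero.2 hB)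
  have hTTA : tr (T * T * A⁻¹) = 0 := by
    have h := tr_mul_self_mul T A⁻¹
    have m : tr (T⁻¹ * A⁻¹) = tr T⁻¹ := by rw [← m₁', mul_inv_rev]
    rw [tr_mul_comm T A⁻¹, hg, hA', m] at h
    rw [h]; ring
  -- In the Cayley-Hamilton identity for A multiplied by TA⁻¹T, the terms with A² and A have equal
  -- traces and tr(TA⁻¹T) = 0. What is left is -2 tr (A⁻¹T)⁻¹ = 0.
  have hK : tr (A⁻¹ * T)⁻¹ = 0 := by
    have h := tr_mul_self_mul A (T * (A⁻¹ * T))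
    have f₁ : tr (A * A * (T * (A⁻¹ * T))) = tr (A * (T * (A⁻¹ * T))) := by
      have hTA : T * A = A * B * T := by rw [← h₁]; group
      have hTB : T * B = B * A * B * T := by rw [← h₂]; group
      have e₆ : A⁻¹ * T * (A * A * T) = T * (A⁻¹ * T * A) := by
        calc A⁻¹ * T * (A * A * T) = (A⁻¹ * T * A) * (A * T) := by group
          _ = B * (T * A) * T := by rw [← hBT]; group
          _ = (B * A * B * T) * T := by rw [hTA]; group
          _ = T * (A⁻¹ * T * A) := by rw [← hTB, ← hBT]; group
      rw [tr_eq_of_conj (A := A * A * (T * (A⁻¹ * T))) (B := A⁻¹ * T * (A * A * T)) (A⁻¹ * T)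
        (by group), e₆]
      exact tr_eq_of_conj A (by group)
    have f₂ : tr (A⁻¹ * (T * (A⁻¹ * T))) = - 2 * tr (A⁻¹ * T)⁻¹ := by
      have h := tr_mul_self_mul (A⁻¹ * T) 1
      rw [mul_one, mul_one, mul_one, hg, tr_one] at h
      rw [show A⁻¹ * (T * (A⁻¹ * T)) = A⁻¹ * T * (A⁻¹ * T) by group, h]
      ring
    have f₃ : tr (T * (A⁻¹ * T)) = 0 := by
      rw [← hTTA]
      exact tr_eq_of_conj T (by group)
    rw [f₁, f₂, f₃, hA, hA'] at h
    linear_combination h / 2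
  have hg' : tr (T⁻¹ * A) = 0 := by rw [← hK]; congr 1; group
  refine ⟨hg, hK, ?_, ?_⟩
  · rw [← hTTA, mul_assoc, tr_mul_comm]
  · have h := tr_mul_self_mul T⁻¹ A
    rw [hg', hA, inv_inv, tr_mul_comm T A, m₁] at h
    rw [show (A⁻¹ * T * T)⁻¹ = T⁻¹ * T⁻¹ * A by group, h]
    ring

end relations

end FigEight

end

noncomputable section

namespace FigEight

open scoped Matrix

/-! ### Representations of the triangle group `D(3, 3, 4)` -/

/-- First generator of the triangle group. -/
def kGen : TriangleGroup 3 3 4 := PresentedGroup.of 0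

/-- Second generator of the triangle group. -/
def lGen : TriangleGroup 3 3 4 := PresentedGroup.of 1

/-- A homomorphism from the triangle group is given by elements that satisfy the relations. -/
def triangleLift {H : Type*} [Group H] (K L : H) (hK : K ^ 3 = 1) (hL : L ^ 3 = 1)
    (hKL : (K * L) ^ 4 = 1) : TriangleGroup 3 3 4 →* H :=
  PresentedGroup.toGroup (f := ![K, L]) (by
    rintro r (rfl | rfl | rfl)
    · simpa using hK
    · simpa using hL
    · simpa using hKL)

@[simp] theorem triangleLift_kGen {H : Type*} [Group H] {K L : H} (hK : K ^ 3 = 1) (hL : L ^ 3 = 1)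
    (hKL : (K * L) ^ 4 = 1) : triangleLift K L hK hL hKL kGen = K := PresentedGroup.toGroup.of _

@[simp] theorem triangleLift_lGen {H : Type*} [Group H] {K L : H} (hK : K ^ 3 = 1) (hL : L ^ 3 = 1)
    (hKL : (K * L) ^ 4 = 1) : triangleLift K L hK hL hKL lGen = L := PresentedGroup.toGroup.of _

theorem kGen_pow : kGen ^ 3 = 1 := by
  have := PresentedGroup.one_of_mem (rels := ({FreeGroup.of 0 ^ 3, FreeGroup.of 1 ^ 3,
    (FreeGroup.of 0 * FreeGroup.of 1) ^ 4} : Set (FreeGroup (Fin 2)))) (x := FreeGroup.of 0 ^ 3)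
    (by simp)
  rwa [map_pow] at this

theorem lGen_pow : lGen ^ 3 = 1 := by
  have := PresentedGroup.one_of_mem (rels := ({FreeGroup.of 0 ^ 3, FreeGroup.of 1 ^ 3,
    (FreeGroup.of 0 * FreeGroup.of 1) ^ 4} : Set (FreeGroup (Fin 2)))) (x := FreeGroup.of 1 ^ 3)
    (by simp)
  rwa [map_pow] at this

theorem kGen_mul_lGen_pow : (kGen * lGen) ^ 4 = 1 := by
  have := PresentedGroup.one_of_mem (rels := ({FreeGroup.of 0 ^ 3, FreeGroup.of 1 ^ 3,
    (FreeGroup.of 0 * FreeGroup.of 1) ^ 4} : Set (FreeGroup (Fin 2))))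
    (x := (FreeGroup.of 0 * FreeGroup.of 1) ^ 4) (by simp)
  rwa [map_pow, map_mul] at this

/-- Solving k = a⁻¹t, l = a⁻¹t² gives t = k⁻¹l, a = k⁻¹lk⁻¹ and, from the first knot relation, b =
lk⁻¹l⁻¹k. The first relation then holds freely, and only the second one needs the relators of
D(3,3,4). -/
theorem knot_relation_of_triangle {H : Type*} [Group H] {K L : H} (hK : K ^ 3 = 1)
    (hL : L ^ 3 = 1) (hKL : (K * L) ^ 4 = 1) :
    K⁻¹ * L * (L * K⁻¹ * L⁻¹ * K) * (K⁻¹ * L)⁻¹ =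
      L * K⁻¹ * L⁻¹ * K * (K⁻¹ * L * K⁻¹) * (L * K⁻¹ * L⁻¹ * K) := by
  have e₁ : L * L = L⁻¹ := by rw [eq_inv_iff_mul_eq_one, ← hL, pow_three']
  have e₂ : K⁻¹ * K⁻¹ = K := by
    rw [← mul_inv_rev, inv_eq_iff_mul_eq_one, ← hK, pow_three']
  have e₃ : K⁻¹ * L⁻¹ * K⁻¹ * L⁻¹ = L * K * L * K := by
    have : L * K * L * K * (L * K * L * K) = 1 := by
      calc L * K * L * K * (L * K * L * K) = L * (K * L) ^ 4 * L⁻¹ := by simp [pow_succ, mul_assoc]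
        _ = 1 := by rw [hKL]; group
    rw [eq_comm, eq_comm, ← inv_inj, eq_comm, ← mul_eq_one_iff_eq_inv.1 this]
    group
  calc K⁻¹ * L * (L * K⁻¹ * L⁻¹ * K) * (K⁻¹ * L)⁻¹
      = K⁻¹ * (L * L) * K⁻¹ * L⁻¹ * K * L⁻¹ * K := by group
    _ = L * K * L * K * K * L⁻¹ * K := by rw [e₁, e₃]
    _ = L * (K⁻¹ * K⁻¹) * L * (K⁻¹ * K⁻¹) * (K⁻¹ * K⁻¹) * L⁻¹ * K := by rw [e₂]
    _ = L * K⁻¹ * (K⁻¹ * L * K⁻¹) * (K ^ 3)⁻¹ * L⁻¹ * K := by group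
    _ = _ := by rw [hK]; group

/-- The surjection of the knot group onto the triangle group. -/
def toTriangle : KnotGroup →* TriangleGroup 3 3 4 :=
  knotLift (kGen⁻¹ * lGen * kGen⁻¹) (lGen * kGen⁻¹ * lGen⁻¹ * kGen) (kGen⁻¹ * lGen) (by group)
    (knot_relation_of_triangle kGen_pow lGen_pow kGen_mul_lGen_pow)

theorem toTriangle_a : toTriangle a = kGen⁻¹ * lGen * kGen⁻¹ := knotLift_a _ _
theorem toTriangle_b : toTriangle b = lGen * kGen⁻¹ * lGen⁻¹ * kGen := knotLift_b _ _
theorem toTriangle_t : toTriangle t = kGen⁻¹ * lGen := knotLift_t _ _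

theorem toTriangle_surjective : Function.Surjective toTriangle := by
  rw [← MonoidHom.range_eq_top, eq_top_iff, ← PresentedGroup.closure_range_of, Subgroup.closure_le]
  have hk : kGen ∈ toTriangle.range :=
    ⟨a⁻¹ * t, by rw [map_mul, map_inv, toTriangle_a, toTriangle_t]; group⟩
  have hl : lGen ∈ toTriangle.range :=
    ⟨a⁻¹ * t * t, by rw [map_mul, map_mul, map_inv, toTriangle_a, toTriangle_t]; group⟩
  rintro _ ⟨i, rfl⟩
  fin_cases i
  · exact hk
  · exact hl

/-- Modulo k³ and l³ the commutator of the images of a and b collapses to the cube of the image of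
t. Hence the slope is -3. -/
theorem longitude_relation_of_triangle {H : Type*} [Group H] {K L : H} (hK : K ^ 3 = 1)
    (hL : L ^ 3 = 1) : (K⁻¹ * L) ^ (-3 : ℤ) * (K⁻¹ * L * K⁻¹ * (L * K⁻¹ * L⁻¹ * K) *
      (K⁻¹ * L * K⁻¹)⁻¹ * (L * K⁻¹ * L⁻¹ * K)⁻¹) = 1 := by
  have e₁ : L⁻¹ * L⁻¹ = L := by rw [← mul_inv_rev, inv_eq_iff_mul_eq_one, ← hL, pow_three']
  have e₂ : K * K * K = 1 := by rw [← hK, pow_three']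
  calc _ = (K⁻¹ * L) ^ (-3 : ℤ) * (K⁻¹ * L * K⁻¹ * L * K⁻¹ * L⁻¹ * (K * K * K) * L⁻¹) := by group
    _ = (K⁻¹ * L) ^ (-3 : ℤ) * (K⁻¹ * L * K⁻¹ * L * K⁻¹ * (L⁻¹ * L⁻¹)) := by rw [e₂]; group
    _ = 1 := by rw [e₁, zpow_neg, zpow_ofNat, pow_three']; group

theorem toTriangle_longitude : toTriangle (t ^ (-3 : ℤ) * longitude) = 1 := by
  rw [map_mul, map_zpow, longitude, map_mul, map_mul, map_mul, map_inv, map_inv, toTriangle_a,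
    toTriangle_b, toTriangle_t]
  exact longitude_relation_of_triangle kGen_pow lGen_pow

theorem fillingKernel_le_ker {H : Type*} [Group H] {n : ℤ} (f : KnotGroup →* H)
    (h : f (t ^ n * longitude) = 1) : fillingKernel n ≤ f.ker :=
  Subgroup.normalClosure_le_normal (by simpa [MonoidHom.mem_ker] using h)

theorem tr_pow_three (g : SL3) : tr (g * g * g) = tr g ^ 3 - 3 * tr g * tr g⁻¹ + 3 := by
  have h₁ := tr_mul_self_mul g g
  have h₂ := tr_mul_self_mul g 1
  rw [mul_one, mul_one, mul_one, tr_one] at h₂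
  rw [inv_mul_cancel, tr_one, h₂] at h₁
  rw [h₁]; ring

/-- Pairs of matrices of order three that give the representations of the triangle group on the
two-dimensional component. -/
structure IsTrianglePair (K L : SL3) : Prop where
  tr_k : tr K = 0
  tr_k_inv : tr K⁻¹ = 0
  tr_l : tr L = 0
  tr_l_inv : tr L⁻¹ = 0
  tr_kl : tr (K * L) = 1
  tr_kl_inv : tr (K * L)⁻¹ = 1

/-- The parameter `ζ` of a pair. -/
def zeta (K L : SL3) : ℂ := tr (L * K * L⁻¹ * K⁻¹)

namespace IsTrianglePair

variable {K L : SL3} (h : IsTrianglePair K L)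
include h

theorem k_pow : K ^ 3 = 1 := sq_eq_of_tr h.tr_k h.tr_k_inv
theorem l_pow : L ^ 3 = 1 := sq_eq_of_tr h.tr_l h.tr_l_inv
theorem kl_pow : (K * L) ^ 4 = 1 := pow_four_eq_of_tr h.tr_kl h.tr_kl_inv

theorem k_mul_k : K * K = K⁻¹ := by rw [eq_inv_iff_mul_eq_one, ← h.k_pow, pow_three']
theorem l_mul_l : L * L = L⁻¹ := by rw [eq_inv_iff_mul_eq_one, ← h.l_pow, pow_three']
theorem k_inv_mul_k_inv : K⁻¹ * K⁻¹ = K := by rw [← mul_inv_rev, h.k_mul_k, inv_inv]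
theorem l_inv_mul_l_inv : L⁻¹ * L⁻¹ = L := by rw [← mul_inv_rev, h.l_mul_l, inv_inv]

/-- Since K² = K⁻¹, the word K L K (L⁻¹K) is conjugate to a commutator, and the other commutator
appears on the right of `tr_mul_mul_mul`. With `tr_comm_mul` this identifies the two commutator
traces as the roots of the quadratic that defines the hypersurface. -/
theorem tr_comm_add : tr (K * L * K⁻¹ * L⁻¹) + zeta K L
    = tr (K * L⁻¹) * tr (K⁻¹ * L) - 2 := by
  have e := tr_mul_mul_mul K L (L⁻¹ * K)
  have e₁ : tr (K * L * K * (L⁻¹ * K)) = tr (K⁻¹ * L * K * L⁻¹) := by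
    rw [← h.k_mul_k]
    exact tr_eq_of_conj K (by group)
  have e₂ : tr (K⁻¹ * L * K * L⁻¹) = zeta K L := tr_eq_of_conj K (by group)
  have e₃ : tr (L * K⁻¹ * (L⁻¹ * K)) = tr (K * L * K⁻¹ * L⁻¹) := tr_eq_of_conj K (by group)
  have e₄ : K⁻¹ * L * (L⁻¹ * K) = 1 := by group
  have e₅ : tr (K * (L⁻¹ * K)) = 1 := by
    rw [← h.tr_kl_inv, mul_inv_rev, ← h.k_mul_k]
    exact tr_eq_of_conj K⁻¹ (by group)
  have e₆ : tr (K⁻¹ * (L⁻¹ * K)) = 0 := by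
    rw [← h.tr_l_inv]; exact tr_eq_of_conj K (by group)
  have e₇ : tr (L⁻¹ * K) = tr (K * L⁻¹) := tr_mul_comm _ _
  rw [e₁, e₂, e₃, e₄, tr_one, e₅, e₆, e₇, h.tr_k_inv, h.tr_l, h.tr_kl] at e
  linear_combination e

/-- The trace of L (KL⁻¹K⁻¹) L (K⁻¹L⁻¹K) is computed twice. Splitting at the two letters L produces
the product of the commutator traces. Splitting a conjugate of the same word at K produces only
their sum and polynomials in ν and ν̄. -/
theorem tr_comm_mul : tr (K * L * K⁻¹ * L⁻¹) * zeta K L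
    = tr (K * L⁻¹) ^ 3 + tr (K⁻¹ * L) ^ 3 - 5 * (tr (K * L⁻¹) * tr (K⁻¹ * L)) + 5 := by
  set n := tr (K * L⁻¹) with hn
  set m := tr (K⁻¹ * L) with hm
  have c₁ : tr (L⁻¹ * K) = n := tr_mul_comm _ _
  have c₂ : tr (L * K⁻¹) = m := tr_mul_comm _ _
  have c₃ : tr (L⁻¹ * K⁻¹) = 1 := by rw [← h.tr_kl_inv, mul_inv_rev]
  have c₄ : tr (K⁻¹ * L⁻¹) = 1 := by rw [tr_mul_comm, c₃]
  have hkl : tr (L * K) = 1 := by rw [tr_mul_comm, h.tr_kl]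
  have e := tr_mul_mul_mul L (K * L⁻¹ * K⁻¹) (K⁻¹ * L⁻¹ * K)
  have e₁ : tr (L⁻¹ * (K * L⁻¹ * K⁻¹) * (K⁻¹ * L⁻¹ * K)) = n ^ 3 - 3 * n * m + 3 := by
    rw [show L⁻¹ * (K * L⁻¹ * K⁻¹) * (K⁻¹ * L⁻¹ * K)
      = L⁻¹ * K * L⁻¹ * (K⁻¹ * K⁻¹) * L⁻¹ * K by group, h.k_inv_mul_k_inv,
      show L⁻¹ * K * L⁻¹ * K * L⁻¹ * K = (L⁻¹ * K) * (L⁻¹ * K) * (L⁻¹ * K) by group,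
      tr_pow_three, c₁, show (L⁻¹ * K)⁻¹ = K⁻¹ * L by group]
  have e₂ : tr (K * L⁻¹ * K⁻¹ * L⁻¹ * (K⁻¹ * L⁻¹ * K)) = 1 := by
    have : tr (K * L⁻¹ * K⁻¹ * L⁻¹ * (K⁻¹ * L⁻¹ * K))
        = tr (K⁻¹ * L⁻¹ * (K⁻¹ * L⁻¹) * (K⁻¹ * L⁻¹)) := by
      have e := h.k_mul_k
      rw [show K⁻¹ * L⁻¹ * (K⁻¹ * L⁻¹) * (K⁻¹ * L⁻¹)
        = K⁻¹ * (L⁻¹ * K⁻¹ * L⁻¹ * K⁻¹ * L⁻¹) by group]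
      nth_rewrite 3 [← e]
      exact tr_eq_of_conj K (by group)
    rw [this, tr_pow_three, c₄, show (K⁻¹ * L⁻¹)⁻¹ = L * K by group, hkl]
    norm_num
  have e₃ : tr (K * L⁻¹ * K⁻¹) = 0 := by rw [tr_conj, h.tr_l_inv]
  have e₄ : tr (K⁻¹ * L⁻¹ * K) = 0 := by
    rw [← h.tr_l_inv]; exact tr_eq_of_conj K (by group)
  have e₅ : tr (L * (K * L⁻¹ * K⁻¹)) = zeta K L := by rw [zeta]; congr 1; group
  have e₆ : tr (L * (K⁻¹ * L⁻¹ * K)) = tr (K * L * K⁻¹ * L⁻¹) := tr_eq_of_conj K (by group)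
  rw [e₁, e₂, e₃, e₄, e₅, e₆, h.tr_l_inv] at e
  have f := tr_mul_mul_mul K L (L⁻¹ * K⁻¹ * L * K⁻¹ * L⁻¹)
  have f₀ : tr (K * L * K * (L⁻¹ * K⁻¹ * L * K⁻¹ * L⁻¹))
      = tr (L * (K * L⁻¹ * K⁻¹) * L * (K⁻¹ * L⁻¹ * K)) :=
    tr_eq_of_conj K⁻¹ (by group)
  have f₁ : tr (K⁻¹ * L * (L⁻¹ * K⁻¹ * L * K⁻¹ * L⁻¹)) = tr (K * L * K⁻¹ * L⁻¹) := by
    rw [show K⁻¹ * L * (L⁻¹ * K⁻¹ * L * K⁻¹ * L⁻¹) = (K⁻¹ * K⁻¹) * L * K⁻¹ * L⁻¹ by group,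
      h.k_inv_mul_k_inv]
  have f₂ : tr (L * K⁻¹ * (L⁻¹ * K⁻¹ * L * K⁻¹ * L⁻¹)) = zeta K L := by
    rw [tr_eq_of_conj (B := K⁻¹ * K⁻¹ * L⁻¹ * K⁻¹ * L) (K⁻¹ * L⁻¹) (by group),
      h.k_inv_mul_k_inv]
    exact tr_eq_of_conj L (by group)
  have f₃ : tr (K * (L⁻¹ * K⁻¹ * L * K⁻¹ * L⁻¹)) = n * m - 1 := by
    have g := tr_mul_mul_mul L⁻¹ (K⁻¹ * L * K⁻¹) K
    have g₀ : tr (L⁻¹ * (K⁻¹ * L * K⁻¹) * L⁻¹ * K)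
        = tr (K * (L⁻¹ * K⁻¹ * L * K⁻¹ * L⁻¹)) := tr_eq_of_conj K (by group)
    have g₁ : tr (L * (K⁻¹ * L * K⁻¹) * K) = 1 := by
      rw [show L * (K⁻¹ * L * K⁻¹) * K = L * K⁻¹ * L by group, ← c₃, ← h.l_mul_l]
      exact tr_eq_of_conj L (by group)
    have g₂ : tr (K⁻¹ * L * K⁻¹ * L * K) = 1 := by
      rw [← c₃, ← h.l_mul_l]
      exact tr_eq_of_conj (L * K) (by group)
    have g₃ : tr (K⁻¹ * L * K⁻¹) = 1 := by
      rw [← h.tr_kl]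
      nth_rewrite 3 [← h.k_inv_mul_k_inv]
      exact tr_eq_of_conj K⁻¹ (by group)
    have g₄ : tr (L⁻¹ * (K⁻¹ * L * K⁻¹)) = m := by
      have i := tr_mul_mul_mul K⁻¹ L⁻¹ L
      have i₁ : tr (K⁻¹ * L⁻¹ * K⁻¹ * L) = tr (L⁻¹ * (K⁻¹ * L * K⁻¹)) :=
        tr_eq_of_conj K (by group)
      have i₂ : K * L⁻¹ * L = K := by group
      have i₃ : tr (L⁻¹ * K * L) = 0 := by
        rw [← h.tr_k]; exact tr_eq_of_conj L (by group)
      rw [inv_inv, i₁, i₂, i₃, h.tr_k, h.tr_l_inv, h.tr_l, c₄, ← hm] at i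
      linear_combination i
    rw [inv_inv, g₀, g₁, g₂, g₃, g₄, h.tr_l, h.tr_k, hkl, c₁] at g
    linear_combination g
  have f₄ : tr (L⁻¹ * K⁻¹ * L * K⁻¹ * L⁻¹) = m ^ 2 - 2 * n := by
    have : tr (L⁻¹ * K⁻¹ * L * K⁻¹ * L⁻¹) = tr (K⁻¹ * L * (K⁻¹ * L) * 1) := by
      rw [tr_eq_of_conj (B := L⁻¹ * L⁻¹ * K⁻¹ * L * K⁻¹) L⁻¹ (by group), h.l_inv_mul_l_inv]
      exact tr_eq_of_conj K⁻¹ (by group)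
    rw [this, tr_mul_self_mul, mul_one, mul_one, tr_one, show (K⁻¹ * L)⁻¹ = L⁻¹ * K by group, c₁]
    ring
  rw [f₀, f₁, f₂, f₃, f₄, h.tr_k_inv, h.tr_l, h.tr_kl, ← hm] at f
  have s := h.tr_comm_add
  linear_combination f - e - s

end IsTrianglePair

end FigEight

end

noncomputable section

namespace FigEight

open scoped Matrix
open MvPolynomial

/-! ### The component `V₁` -/

theorem closure_generators_of_triangle :
    Subgroup.closure {a⁻¹ * t, a⁻¹ * t * t} = (⊤ : Subgroup KnotGroup) := by
  have hk : a⁻¹ * t ∈ Subgroup.closure {a⁻¹ * t, a⁻¹ * t * t} := Subgroup.subset_closure (by simp)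
  have hl : a⁻¹ * t * t ∈ Subgroup.closure {a⁻¹ * t, a⁻¹ * t * t} :=
    Subgroup.subset_closure (by simp)
  rw [eq_top_iff, ← closure_a_t, Subgroup.closure_le]
  have ht : t ∈ Subgroup.closure {a⁻¹ * t, a⁻¹ * t * t} := by
    have := mul_mem (inv_mem hk) hl
    rwa [show (a⁻¹ * t)⁻¹ * (a⁻¹ * t * t) = t by group] at this
  rintro _ (rfl | rfl)
  · have := mul_mem ht (inv_mem hk)
    rwa [show t * (a⁻¹ * t)⁻¹ = a by group] at this
  · exact ht

/-- Representations of the knot group that factor through the triangle group. -/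
def IsTriangleRep (ρ : KnotGroup →* SL3) : Prop :=
  IsTrianglePair (ρ (a⁻¹ * t)) (ρ (a⁻¹ * t * t))

/-- The component of characters of representations that factor through the triangle group. -/
def triangleComponent : Set (KnotGroup → ℂ) :=
  {χ | ∃ ρ : KnotGroup →* SL3, IsTriangleRep ρ ∧ χ = character ρ}

/-- The representation of the triangle group given by a pair. -/
def IsTrianglePair.rep {K L : SL3} (h : IsTrianglePair K L) : TriangleGroup 3 3 4 →* SL3 :=
  triangleLift K L h.k_pow h.l_pow h.kl_pow

theorem IsTriangleRep.comp_toTriangle {ρ : KnotGroup →* SL3} (h : IsTriangleRep ρ) :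
    (IsTrianglePair.rep h).comp toTriangle = ρ := by
  refine knotGroup_hom_ext ?_ ?_ <;>
  · simp only [map_mul, map_inv, MonoidHom.comp_apply, toTriangle_a, toTriangle_t,
      IsTrianglePair.rep, triangleLift_kGen, triangleLift_lGen]
    group

theorem IsTrianglePair.rep_comp_k {K L : SL3} (h : IsTrianglePair K L) :
    h.rep.comp toTriangle (a⁻¹ * t) = K := by
  simp only [map_mul, map_inv, MonoidHom.comp_apply, toTriangle_a, toTriangle_t, rep,
    triangleLift_kGen, triangleLift_lGen]
  group

theorem IsTrianglePair.rep_comp_l {K L : SL3} (h : IsTrianglePair K L) :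
    h.rep.comp toTriangle (a⁻¹ * t * t) = L := by
  simp only [map_mul, map_inv, MonoidHom.comp_apply, toTriangle_a, toTriangle_t, rep,
    triangleLift_kGen, triangleLift_lGen]
  group

theorem IsTrianglePair.isTriangleRep {K L : SL3} (h : IsTrianglePair K L) :
    IsTriangleRep (h.rep.comp toTriangle) := by
  rw [IsTriangleRep, h.rep_comp_k, h.rep_comp_l]
  exact h

/-- The values of the ten traces of the generators in terms of the parameters. -/
def triangleTraces (x : Fin 3 → ℂ) : Fin 10 → ℂ :=
  ![0, 0, 0, 0, 1, 1, x 0, x 1, x 0 * x 1 - 2 - x 2, x 2]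

namespace IsTriangleRep

variable {ρ : KnotGroup →* SL3} (h : IsTriangleRep ρ)

theorem param_eq : param₁ (character ρ) = ![tr (ρ (a⁻¹ * t) * (ρ (a⁻¹ * t * t))⁻¹),
    tr ((ρ (a⁻¹ * t))⁻¹ * ρ (a⁻¹ * t * t)), zeta (ρ (a⁻¹ * t)) (ρ (a⁻¹ * t * t))] := by
  have e₀ : character ρ t⁻¹ = tr (ρ (a⁻¹ * t) * (ρ (a⁻¹ * t * t))⁻¹) := by
    rw [character_apply, ← map_inv, ← map_mul]
    simp only [map_mul, map_inv]
    exact tr_eq_of_conj ((ρ a)⁻¹ * ρ t) (by group)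
  have e₁ : character ρ t = tr ((ρ (a⁻¹ * t))⁻¹ * ρ (a⁻¹ * t * t)) := by
    rw [character_apply, ← map_inv, ← map_mul]
    congr 2; group
  have e₂ : character ρ b⁻¹ = zeta (ρ (a⁻¹ * t)) (ρ (a⁻¹ * t * t)) := by
    rw [character_apply, b_eq, zeta]
    simp only [map_mul, map_inv]
    exact tr_eq_of_conj ((ρ a)⁻¹ * ρ t) (by group)
  simp only [param₁, e₀, e₁, e₂]

include h

theorem tenTraces_eq :
    tenTraces (ρ (a⁻¹ * t)) (ρ (a⁻¹ * t * t)) = triangleTraces (param₁ (character ρ)) := by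
  have e := IsTrianglePair.tr_comm_add h
  have e' : tr (ρ (a⁻¹ * t) * ρ (a⁻¹ * t * t) * (ρ (a⁻¹ * t))⁻¹ * (ρ (a⁻¹ * t * t))⁻¹) =
    tr (ρ (a⁻¹ * t) * (ρ (a⁻¹ * t * t))⁻¹) * tr ((ρ (a⁻¹ * t))⁻¹ * ρ (a⁻¹ * t * t)) - 2
      - zeta (ρ (a⁻¹ * t)) (ρ (a⁻¹ * t * t)) := by linear_combination e
  rw [param_eq, tenTraces, e', h.tr_k, h.tr_k_inv, h.tr_l, h.tr_l_inv, h.tr_kl, h.tr_kl_inv]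
  rfl

theorem param_mem : param₁ (character ρ) ∈ hypersurface := by
  have e := IsTrianglePair.tr_comm_add h
  have e' := IsTrianglePair.tr_comm_mul h
  rw [param_eq]
  simp only [hypersurface, Set.mem_ofPred_eq, Matrix.cons_val_zero, Matrix.cons_val_one,
    Matrix.cons_val]
  linear_combination (zeta (ρ (a⁻¹ * t)) (ρ (a⁻¹ * t * t))) * e - e'

theorem tr_a : tr (ρ a) = 1 := by
  have e : tr (ρ a) =
      tr ((ρ (a⁻¹ * t))⁻¹ * (ρ (a⁻¹ * t))⁻¹ * ρ (a⁻¹ * t * t)) := by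
    simp only [map_mul, map_inv]
    exact tr_eq_of_conj ((ρ t)⁻¹ * ρ a) (by group)
  rw [e, IsTrianglePair.k_inv_mul_k_inv h, h.tr_kl]

theorem tr_a_inv : tr (ρ a)⁻¹ = 1 := by
  have e : tr (ρ a)⁻¹ =
      tr ((ρ (a⁻¹ * t))⁻¹ * (ρ (a⁻¹ * t))⁻¹ * ρ (a⁻¹ * t * t))⁻¹ := by
    simp only [map_mul, map_inv]
    exact tr_inv_eq_of_conj ((ρ t)⁻¹ * ρ a) (by group)
  rw [e, IsTrianglePair.k_inv_mul_k_inv h, h.tr_kl_inv]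

theorem tr_b : tr (ρ b) = tr (ρ t)⁻¹ * tr (ρ t) - 2 - tr (ρ b)⁻¹ := by
  have e := IsTrianglePair.tr_comm_add h
  have p := param_eq (ρ := ρ)
  have p₀ := congrFun p 0
  have p₁ := congrFun p 1
  have p₂ := congrFun p 2
  simp only [param₁, Matrix.cons_val_zero, Matrix.cons_val_one, Matrix.cons_val, character_apply,
    map_inv ρ t, map_inv ρ b] at p₀ p₁ p₂
  have : tr (ρ b) = tr (ρ (a⁻¹ * t) * ρ (a⁻¹ * t * t) * (ρ (a⁻¹ * t))⁻¹ * (ρ (a⁻¹ * t * t))⁻¹) := by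
    rw [b_eq]
    simp only [map_mul, map_inv]
    exact tr_eq_of_conj ((ρ a)⁻¹ * ρ t) (by group)
  rw [this, p₀, p₁, p₂]
  linear_combination e

end IsTriangleRep

/-- A polynomial that expresses a character in terms of its ten values on the generators of the
triangle group. -/
def triangleTracePolynomial (g : KnotGroup) : MvPolynomial (Fin 10) ℂ :=
  (exists_tracePolynomial closure_generators_of_triangle g).choose

theorem tr_eq_triangleTracePolynomial (ρ : KnotGroup →* SL3) (g : KnotGroup) :
    tr (ρ g) = eval (tenTraces (ρ (a⁻¹ * t)) (ρ (a⁻¹ * t * t))) (triangleTracePolynomial g) :=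
  (exists_tracePolynomial closure_generators_of_triangle g).choose_spec ρ

/-- The character with given parameters. -/
def triangleCharacter (x : Fin 3 → ℂ) : KnotGroup → ℂ :=
  fun g => eval (triangleTraces x) (triangleTracePolynomial g)

theorem isPolynomialMap_triangleCharacter : IsPolynomialMap triangleCharacter := by
  refine ⟨fun g => bind₁ ![0, 0, 0, 0, 1, 1, X 0, X 1, X 0 * X 1 - C 2 - X 2, X 2]
    (triangleTracePolynomial g), fun x g => ?_⟩
  rw [triangleCharacter, ← aeval_eq_eval, ← aeval_eq_eval, aeval_bind₁]
  congr 2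
  funext i
  fin_cases i <;> simp [triangleTraces]

theorem isPolynomialMap_param₁ : IsPolynomialMap param₁ :=
  ⟨![X t⁻¹, X t, X b⁻¹], fun χ i => by fin_cases i <;> simp [param₁]⟩

theorem triangleCharacter_param {χ : KnotGroup → ℂ} (h : χ ∈ triangleComponent) :
    triangleCharacter (param₁ χ) = χ := by
  obtain ⟨ρ, hρ, rfl⟩ := h
  funext g
  rw [character_apply, tr_eq_triangleTracePolynomial, hρ.tenTraces_eq, triangleCharacter]

theorem param_mem_hypersurface {χ : KnotGroup → ℂ} (h : χ ∈ triangleComponent) :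
    param₁ χ ∈ hypersurface := by
  obtain ⟨ρ, hρ, rfl⟩ := h
  exact hρ.param_mem

theorem factorsThroughFilling_triangleComponent : FactorsThroughFilling triangleComponent (-3) := by
  refine ⟨QuotientGroup.lift (fillingKernel (-3)) toTriangle
    (fillingKernel_le_ker toTriangle toTriangle_longitude), ?_, ?_⟩
  · intro x
    obtain ⟨g, rfl⟩ := toTriangle_surjective x
    exact ⟨toFilling (-3) g, rfl⟩
  · rintro χ ⟨ρ, hρ, rfl⟩
    refine ⟨IsTrianglePair.rep hρ, ?_⟩
    conv_lhs => rw [← hρ.comp_toTriangle]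
    rfl

end FigEight

end

noncomputable section

namespace FigEight

open scoped Matrix

/-! ### Common eigenvectors -/

theorem HasCommonEigenvector.exists_monoidHom {G : Type*} [Group G] {ρ : G →* SL3}
    (h : HasCommonEigenvector ρ) : ∃ v : Fin 3 → ℂ, v ≠ 0 ∧ ∃ c : G →* ℂ,
      (∀ g, (ρ g : Matrix (Fin 3) (Fin 3) ℂ) *ᵥ v = c g • v) ∧ ∀ g, ρ g = 1 → c g = 1 := by
  obtain ⟨v, hv, hc⟩ := h
  choose c hc using hc
  have inj : ∀ x y : ℂ, x • v = y • v → x = y := fun x y e => smul_left_injective ℂ hv e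
  have one : ∀ g, ρ g = 1 → c g = 1 := fun g hg => inj _ _ (by rw [← hc, hg]; simp)
  refine ⟨v, hv, ⟨⟨c, one 1 (map_one ρ)⟩, fun g k => inj _ _ ?_⟩, hc, one⟩
  rw [← hc, map_mul, Matrix.SpecialLinearGroup.coe_mul, ← Matrix.mulVec_mulVec, hc,
    Matrix.mulVec_smul, hc, smul_smul, mul_comm]

/-! ### The exceptional points -/

theorem varpi_pow_three : ϖ ^ 3 = 1 := by
  rw [ϖ, ← Complex.exp_nat_mul]
  convert Complex.exp_two_pi_mul_I using 2
  push_cast; ring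

theorem varpi_ne_one : ϖ ≠ 1 := by
  have h := Complex.isPrimitiveRoot_exp 3 (by norm_num)
  have := h.ne_one (by norm_num)
  simpa [ϖ] using this

theorem pow_three_eq_one_iff {ω : ℂ} : ω ^ 3 = 1 ↔ ω = 1 ∨ ω = ϖ ∨ ω = ϖ ^ 2 := by
  have h₃ := varpi_pow_three
  have h₂ : ϖ ^ 2 + ϖ + 1 = 0 := by
    have : (ϖ - 1) * (ϖ ^ 2 + ϖ + 1) = 0 := by linear_combination h₃
    exact (mul_eq_zero.1 this).resolve_left (sub_ne_zero.2 varpi_ne_one)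
  constructor
  · intro h
    have : (ω - 1) * ((ω - ϖ) * (ω - ϖ ^ 2)) = 0 := by
      linear_combination h + (ω - ω ^ 2) * h₂ + (ω - 1) * h₃
    simpa [sub_eq_zero] using this
  · rintro (rfl | rfl | rfl)
    · norm_num
    · exact h₃
    · linear_combination (ϖ ^ 3 + 1) * h₃

theorem mem_exceptionalPoints {x : Fin 3 → ℂ} :
    x ∈ exceptionalPoints ↔ ∃ ω : ℂ, ω ^ 3 = 1 ∧ x = ![2 * ω ^ 2, 2 * ω, 1] := by
  have h₃ := varpi_pow_three
  have h₄ : (ϖ ^ 2) ^ 2 = ϖ := by linear_combination ϖ * h₃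
  simp only [pow_three_eq_one_iff, exceptionalPoints, Set.mem_insert_iff, Set.mem_singleton_iff]
  constructor
  · rintro (rfl | rfl | rfl)
    · exact ⟨1, by simp, by simp⟩
    · exact ⟨ϖ ^ 2, by simp, by simp [h₄]⟩
    · exact ⟨ϖ, by simp, by simp⟩
  · rintro ⟨ω, rfl | rfl | rfl, rfl⟩
    · simp
    · simp
    · simp [h₄]

theorem IsTriangleRep.param_mem_exceptionalPoints {ρ : KnotGroup →* SL3} (h : IsTriangleRep ρ)
    (hρ : HasCommonEigenvector ρ) : param₁ (character ρ) ∈ exceptionalPoints := by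
  obtain ⟨v, hv, c, hc, one⟩ := hρ.exists_monoidHom
  have inj : ∀ x y : ℂ, x • v = y • v → x = y := fun x y e => smul_left_injective ℂ hv e
  set k := a⁻¹ * t with hk
  set l := a⁻¹ * t * t with hl
  have hk3 : c k ^ 3 = 1 := by rw [← map_pow, one]; rw [map_pow]; exact IsTrianglePair.k_pow h
  have hl3 : c l ^ 3 = 1 := by rw [← map_pow, one]; rw [map_pow]; exact IsTrianglePair.l_pow h
  have hkl4 : (c k * c l) ^ 4 = 1 := by
    rw [← map_mul, ← map_pow, one]
    rw [map_pow, map_mul]; exact IsTrianglePair.kl_pow h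
  -- The product is a cube root of unity and also a fourth root of unity.
  have hkl : c k * c l = 1 := by
    linear_combination hkl4 - c k * c l * ((c l) ^ 3 * hk3 + hl3)
  -- The polarised Cayley-Hamilton identity, applied to the common eigenvector, becomes a scalar
  -- equation between the eigenvalues and the traces.
  have key : ∀ g x : KnotGroup, c g * c x * c g = - (c g⁻¹ * c x) - c x * c g⁻¹ +
      tr (ρ g)⁻¹ * c x + tr (ρ x) * c g⁻¹ + tr (ρ g * ρ x) * c g
      + (tr ((ρ g)⁻¹ * ρ x) - tr (ρ g)⁻¹ * tr (ρ x)) := by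
    intro g x
    have e := congrArg (· *ᵥ v) (coe_mul_mul_self (ρ g) (ρ x))
    simp only [Matrix.add_mulVec, Matrix.sub_mulVec, Matrix.neg_mulVec, Matrix.smul_mulVec,
      ← Matrix.mulVec_mulVec, ← map_inv, hc, Matrix.mulVec_smul, smul_smul, Matrix.one_mulVec,
      ← sub_smul, ← add_smul, ← neg_smul] at e
    have := inj _ _ e
    simp only [map_inv ρ] at this
    linear_combination this
  have inv : ∀ g, c g * c g⁻¹ = 1 := fun g => by rw [← map_mul]; simp
  have ik : c k⁻¹ = c l := by linear_combination (c l) * inv k - c k⁻¹ * hkl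
  have il : c l⁻¹ = c k := by linear_combination (c k) * inv l - c l⁻¹ * hkl
  have e₁ := key k l
  have e₂ := key l k
  rw [tr_mul_comm (ρ l)] at e₂
  have p := param_eq (ρ := ρ)
  have e₀ : tr ((ρ l)⁻¹ * ρ k) = tr (ρ k * (ρ l)⁻¹) := tr_mul_comm _ _
  rw [h.tr_k_inv, h.tr_l, h.tr_kl, ik] at e₁
  rw [h.tr_l_inv, h.tr_k, h.tr_kl, il, e₀] at e₂
  have p₀ := congrFun p 0
  have p₁ := congrFun p 1
  have hH := h.param_mem
  set x := param₁ (character ρ)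
  simp only [Matrix.cons_val_zero, Matrix.cons_val_one] at p₀ p₁
  rw [← p₁] at e₁
  rw [← p₀] at e₂
  have sq : c l ^ 2 = c k := by linear_combination (c k) * hl3 - c l ^ 2 * hkl
  have sq' : c k ^ 2 = c l := by linear_combination (c l) * hk3 - c k ^ 2 * hkl
  have x₁ : x 1 = 2 * c k := by linear_combination (c k) * hkl - e₁ + 2 * sq
  have x₀ : x 0 = 2 * c k ^ 2 := by linear_combination (c l) * hkl - e₂
  have x₂ : x 2 = 1 := by
    simp only [hypersurface, Set.mem_ofPred_eq, x₀, x₁] at hH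
    have : (x 2 - 1) ^ 2 = 0 := by
      linear_combination hH + (4 * x 2 + 4 - 8 * c k ^ 3) * hk3
    rw [sq_eq_zero_iff] at this
    linear_combination this
  refine mem_exceptionalPoints.2 ⟨c k, hk3, ?_⟩
  ext i
  fin_cases i
  · exact x₀
  · exact x₁
  · exact x₂

theorem IsTriangleRep.dualRep {ρ : KnotGroup →* SL3} (h : IsTriangleRep ρ) :
    IsTriangleRep (dualRep ρ) := by
  constructor <;> simp only [← map_inv, ← map_mul, tr_dualRep]
  · rw [map_inv]; exact h.tr_k_inv
  · rw [inv_inv]; exact h.tr_k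
  · rw [map_inv]; exact h.tr_l_inv
  · rw [inv_inv]; exact h.tr_l
  · rw [map_inv, map_mul]; exact h.tr_kl_inv
  · rw [inv_inv, map_mul]; exact h.tr_kl

/-- The contragredient representation exchanges ν with ν̄ and ζ with the other root of the
quadratic. The exceptional set is stable under this because ζ = 1 is a double root there. -/
theorem IsTriangleRep.isIrreducibleRep {ρ : KnotGroup →* SL3} (h : IsTriangleRep ρ)
    (hx : param₁ (character ρ) ∉ exceptionalPoints) : IsIrreducibleRep ρ := by
  by_contra hρ
  rcases hasCommonEigenvector_of_not_irreducible hρ with h' | h'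
  · exact hx (h.param_mem_exceptionalPoints h')
  · have := h.dualRep.param_mem_exceptionalPoints h'
    obtain ⟨ω, h3, e⟩ := mem_exceptionalPoints.1 this
    have e₀ := congrFun e 0
    have e₁ := congrFun e 1
    have e₂ := congrFun e 2
    simp only [param₁, Matrix.cons_val_zero, Matrix.cons_val_one, Matrix.cons_val,
      character_apply, tr_dualRep, inv_inv] at e₀ e₁ e₂
    refine hx (mem_exceptionalPoints.2 ⟨ω ^ 2, by linear_combination (ω ^ 3 + 1) * h3, ?_⟩)
    have hb := h.tr_b
    rw [← map_inv ρ t, ← map_inv ρ b, e₀, e₁, e₂] at hb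
    ext i
    fin_cases i
    · change tr (ρ t⁻¹) = 2 * (ω ^ 2) ^ 2
      linear_combination e₁ - 2 * ω * h3
    · exact e₀
    · change tr (ρ b⁻¹) = 1
      linear_combination hb + 4 * h3

end FigEight

end

noncomputable section

namespace FigEight

open scoped Matrix

/-! ### The representations at the exceptional points -/

theorem of_fin_three_ext {R : Type*} {a b c d e f g h i a' b' c' d' e' f' g' h' i' : R}
    (ha : a = a') (hb : b = b') (hc : c = c') (hd : d = d') (he : e = e') (hf : f = f')
    (hg : g = g') (hh : h = h') (hi : i = i') :
    !![a, b, c; d, e, f; g, h, i] = !![a', b', c'; d', e', f'; g', h', i'] := by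
  rw [ha, hb, hc, hd, he, hf, hg, hh, hi]

namespace Exceptional

/-- A quaternion unit. -/
def A : SL3 := ⟨!![1, 0, 0; 0, Complex.I, 0; 0, 0, -Complex.I], by simp [Matrix.det_fin_three]⟩

/-- A quaternion unit. -/
def B : SL3 := ⟨!![1, 0, 0; 0, 0, 1; 0, -1, 0], by simp [Matrix.det_fin_three]⟩

/-- An element that permutes the quaternion units. -/
def T (ω : ℂ) (h : ω ^ 3 = 1) : SL3 :=
  ⟨!![ω, 0, 0; 0, ω * (1 - Complex.I) / 2, -ω * (1 + Complex.I) / 2;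
    0, ω * (1 - Complex.I) / 2, ω * (1 + Complex.I) / 2], by
    simp [Matrix.det_fin_three]
    linear_combination h - ω ^ 3 * Complex.I_sq / 2⟩

theorem coe_A : (A : Matrix (Fin 3) (Fin 3) ℂ) =
    !![1, 0, 0; 0, Complex.I, 0; 0, 0, -Complex.I] := rfl

theorem coe_B : (B : Matrix (Fin 3) (Fin 3) ℂ) = !![1, 0, 0; 0, 0, 1; 0, -1, 0] := rfl

theorem coe_T (ω : ℂ) (h : ω ^ 3 = 1) : (T ω h : Matrix (Fin 3) (Fin 3) ℂ) =
    !![ω, 0, 0; 0, ω * (1 - Complex.I) / 2, -ω * (1 + Complex.I) / 2;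
      0, ω * (1 - Complex.I) / 2, ω * (1 + Complex.I) / 2] := rfl

theorem T_mul_A (ω : ℂ) (h : ω ^ 3 = 1) : T ω h * A * (T ω h)⁻¹ = A * B := by
  rw [mul_inv_eq_iff_eq_mul]
  refine Subtype.ext ?_
  simp only [Matrix.SpecialLinearGroup.coe_mul, coe_A, coe_B, coe_T, Matrix.mul_fin_three]
  refine of_fin_three_ext ?_ ?_ ?_ ?_ ?_ ?_ ?_ ?_ ?_ <;>
    ring_nf

theorem T_mul_B (ω : ℂ) (h : ω ^ 3 = 1) : T ω h * B * (T ω h)⁻¹ = B * A * B := by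
  rw [mul_inv_eq_iff_eq_mul]
  refine Subtype.ext ?_
  simp only [Matrix.SpecialLinearGroup.coe_mul, coe_A, coe_B, coe_T, Matrix.mul_fin_three]
  refine of_fin_three_ext ?_ ?_ ?_ ?_ ?_ ?_ ?_ ?_ ?_ <;>
    (ring_nf; try simp only [Complex.I_sq]; try ring_nf)

/-- The inverse of `A`. -/
def A' : SL3 := ⟨!![1, 0, 0; 0, -Complex.I, 0; 0, 0, Complex.I], by simp [Matrix.det_fin_three]⟩

/-- The inverse of `T`. -/
def T' (ω : ℂ) (h : ω ^ 3 = 1) : SL3 :=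
  ⟨!![ω ^ 2, 0, 0; 0, ω ^ 2 * (1 + Complex.I) / 2, ω ^ 2 * (1 + Complex.I) / 2;
    0, -ω ^ 2 * (1 - Complex.I) / 2, ω ^ 2 * (1 - Complex.I) / 2], by
    simp [Matrix.det_fin_three]
    linear_combination (ω ^ 3 + 1) * h - ω ^ 6 * Complex.I_sq / 2⟩

theorem coe_A' : (A' : Matrix (Fin 3) (Fin 3) ℂ) =
    !![1, 0, 0; 0, -Complex.I, 0; 0, 0, Complex.I] := rfl

theorem coe_T' (ω : ℂ) (h : ω ^ 3 = 1) : (T' ω h : Matrix (Fin 3) (Fin 3) ℂ) =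
    !![ω ^ 2, 0, 0; 0, ω ^ 2 * (1 + Complex.I) / 2, ω ^ 2 * (1 + Complex.I) / 2;
      0, -ω ^ 2 * (1 - Complex.I) / 2, ω ^ 2 * (1 - Complex.I) / 2] := rfl

theorem A_inv : A⁻¹ = A' := by
  rw [inv_eq_iff_mul_eq_one]
  refine Subtype.ext ?_
  simp only [Matrix.SpecialLinearGroup.coe_mul, Matrix.SpecialLinearGroup.coe_one, coe_A, coe_A',
    Matrix.mul_fin_three, Matrix.one_fin_three]
  refine of_fin_three_ext ?_ ?_ ?_ ?_ ?_ ?_ ?_ ?_ ?_ <;>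
    (ring_nf; try simp only [Complex.I_sq]; try ring_nf)

theorem A'_inv : A'⁻¹ = A := by rw [← A_inv, inv_inv]

theorem T_inv (ω : ℂ) (h : ω ^ 3 = 1) : (T ω h)⁻¹ = T' ω h := by
  rw [inv_eq_iff_mul_eq_one]
  refine Subtype.ext ?_
  simp only [Matrix.SpecialLinearGroup.coe_mul, Matrix.SpecialLinearGroup.coe_one, coe_T, coe_T',
    Matrix.mul_fin_three, Matrix.one_fin_three]
  refine of_fin_three_ext ?_ ?_ ?_ ?_ ?_ ?_ ?_ ?_ ?_ <;>
    (ring_nf; try simp only [Complex.I_sq, h]; try ring_nf)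

/-- The representation of the knot group at an exceptional point. -/
def rep (ω : ℂ) (h : ω ^ 3 = 1) : KnotGroup →* SL3 :=
  knotLift A B (T ω h) (T_mul_A ω h) (T_mul_B ω h)

variable {ω : ℂ} (h : ω ^ 3 = 1)

@[simp] theorem rep_a : rep ω h a = A := knotLift_a _ _
@[simp] theorem rep_b : rep ω h b = B := knotLift_b _ _
@[simp] theorem rep_t : rep ω h t = T ω h := knotLift_t _ _

theorem isTriangleRep_rep : IsTriangleRep (rep ω h) := by
  constructor <;> simp only [map_mul, map_inv, rep_a, rep_t, mul_inv_rev, A_inv, A'_inv, T_inv,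
    tr, Matrix.SpecialLinearGroup.coe_mul, coe_A, coe_A', coe_T, coe_T', Matrix.mul_fin_three,
    Matrix.trace_fin_three_of] <;>
  · ring_nf
    try simp only [Complex.I_sq, Complex.I_pow_four, h, show ω ^ 6 = 1 by
      linear_combination (ω ^ 3 + 1) * h]
    try ring_nf

theorem B_inv : B⁻¹ = A * A * B := by
  rw [inv_eq_iff_mul_eq_one]
  refine Subtype.ext ?_
  simp only [Matrix.SpecialLinearGroup.coe_mul, Matrix.SpecialLinearGroup.coe_one, coe_A, coe_B,
    Matrix.mul_fin_three, Matrix.one_fin_three]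
  refine of_fin_three_ext ?_ ?_ ?_ ?_ ?_ ?_ ?_ ?_ ?_ <;>
    (ring_nf; try simp only [Complex.I_sq]; try ring_nf)

theorem tr_B_inv : tr B⁻¹ = 1 := by
  simp [tr, B_inv, Matrix.SpecialLinearGroup.coe_mul, coe_A, coe_B,
    Matrix.trace_fin_three_of]

theorem param_rep : param₁ (character (rep ω h)) = ![2 * ω ^ 2, 2 * ω, 1] := by
  simp only [param₁, character_apply, map_inv, rep_t, rep_b, tr_B_inv, T_inv]
  simp only [tr, coe_T, coe_T', Matrix.trace_fin_three_of]
  congr 2 <;> ring_nf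

theorem A_mul_A_comm : A * A * B = B * (A * A) ∧ A * A * T ω h = T ω h * (A * A) := by
  constructor <;> refine Subtype.ext ?_ <;>
    simp only [Matrix.SpecialLinearGroup.coe_mul, coe_A, coe_B, coe_T, Matrix.mul_fin_three] <;>
    refine of_fin_three_ext ?_ ?_ ?_ ?_ ?_ ?_ ?_ ?_ ?_ <;> ring_nf

/-- The image of a² is diag(1, -1, -1). It acts as a scalar on each of the two invariant summands, a
line and a plane, but not on the whole space. -/
theorem rep_central (g : KnotGroup) :
    rep ω h (a * a) * rep ω h g = rep ω h g * rep ω h (a * a) := by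
  have hg : g ∈ Subgroup.closure {a, t} := by rw [closure_a_t]; trivial
  rw [map_mul, rep_a]
  induction hg using Subgroup.closure_induction with
  | mem x hx =>
    rcases hx with rfl | rfl
    · rw [rep_a, mul_assoc]
    · rw [rep_t]; exact (A_mul_A_comm h).2
  | one => simp
  | mul x y _ _ hx hy => rw [map_mul, ← mul_assoc, hx, mul_assoc, hy, mul_assoc]
  | inv x _ hx => rw [map_inv]; exact Commute.inv_right hx

end Exceptional

/-- A characteristic equation that irreducible representations cannot satisfy. -/
theorem IsIrreducibleRep.character_ne_exceptional {ρ : KnotGroup →* SL3}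
    (hρ : IsIrreducibleRep ρ) {ω : ℂ} (h : ω ^ 3 = 1) :
    character ρ ≠ character (Exceptional.rep ω h) := by
  intro hc
  -- An irreducible representation would map a² to a scalar z with z³ = 1, while the trace
  -- prescribes 3z = -1.
  obtain ⟨z, hz⟩ := hρ.exists_eq_smul_one_of_character_eq hc (a * a) (Exceptional.rep_central h)
  have e₁ : z ^ 3 = 1 := by
    have := (ρ (a * a)).2
    rw [hz] at this
    simpa [Matrix.det_smul] using this
  have e₂ : 3 * z = -1 := by
    have := congrFun hc (a * a)
    rw [character, character, hz, map_mul, Exceptional.rep_a, Matrix.SpecialLinearGroup.coe_mul,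
      Exceptional.coe_A, Matrix.mul_fin_three, Matrix.trace_fin_three_of] at this
    simp at this
    linear_combination this
  have : (3 * z) ^ 3 = 27 := by linear_combination 27 * e₁
  rw [e₂] at this
  norm_num at this

end FigEight

end

noncomputable section

namespace FigEight

open scoped Matrix

/-! ### Existence of representations with given parameters -/

/-- The matrix of a cyclic permutation of the basis. -/
def cyclicMatrix : SL3 := ⟨!![0, 0, 1; 1, 0, 0; 0, 1, 0], by simp [Matrix.det_fin_three]⟩

theorem coe_cyclicMatrix : (cyclicMatrix : Matrix (Fin 3) (Fin 3) ℂ) =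
    !![0, 0, 1; 1, 0, 0; 0, 1, 0] := rfl

/-- A pair of generators of the triangle group such that the first basis vector is an eigenvector
of the product for the eigenvalue `e`. -/
theorem exists_isTrianglePair_of_circulant {f g h e : ℂ} (he : e ^ 3 = e ^ 2 - e + 1)
    (hD : -1 + 3 * f * g - f ^ 3 - g ^ 3 ≠ 0)
    (hH : 1 - e + 6 * e * f * g - 2 * e * f * g * h - 2 * e * f ^ 3 - 2 * e * g ^ 3 + e * h
      + e ^ 2 - 5 * e ^ 2 * f * g - e ^ 2 * f * g * h + e ^ 2 * f ^ 3 + 3 * e ^ 2 * g ^ 3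
      - 5 * f * g + f * g * h + 3 * f ^ 3 + g ^ 3 - h + h ^ 2 = 0) :
    ∃ K L : SL3, IsTrianglePair K L ∧ tr (K * L⁻¹) = (3 * e ^ 2 - 2 * e + 1) * g ∧
      tr (K⁻¹ * L) = (e ^ 2 + 2 * e - 1) * f ∧
      tr (K * L * K⁻¹ * L⁻¹) = (3 * e ^ 2 - 2 * e + 1) * h - e ^ 2 := by
  -- Up to sign this is the determinant of the circulant matrix with entries 1, f, g.
  set D := -1 + 3 * f * g - f ^ 3 - g ^ 3 with hDdef
  set m := (e ^ 2 + 2 * e - 1) * f with hm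
  -- Cramer's rule for the circulant system g p + q + f r = h, f p + g q + r = e g, p + f q + g r =
  -- e² f gives p, q and r.
  obtain ⟨p, hp⟩ : ∃ p, D * p = -e * f ^ 2 * g + e * g ^ 2 - e ^ 2 * f + e ^ 2 * f ^ 2 * g + f * h
    - g ^ 2 * h := ⟨_, mul_div_cancel₀ _ hD⟩
  obtain ⟨q, hq⟩ : ∃ q, D * q = e * f * g - e * g ^ 3 + e ^ 2 * f * g - e ^ 2 * f ^ 3 + f * g * h
    - h := ⟨_, mul_div_cancel₀ _ hD⟩
  obtain ⟨r, hr⟩ : ∃ r, D * r = e * f * g ^ 2 - e * g - e ^ 2 * f * g ^ 2 + e ^ 2 * f ^ 2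
    - f ^ 2 * h + g * h := ⟨_, mul_div_cancel₀ _ hD⟩
  -- The four identities that follow encode det L = 1, tr L⁻¹ = 0 and the prescribed values of
  -- tr(KL⁻¹) and of the commutator trace. Clearing the denominator `D` reduces each of them to `hH`
  -- and the equation of `e`.
  have e₁ : e * ((1 - e - q) * q + p * r) = 1 := by
    refine mul_left_cancel₀ (pow_ne_zero 2 hD) ?_
    have : D ^ 2 * (e * ((1 - e - q) * q + p * r)) =
      e * (((1 - e) * D - D * q) * (D * q) + (D * p) * (D * r)) := by ring
    rw [this, hp, hq, hr, hDdef]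
    linear_combination (e * D) * hH + (
      1 + 2 * e * f * g + 2 * e * f * g ^ 4 - 6 * e * f ^ 2 * g ^ 2 - 2 * e * f ^ 3 - 2 * e * f ^
      3 * g ^ 3 + 8 * e * f ^ 4 * g - 2 * e * f ^ 6 - e ^ 2 * f ^ 3 - e ^ 2 * f ^ 3 * g ^ 3 + 3 *
      e ^ 2 * f ^ 4 * g - e ^ 2 * f ^ 6 - 6 * f * g - 6 * f * g ^ 4 + 9 * f ^ 2 * g ^ 2 + 2 * f ^
      3 + 2 * f ^ 3 * g ^ 3 - 6 * f ^ 4 * g + f ^ 6 + 2 * g ^ 3 + g ^ 6) * he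
  have e₂ : e * p + r ^ 2 + (m - p) * q = 0 := by
    refine mul_left_cancel₀ (pow_ne_zero 2 hD) ?_
    have : D ^ 2 * (e * p + r ^ 2 + (m - p) * q) =
      e * (D * p) * D + (D * r) ^ 2 + (m * D - D * p) * (D * q) := by ring
    rw [this, hp, hq, hr, hm, hDdef]
    linear_combination (-f * D) * hH + (
      e * f ^ 4 + e * f ^ 4 * g ^ 3 - 3 * e * f ^ 5 * g + e * f ^ 7 + f + 2 * f * g ^ 3 + f * g ^
      6 - 8 * f ^ 2 * g - 8 * f ^ 2 * g ^ 4 + 15 * f ^ 3 * g ^ 2 + 4 * f ^ 4 + 4 * f ^ 4 * g ^ 3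
      - 14 * f ^ 5 * g + 3 * f ^ 7) * he
  have e₃ : p * (m - p) - (1 - e - q) * r + e * r = (3 * e ^ 2 - 2 * e + 1) * g := by
    refine mul_left_cancel₀ (pow_ne_zero 2 hD) ?_
    have : D ^ 2 * (p * (m - p) - (1 - e - q) * r + e * r) =
      (D * p) * (m * D - D * p) - ((1 - e) * D - D * q) * (D * r) + e * (D * r) * D := by ring
    rw [this, hp, hq, hr, hm, hDdef]
    linear_combination (g * D) * hH + (
      -e * f ^ 3 * g - e * f ^ 3 * g ^ 4 + 3 * e * f ^ 4 * g ^ 2 - e * f ^ 6 * g + 2 * f * g ^ 2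
      + 2 * f * g ^ 5 - 6 * f ^ 2 * g ^ 3 - 2 * f ^ 3 * g - 2 * f ^ 3 * g ^ 4 + 8 * f ^ 4 * g ^ 2
      - 2 * f ^ 6 * g) * he
  have e₄ : e + e * m * r - 2 * e * q - 2 * e ^ 2 + 3 * e ^ 2 * q + e ^ 3 + m * p ^ 2 - m * q * r
      + 3 * p * q * r - p * r - p ^ 3 + q ^ 2 - q ^ 3 - r ^ 3
      = (3 * e ^ 2 - 2 * e + 1) * h - e ^ 2 := by
    refine mul_left_cancel₀ (pow_ne_zero 3 hD) ?_
    have : D ^ 3 * (e + e * m * r - 2 * e * q - 2 * e ^ 2 + 3 * e ^ 2 * q + e ^ 3 + m * p ^ 2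
        - m * q * r + 3 * p * q * r - p * r - p ^ 3 + q ^ 2 - q ^ 3 - r ^ 3) =
      (e - 2 * e ^ 2 + e ^ 3) * D ^ 3 + e * m * (D * r) * D ^ 2
        + (3 * e ^ 2 - 2 * e) * (D * q) * D ^ 2 + m * (D * p) ^ 2 * D - m * (D * q) * (D * r) * D
        + 3 * (D * p) * (D * q) * (D * r) - (D * p) * (D * r) * D - (D * p) ^ 3 + (D * q) ^ 2 * D
        - (D * q) ^ 3 - (D * r) ^ 3 := by ring
    rw [this, hp, hq, hr, hm, hDdef]
    linear_combination ((h - e) * D ^ 2) * hH + (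
      2 * e * f * g + 4 * e * f * g ^ 4 + 2 * e * f * g ^ 7 - 12 * e * f ^ 2 * g ^ 2 - 12 * e * f
      ^ 2 * g ^ 5 - 2 * e * f ^ 3 + 14 * e * f ^ 3 * g ^ 3 + 2 * e * f ^ 3 * g ^ 3 * h - 2 * e *
      f ^ 3 * g ^ 6 + e * f ^ 3 * g ^ 6 * h + e * f ^ 3 * h + 16 * e * f ^ 4 * g - 6 * e * f ^ 4
      * g * h + 16 * e * f ^ 4 * g ^ 4 - 6 * e * f ^ 4 * g ^ 4 * h - 30 * e * f ^ 5 * g ^ 2 + 9 *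
      e * f ^ 5 * g ^ 2 * h - 4 * e * f ^ 6 - 4 * e * f ^ 6 * g ^ 3 + 2 * e * f ^ 6 * g ^ 3 * h +
      2 * e * f ^ 6 * h + 14 * e * f ^ 7 * g - 6 * e * f ^ 7 * g * h - 2 * e * f ^ 9 + e * f ^ 9
      * h - e ^ 2 * f ^ 3 - 2 * e ^ 2 * f ^ 3 * g ^ 3 - e ^ 2 * f ^ 3 * g ^ 6 + 6 * e ^ 2 * f ^ 4
      * g + 6 * e ^ 2 * f ^ 4 * g ^ 4 - 9 * e ^ 2 * f ^ 5 * g ^ 2 - 2 * e ^ 2 * f ^ 6 - 2 * e ^ 2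
      * f ^ 6 * g ^ 3 + 6 * e ^ 2 * f ^ 7 * g - e ^ 2 * f ^ 9 - 2 * f * g * h - 4 * f * g ^ 4 * h
      - 2 * f * g ^ 7 * h + 12 * f ^ 2 * g ^ 2 * h + 12 * f ^ 2 * g ^ 5 * h - 14 * f ^ 3 * g ^ 3
      * h + 2 * f ^ 3 * g ^ 6 * h + 2 * f ^ 3 * h - 16 * f ^ 4 * g * h - 16 * f ^ 4 * g ^ 4 * h +
      30 * f ^ 5 * g ^ 2 * h + 4 * f ^ 6 * g ^ 3 * h + 4 * f ^ 6 * h - 14 * f ^ 7 * g * h + 2 * f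
      ^ 9 * h) * he
  -- This shape builds in tr L = 0, tr(KL) = 1, tr(K⁻¹L) = m and the eigenvalue e of KL on the first
  -- basis vector.
  obtain ⟨L, hL⟩ : ∃ L : SL3,
      (L : Matrix (Fin 3) (Fin 3) ℂ) = !![0, 1 - e - q, p; 0, -r, q; e, m - p, r] := by
    refine ⟨⟨_, ?_⟩, rfl⟩
    simp only [Matrix.det_fin_three, Matrix.of_apply, Matrix.cons_val]
    linear_combination e₁
  refine ⟨cyclicMatrix, L, ⟨?_, ?_, ?_, ?_, ?_, ?_⟩, ?_, ?_, ?_⟩ <;>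
    simp only [tr, Matrix.SpecialLinearGroup.coe_mul, Matrix.SpecialLinearGroup.coe_inv, hL,
      coe_cyclicMatrix, Matrix.adjugate_fin_three_of, Matrix.mul_fin_three,
      Matrix.trace_fin_three_of]
  · ring
  · ring
  · ring
  · linear_combination -e₂
  · ring
  · linear_combination (e ^ 2 - e + 1) * e₁ - (q - e * q - q ^ 2 + p * r) * he
  · linear_combination e₃
  · ring
  · linear_combination e₄

end FigEight

end

/-! ### Realising every point of the hypersurface -/

noncomputable section

namespace FigEight

open scoped Matrix

/-- Modulo e³ - e² + e - 1 the factors (2e² - e + 1)/4 and (e + e²)/4 are the inverses of e² + 2e -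
1 and 3e² - 2e + 1. This undoes the rescaling of the parameters in the circulant construction. -/
theorem exists_isTrianglePair {m n z e : ℂ} (he : e ^ 3 = e ^ 2 - e + 1)
    (hz : z ^ 2 - (n * m - 2) * z + n ^ 3 + m ^ 3 - 5 * n * m + 5 = 0)
    (hD : -1 + 3 * ((2 * e ^ 2 - e + 1) / 4 * m) * ((e + e ^ 2) / 4 * n)
      - ((2 * e ^ 2 - e + 1) / 4 * m) ^ 3 - ((e + e ^ 2) / 4 * n) ^ 3 ≠ 0) :
    ∃ K L : SL3, IsTrianglePair K L ∧ tr (K * L⁻¹) = n ∧ tr (K⁻¹ * L) = m ∧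
      tr (K * L * K⁻¹ * L⁻¹) = z := by
  obtain ⟨K, L, h, h₁, h₂, h₃⟩ := exists_isTrianglePair_of_circulant
    (h := (z + e ^ 2) * (e + e ^ 2) / 4) he hD (by
      linear_combination ((e + e ^ 2) / 4) ^ 2 * hz + (
        -1 + 1/4 * z * e + 3/8 * z * e ^ 2 - 5/64 * z * e ^ 2 * m * n + 1/8 * z * e ^ 3 - 3/16 *
        z * e ^ 3 * m * n - 9/64 * z * e ^ 4 * m * n - 1/32 * z * e ^ 5 * m * n + 5/16 * e * m *
        n + 1/8 * e * m ^ 3 + 5/16 * e ^ 2 - 3/8 * e ^ 2 * m * n - 19/64 * e ^ 2 * m ^ 3 + 1/16 *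
        e ^ 2 * n ^ 3 + 3/16 * e ^ 3 - 11/16 * e ^ 3 * m * n + 19/32 * e ^ 3 * m ^ 3 + 11/64 * e
        ^ 3 * n ^ 3 + 3/16 * e ^ 4 - 5/64 * e ^ 4 * m * n - 5/16 * e ^ 4 * m ^ 3 + 5/32 * e ^ 4 *
        n ^ 3 + 1/16 * e ^ 5 - 3/16 * e ^ 5 * m * n + 1/8 * e ^ 5 * m ^ 3 + 3/64 * e ^ 5 * n ^ 3
        - 9/64 * e ^ 6 * m * n - 1/32 * e ^ 7 * m * n - 3/64 * m ^ 3) * he)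
  refine ⟨K, L, h, ?_, ?_, ?_⟩
  · rw [h₁]
    linear_combination (3 / 4 * e + 1) * n * he
  · rw [h₂]
    linear_combination (e / 2 + 5 / 4) * m * he
  · rw [h₃]
    linear_combination (3 / 4 * e + 1) * (z + e ^ 2) * he

theorem exists_isTriangleRep {x : Fin 3 → ℂ} (hx : x ∈ hypersurface) :
    ∃ ρ : KnotGroup →* SL3, IsTriangleRep ρ ∧ param₁ (character ρ) = x := by
  by_cases hex : x ∈ exceptionalPoints
  · obtain ⟨ω, h, rfl⟩ := mem_exceptionalPoints.1 hex
    exact ⟨_, Exceptional.isTriangleRep_rep h, Exceptional.param_rep h⟩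
  suffices h : ∃ K L : SL3, IsTrianglePair K L ∧ tr (K * L⁻¹) = x 0 ∧ tr (K⁻¹ * L) = x 1 ∧
      tr (K * L * K⁻¹ * L⁻¹) = x 0 * x 1 - 2 - x 2 by
    obtain ⟨K, L, h, h₁, h₂, h₃⟩ := h
    refine ⟨_, h.isTriangleRep, ?_⟩
    have e := h.tr_comm_add
    rw [IsTriangleRep.param_eq, h.rep_comp_k, h.rep_comp_l, h₁, h₂]
    rw [h₁, h₂, h₃] at e
    ext i
    fin_cases i
    · rfl
    · rfl
    · change zeta K L = x 2
      linear_combination e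
  have hx' : x 2 ^ 2 - (x 0 * x 1 - 2) * x 2 + x 0 ^ 3 + x 1 ^ 3 - 5 * (x 0 * x 1) + 5 = 0 := hx
  -- The commutator trace needed here is the second root of the quadratic satisfied by x 2.
  have hz : (x 0 * x 1 - 2 - x 2) ^ 2 - (x 0 * x 1 - 2) * (x 0 * x 1 - 2 - x 2) + x 0 ^ 3
      + x 1 ^ 3 - 5 * x 0 * x 1 + 5 = 0 := by linear_combination hx'
  by_contra hne
  -- If no pair exists, the circulant determinant vanishes for each of the eigenvalues e = 1, i, -i.
  -- The three resulting equations fix x 0 ³, x 1 ³ and x 0 x 1, and they leave only exceptional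
  -- points.
  have key := fun e he => not_imp_comm.1 (exists_isTrianglePair (e := e) he hz) hne
  have i₂ := Complex.I_sq
  have i₃ : Complex.I ^ 3 = -Complex.I := by rw [pow_succ, i₂]; ring
  have i₄ := Complex.I_pow_four
  have i₅ : Complex.I ^ 5 = Complex.I := by rw [pow_succ, i₄]; ring
  have i₆ : Complex.I ^ 6 = -1 := by rw [pow_succ, i₅, ← sq, i₂]
  have k₁ := key 1 (by norm_num)
  have k₂ := key Complex.I (by rw [i₂, i₃]; ring)
  have k₃ := key (-Complex.I) (by ring_nf; rw [i₂, i₃]; ring)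
  ring_nf at k₁ k₂ k₃
  simp only [i₂, i₃, i₄, i₅, i₆] at k₂ k₃
  ring_nf at k₂ k₃
  have s₁ : x 0 ^ 3 = 6 * (x 0 * x 1) - 16 := by
    linear_combination -8 * (k₂ + k₃) + 8 * Complex.I * (k₂ - k₃) - (x 1 ^ 3 - x 0 ^ 3) / 2 * i₂
  have s₂ : x 1 ^ 3 = 6 * (x 0 * x 1) - 16 := by
    linear_combination -8 * (k₂ + k₃) - 8 * Complex.I * (k₂ - k₃) + (x 1 ^ 3 - x 0 ^ 3) / 2 * i₂
  have s₃ : x 0 * x 1 = 4 := by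
    linear_combination -(4 / 3) * k₁ - (s₁ + s₂) / 6
  have s₄ : x 1 ^ 3 = 8 := by linear_combination s₂ + 6 * s₃
  refine hex (mem_exceptionalPoints.2 ⟨x 1 / 2, by linear_combination s₄ / 8, ?_⟩)
  have s₅ : x 2 = 1 := by
    have : (x 2 - 1) ^ 2 = 0 := by
      linear_combination hx' - s₄ - s₁ + (x 2 - 1) * s₃
    rw [sq_eq_zero_iff] at this
    linear_combination this
  ext i
  fin_cases i
  · change x 0 = 2 * (x 1 / 2) ^ 2
    linear_combination (x 1 ^ 2 * s₃ - x 0 * s₄) / 8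
  · change x 1 = 2 * (x 1 / 2)
    ring
  · exact s₅

end FigEight

end

noncomputable section

namespace FigEight

open scoped Matrix
open MvPolynomial

/-! ### The component `V₁` is an irreducible surface -/

/-- By the Nullstellensatz the polynomials that vanish on the zero locus are the multiples of `f`.
-/
theorem isIrreducibleAlgebraicSet_of_prime {σ : Type*} [Finite σ] {f : MvPolynomial σ ℂ}
    (hf : Prime f) : IsIrreducibleAlgebraicSet (zeroLocus ℂ (Ideal.span {f})) := by
  have : (Ideal.span {f}).IsPrime := (Ideal.span_singleton_prime hf.ne_zero).2 hf
  have key (g : MvPolynomial σ ℂ) : (∀ x ∈ zeroLocus ℂ (Ideal.span {f}), eval x g = 0) ↔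
      g ∈ Ideal.span {f} := by
    have e := IsPrime.vanishingIdeal_zeroLocus (K := ℂ) (k := ℂ) (Ideal.span {f})
    rw [← SetLike.ext_iff.1 e g, mem_vanishingIdeal_iff]
    simp only [aeval_eq_eval]
  refine isIrreducibleAlgebraicSet_of_mul ⟨_, rfl⟩ ?_ fun g h hgh => ?_
  · by_contra hne
    rw [Set.not_nonempty_iff_eq_empty] at hne
    refine this.ne_top ((Ideal.eq_top_iff_one _).2 ((key 1).1 fun x hx => ?_))
    rw [hne] at hx
    exact hx.elim
  · rw [key, key]
    exact this.mem_or_mem ((key _).1 fun x hx => by rw [map_mul]; exact hgh x hx)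

/-- The equation of the hypersurface. -/
def hypersurfaceEquation : MvPolynomial (Fin 3) ℂ :=
  X 2 ^ 2 - (X 0 * X 1 - C 2) * X 2 + X 0 ^ 3 + X 1 ^ 3 - C 5 * (X 0 * X 1) + C 5

theorem eval_hypersurfaceEquation (x : Fin 3 → ℂ) : eval x hypersurfaceEquation =
    x 2 ^ 2 - (x 0 * x 1 - 2) * x 2 + x 0 ^ 3 + x 1 ^ 3 - 5 * (x 0 * x 1) + 5 := by
  simp [hypersurfaceEquation]

theorem hypersurface_eq_zeroLocus :
    hypersurface = zeroLocus ℂ (Ideal.span {hypersurfaceEquation}) := by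
  ext x
  rw [zeroLocus_span]
  simp [hypersurface, aeval_eq_eval, eval_hypersurfaceEquation]

theorem prime_hypersurfaceEquation : Prime hypersurfaceEquation := by
  rw [← MulEquiv.prime_iff (finSuccEquiv ℂ 2).toMulEquiv]
  have e : (finSuccEquiv ℂ 2).toMulEquiv hypersurfaceEquation =
      Polynomial.X ^ 3 - Polynomial.C ((X 1 + C 5) * X 0) * Polynomial.X
        + Polynomial.C (X 1 ^ 2 + C 2 * X 1 + X 0 ^ 3 + C 5) := by
    change finSuccEquiv ℂ 2 hypersurfaceEquation = _
    have h1 : (1 : Fin 3) = Fin.succ 0 := rfl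
    have h2 : (2 : Fin 3) = Fin.succ 1 := rfl
    simp only [hypersurfaceEquation, map_add, map_sub, map_mul, map_pow, finSuccEquiv_X_zero, h1,
      h2, finSuccEquiv_X_succ, ← algebraMap_eq, AlgEquiv.commutes]
    simp only [algebraMap_eq, map_ofNat]
    ring
  rw [e, ← UniqueFactorizationMonoid.irreducible_iff_prime]
  have hdeg : (Polynomial.X ^ 3 - Polynomial.C ((X 1 + C 5) * X 0) * Polynomial.X
        + Polynomial.C (X 1 ^ 2 + C 2 * X 1 + X 0 ^ 3 + C 5) :
        Polynomial (MvPolynomial (Fin 2) ℂ)).natDegree = 3 := by compute_degree!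
  have hm : (Polynomial.X ^ 3 - Polynomial.C ((X 1 + C 5) * X 0) * Polynomial.X
        + Polynomial.C (X 1 ^ 2 + C 2 * X 1 + X 0 ^ 3 + C 5) :
        Polynomial (MvPolynomial (Fin 2) ℂ)).Monic := by monicity!
  rw [hm.irreducible_iff_roots_eq_zero_of_degree_le_three (by rw [hdeg]; norm_num) hdeg.le,
    Multiset.eq_zero_iff_forall_notMem]
  intro r hr
  have hr := (Polynomial.mem_roots'.1 hr).2
  -- A cubic in ν that factors has a root in ℂ[ν̄, ζ]. Setting ν̄ = 0 would make -(ζ² + 2ζ + 5), of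
  -- degree two, a cube.
  have h := congrArg (aeval (R := ℂ) ![(0 : Polynomial ℂ), Polynomial.X]) hr
  simp at h
  have h' : (aeval (R := ℂ) ![(0 : Polynomial ℂ), Polynomial.X] r) ^ 3
      = -(Polynomial.X ^ 2 + Polynomial.C 2 * Polynomial.X + Polynomial.C 5) := by
    rw [eq_neg_iff_add_eq_zero]
    simpa using h
  have hd : (-(Polynomial.X ^ 2 + Polynomial.C 2 * Polynomial.X + Polynomial.C 5) :
    Polynomial ℂ).natDegree = 2 := by rw [Polynomial.natDegree_neg]; compute_degree!
  rw [← h', Polynomial.natDegree_pow] at hd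
  omega

theorem isIrreducibleAlgebraicSet_hypersurface : IsIrreducibleAlgebraicSet hypersurface := by
  rw [hypersurface_eq_zeroLocus]
  exact isIrreducibleAlgebraicSet_of_prime prime_hypersurfaceEquation

theorem triangleCharacter_mem {x : Fin 3 → ℂ} (hx : x ∈ hypersurface) :
    triangleCharacter x ∈ triangleComponent ∧ param₁ (triangleCharacter x) = x := by
  obtain ⟨ρ, hρ, rfl⟩ := exists_isTriangleRep hx
  have h : character ρ ∈ triangleComponent := ⟨ρ, hρ, rfl⟩
  rw [triangleCharacter_param h]
  exact ⟨h, rfl⟩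

theorem isAlgebraicIso_triangleComponent :
    IsAlgebraicIso param₁ triangleComponent hypersurface :=
  ⟨isPolynomialMap_param₁, fun _ => param_mem_hypersurface, triangleCharacter,
    isPolynomialMap_triangleCharacter, fun _ hx => (triangleCharacter_mem hx).1,
    fun _ => triangleCharacter_param, fun _ hx => (triangleCharacter_mem hx).2⟩

theorem IsPolynomialMap.comp {σ τ υ : Type*} {F : (σ → ℂ) → (τ → ℂ)} {G : (τ → ℂ) → (υ → ℂ)}
    (hG : IsPolynomialMap G) (hF : IsPolynomialMap F) : IsPolynomialMap (G ∘ F) := by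
  obtain ⟨P, hP⟩ := hF
  obtain ⟨Q, hQ⟩ := hG
  refine ⟨fun i => bind₁ P (Q i), fun x i => ?_⟩
  rw [Function.comp_apply, hQ, ← aeval_eq_eval, ← aeval_eq_eval, aeval_bind₁]
  congr 2
  funext j
  rw [hP, aeval_eq_eval]

theorem IsPolynomialMap.isAlgebraicSet_fixed {σ : Type*} {F : (σ → ℂ) → (σ → ℂ)}
    (hF : IsPolynomialMap F) : IsAlgebraicSet {x | F x = x} := by
  obtain ⟨P, hP⟩ := hF
  have : {x | F x = x} = ⋂ i, {x : σ → ℂ | eval x (P i) = eval x (X i)} := by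
    ext x
    simp [funext_iff, hP]
  rw [this]
  exact isAlgebraicSet_iInter fun i => isAlgebraicSet_setOf_eq _ _

theorem triangleComponent_eq_image : triangleComponent = triangleCharacter '' hypersurface :=
  Set.Subset.antisymm
    (fun χ h => ⟨param₁ χ, param_mem_hypersurface h, triangleCharacter_param h⟩)
    (Set.image_subset_iff.2 fun _ hx => (triangleCharacter_mem hx).1)

/-- Over the hypersurface the set consists of the fixed points of the polynomial map
`triangleCharacter ∘ param₁`. So it is closed in the infinite-dimensional space of functions on Γ.
-/
theorem isAlgebraicSet_triangleComponent : IsAlgebraicSet triangleComponent := by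
  have : triangleComponent =
      {χ | (triangleCharacter ∘ param₁) χ = χ} ∩ param₁ ⁻¹' hypersurface := by
    ext χ
    refine ⟨fun h => ⟨triangleCharacter_param h, param_mem_hypersurface h⟩, fun h => ?_⟩
    rw [← show triangleCharacter (param₁ χ) = χ from h.1]
    exact (triangleCharacter_mem h.2).1
  rw [this]
  exact (isPolynomialMap_triangleCharacter.comp isPolynomialMap_param₁).isAlgebraicSet_fixed.inter
    (isPolynomialMap_param₁.isAlgebraicSet_preimage isIrreducibleAlgebraicSet_hypersurface.1)

theorem isIrreducibleAlgebraicSet_triangleComponent :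
    IsIrreducibleAlgebraicSet triangleComponent := by
  have h := isAlgebraicSet_triangleComponent
  rw [triangleComponent_eq_image] at h ⊢
  exact isIrreducibleAlgebraicSet_hypersurface.image isPolynomialMap_triangleCharacter h

theorem eq_of_param_eq {χ χ' : KnotGroup → ℂ} (h : χ ∈ triangleComponent)
    (h' : χ' ∈ triangleComponent) (e : param₁ χ = param₁ χ') : χ = χ' := by
  rw [← triangleCharacter_param h, ← triangleCharacter_param h', e]

theorem mem_irredCharacters_iff {χ : KnotGroup → ℂ} (h : χ ∈ triangleComponent) :
    χ ∈ irredCharacters KnotGroup ↔ param₁ χ ∉ exceptionalPoints := by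
  constructor
  · rintro ⟨ρ, hρ, rfl⟩ hx
    obtain ⟨ω, hω, e⟩ := mem_exceptionalPoints.1 hx
    exact hρ.character_ne_exceptional hω (eq_of_param_eq h ⟨_, Exceptional.isTriangleRep_rep hω, rfl⟩
      (e.trans (Exceptional.param_rep hω).symm))
  · intro hx
    obtain ⟨ρ, hρ, rfl⟩ := h
    exact ⟨ρ, hρ.isIrreducibleRep hx, rfl⟩

end FigEight

end

noncomputable section

namespace FigEight

open scoped Matrix
open MvPolynomial

/-! ### The component `V₂` -/

/-- The image of `V₁` under the symmetry `flip`. -/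
def flippedComponent : Set (KnotGroup → ℂ) := {χ | χ ∘ flip ∈ triangleComponent}

theorem flip_symm_t : flip.symm t = t⁻¹ := by rw [MulEquiv.symm_apply_eq, map_inv, flip_t, inv_inv]
theorem flip_symm_longitude : flip.symm longitude = longitude := by
  rw [MulEquiv.symm_apply_eq, flip_longitude]

theorem isPolynomialMap_precomp {σ τ : Type*} (e : τ → σ) :
    IsPolynomialMap fun χ : σ → ℂ => χ ∘ e :=
  ⟨fun i => X (e i), fun χ i => by simp⟩

theorem flippedComponent_eq_image :
    flippedComponent = (fun χ : KnotGroup → ℂ => χ ∘ flip.symm) '' triangleComponent := by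
  ext χ
  constructor
  · exact fun h => ⟨_, h, by funext g; simp⟩
  · rintro ⟨χ, h, rfl⟩
    change (χ ∘ flip.symm) ∘ flip ∈ triangleComponent
    convert h
    funext g
    simp

theorem isIrreducibleAlgebraicSet_flippedComponent :
    IsIrreducibleAlgebraicSet flippedComponent := by
  have h : IsAlgebraicSet flippedComponent :=
    (isPolynomialMap_precomp flip).isAlgebraicSet_preimage isAlgebraicSet_triangleComponent
  rw [flippedComponent_eq_image] at h ⊢
  exact isIrreducibleAlgebraicSet_triangleComponent.image (isPolynomialMap_precomp _) h

theorem param₁_comp_flip (χ : KnotGroup → ℂ) : param₁ (χ ∘ flip) = param₂ χ := by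
  simp [param₁, param₂]

theorem isAlgebraicIso_flippedComponent :
    IsAlgebraicIso param₂ flippedComponent hypersurface := by
  refine ⟨⟨![X t, X t⁻¹, X a], fun χ i => by fin_cases i <;> simp [param₂]⟩,
    fun χ h => ?_, fun x => triangleCharacter x ∘ flip.symm,
    (isPolynomialMap_precomp flip.symm).comp isPolynomialMap_triangleCharacter, fun x hx => ?_,
    fun χ h => ?_, fun x hx => ?_⟩
  · rw [← param₁_comp_flip]
    exact param_mem_hypersurface h
  · rw [flippedComponent_eq_image]
    exact ⟨_, (triangleCharacter_mem hx).1, rfl⟩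
  · change triangleCharacter (param₂ χ) ∘ flip.symm = χ
    rw [← param₁_comp_flip, triangleCharacter_param h]
    funext g
    simp
  · rw [← param₁_comp_flip]
    convert (triangleCharacter_mem hx).2
    funext g
    simp

theorem mem_irredCharacters_comp_flip {χ : KnotGroup → ℂ} :
    χ ∘ flip ∈ irredCharacters KnotGroup ↔ χ ∈ irredCharacters KnotGroup := by
  constructor
  · rintro ⟨ρ, hρ, h⟩
    refine ⟨ρ.comp flip.symm.toMonoidHom, hρ.comp_of_surjective _ flip.symm.surjective, ?_⟩
    funext g
    have := congrFun h (flip.symm g)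
    rw [Function.comp_apply, MulEquiv.apply_symm_apply] at this
    exact this
  · rintro ⟨ρ, hρ, rfl⟩
    exact ⟨ρ.comp flip.toMonoidHom, hρ.comp_of_surjective _ flip.surjective, rfl⟩

theorem mem_irredCharacters_iff_of_flipped {χ : KnotGroup → ℂ} (h : χ ∈ flippedComponent) :
    χ ∈ irredCharacters KnotGroup ↔ param₂ χ ∉ exceptionalPoints := by
  rw [← mem_irredCharacters_comp_flip, mem_irredCharacters_iff h, param₁_comp_flip]

theorem factorsThroughFilling_flippedComponent : FactorsThroughFilling flippedComponent 3 := by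
  refine ⟨QuotientGroup.lift (fillingKernel 3) (toTriangle.comp flip.symm.toMonoidHom)
    (fillingKernel_le_ker _ ?_), ?_, ?_⟩
  · have := toTriangle_longitude
    simpa [flip_symm_t, flip_symm_longitude] using this
  · intro x
    obtain ⟨g, rfl⟩ := toTriangle_surjective x
    exact ⟨toFilling 3 (flip g), by simp [toFilling]⟩
  · rintro χ ⟨ρ, hρ, h⟩
    refine ⟨IsTrianglePair.rep hρ, ?_⟩
    funext g
    have := congrFun h (flip.symm g)
    rw [← hρ.comp_toTriangle, Function.comp_apply, MulEquiv.apply_symm_apply] at this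
    exact this

theorem character_apply_conj (ρ : KnotGroup →* SL3) (g h : KnotGroup) :
    character ρ (g * h * g⁻¹) = character ρ h := by
  simp only [character_apply, map_mul, map_inv, tr_conj]

theorem triangleComponent_apply_a {χ : KnotGroup → ℂ} (h : χ ∈ triangleComponent) :
    χ a = 1 ∧ χ a⁻¹ = 1 := by
  obtain ⟨ρ, hρ, rfl⟩ := h
  exact ⟨hρ.tr_a, by rw [character_apply, map_inv, hρ.tr_a_inv]⟩

theorem triangleComponent_apply_b {χ : KnotGroup → ℂ} (h : χ ∈ triangleComponent) :
    χ b = param₁ χ 0 * param₁ χ 1 - 2 - param₁ χ 2 := by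
  obtain ⟨ρ, hρ, rfl⟩ := h
  simpa [param₁, character_apply] using hρ.tr_b

theorem flippedComponent_subset {χ : KnotGroup → ℂ} (h : χ ∈ flippedComponent) :
    ∃ ρ : KnotGroup →* SL3, IsTriangleRep (ρ.comp flip.toMonoidHom) ∧ χ = character ρ := by
  obtain ⟨ρ, hρ, h⟩ := h
  refine ⟨ρ.comp flip.symm.toMonoidHom, ?_, ?_⟩
  · convert hρ
    ext1 g
    simp
  · funext g
    have := congrFun h (flip.symm g)
    rw [Function.comp_apply, MulEquiv.apply_symm_apply] at this
    exact this

theorem flippedComponent_apply_b {χ : KnotGroup → ℂ} (h : χ ∈ flippedComponent) :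
    χ b = 1 ∧ χ b⁻¹ = 1 := by
  have e := triangleComponent_apply_a h
  obtain ⟨ρ, hρ, rfl⟩ := flippedComponent_subset h
  rw [Function.comp_apply, Function.comp_apply, map_inv, flip_a, character_apply_conj,
    show (a * b * a⁻¹)⁻¹ = a * b⁻¹ * a⁻¹ by group, character_apply_conj] at e
  exact e

/-! ### The intersection of `V₁` and `V₂` -/

theorem Exceptional.coe_B_inv : ((B⁻¹ : SL3) : Matrix (Fin 3) (Fin 3) ℂ) =
    !![1, 0, 0; 0, 0, -1; 0, 1, 0] := by
  rw [Matrix.SpecialLinearGroup.coe_inv, coe_B, Matrix.adjugate_fin_three_of]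
  refine of_fin_three_ext ?_ ?_ ?_ ?_ ?_ ?_ ?_ ?_ ?_ <;> ring

theorem Exceptional.T'_inv {ω : ℂ} (h : ω ^ 3 = 1) : (T' ω h)⁻¹ = T ω h := by
  rw [← T_inv, inv_inv]

theorem Exceptional.isTriangleRep_rep_flip {ω : ℂ} (h : ω ^ 3 = 1) :
    IsTriangleRep ((rep ω h).comp flip.toMonoidHom) := by
  have I6 : Complex.I ^ 6 = -1 := by rw [pow_succ, pow_succ, Complex.I_pow_four, one_mul, Complex.I_mul_I]
  have h6 : ω ^ 6 = 1 := by linear_combination (ω ^ 3 + 1) * h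
  constructor <;> simp only [MonoidHom.comp_apply, MulEquiv.toMonoidHom_eq_coe, MonoidHom.coe_coe,
    map_mul, map_inv, flip_a, flip_t, rep_a, rep_b, rep_t, mul_inv_rev, inv_inv, A_inv, A'_inv, T_inv, T'_inv,
    tr, Matrix.SpecialLinearGroup.coe_mul, coe_A, coe_A', coe_B, coe_B_inv, coe_T, coe_T',
    Matrix.mul_fin_three, Matrix.trace_fin_three_of] <;>
  · ring_nf
    try simp only [Complex.I_sq, Complex.I_pow_four, I6, h, h6]
    try ring_nf

theorem mem_triangle_inter_flipped {χ : KnotGroup → ℂ} :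
    χ ∈ triangleComponent ∩ flippedComponent ↔
      ∃ (ω : ℂ) (h : ω ^ 3 = 1), χ = character (Exceptional.rep ω h) := by
  constructor
  · rintro ⟨h₁, h₂⟩
    have hb := flippedComponent_apply_b h₂
    have hb' := triangleComponent_apply_b h₁
    have hH : _ = (0 : ℂ) := param_mem_hypersurface h₁
    have h2 : param₁ χ 2 = 1 := hb.2
    rw [hb.1, h2] at hb'
    rw [h2] at hH
    set x := param₁ χ with hx
    have h4 : x 0 * x 1 = 4 := by linear_combination -hb'
    -- Here x 0 ³ and x 1 ³ have sum 16 and product 64, so both are equal to 8.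
    have h8 : (x 1 ^ 3 - 8) ^ 2 = 0 := by
      linear_combination x 1 ^ 3 * hH + (6 * x 1 ^ 3 - (x 0 ^ 2 * x 1 ^ 2 + 4 * x 0 * x 1 + 16)) * h4
    rw [sq_eq_zero_iff] at h8
    have hω : (x 1 / 2) ^ 3 = 1 := by linear_combination h8 / 8
    refine ⟨x 1 / 2, hω, eq_of_param_eq h₁ ⟨_, Exceptional.isTriangleRep_rep hω, rfl⟩ ?_⟩
    rw [Exceptional.param_rep, ← hx]
    ext i
    fin_cases i
    · change x 0 = 2 * (x 1 / 2) ^ 2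
      linear_combination (x 1 ^ 2 * h4 - x 0 * h8) / 8
    · change x 1 = 2 * (x 1 / 2)
      ring
    · exact h2
  · rintro ⟨ω, h, rfl⟩
    exact ⟨⟨_, Exceptional.isTriangleRep_rep h, rfl⟩, _, Exceptional.isTriangleRep_rep_flip h, rfl⟩

theorem Exceptional.param₂_rep {ω : ℂ} (h : ω ^ 3 = 1) :
    param₂ (character (rep ω h)) = ![2 * ω, 2 * ω ^ 2, 1] := by
  have e := param_rep h
  have e₀ : character (rep ω h) t⁻¹ = 2 * ω ^ 2 := congrFun e 0
  have e₁ : character (rep ω h) t = 2 * ω := congrFun e 1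
  have e₂ := (triangleComponent_apply_a ⟨_, isTriangleRep_rep h, rfl⟩).1
  rw [param₂, e₀, e₁, e₂]

theorem param₁_image_inter :
    param₁ '' (triangleComponent ∩ flippedComponent) = exceptionalPoints := by
  ext x
  rw [mem_exceptionalPoints]
  constructor
  · rintro ⟨χ, hχ, rfl⟩
    obtain ⟨ω, h, rfl⟩ := mem_triangle_inter_flipped.1 hχ
    exact ⟨ω, h, Exceptional.param_rep h⟩
  · rintro ⟨ω, h, rfl⟩
    exact ⟨_, mem_triangle_inter_flipped.2 ⟨ω, h, rfl⟩, Exceptional.param_rep h⟩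

theorem param₂_image_inter :
    param₂ '' (triangleComponent ∩ flippedComponent) = exceptionalPoints := by
  have inv : ∀ ω : ℂ, ω ^ 3 = 1 → (ω ^ 2) ^ 3 = 1 ∧ (ω ^ 2) ^ 2 = ω := fun ω h =>
    ⟨by linear_combination (ω ^ 3 + 1) * h, by linear_combination ω * h⟩
  ext x
  rw [mem_exceptionalPoints]
  constructor
  · rintro ⟨χ, hχ, rfl⟩
    obtain ⟨ω, h, rfl⟩ := mem_triangle_inter_flipped.1 hχ
    exact ⟨ω ^ 2, (inv ω h).1, by rw [Exceptional.param₂_rep, (inv ω h).2]⟩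
  · rintro ⟨ω, h, rfl⟩
    exact ⟨_, mem_triangle_inter_flipped.2 ⟨ω ^ 2, (inv ω h).1, rfl⟩,
      by rw [Exceptional.param₂_rep, (inv ω h).2]⟩

/-- Only the image of t involves ω, so the three exceptional characters agree on the fibre group. -/
theorem Exceptional.rep_apply_fibre {ω : ℂ} (h : ω ^ 3 = 1) (g : fibreGroup) :
    rep ω h g = rep 1 (one_pow 3) g := by
  obtain ⟨g, hg⟩ := g
  induction hg using Subgroup.closure_induction with
  | mem x hx => rcases hx with rfl | rfl <;> simp
  | one => simp
  | mul x y _ _ hx hy => simp only [map_mul] at *; rw [hx, hy]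
  | inv x _ hx => simp only [map_inv] at *; rw [hx]

theorem restrictToFibre_image_inter :
    ∃ ψ ∈ characters fibreGroup,
      restrictToFibre '' (triangleComponent ∩ flippedComponent) = {ψ} ∧
      ∀ g : fibreGroup, ((g : KnotGroup) = a ∨ (g : KnotGroup) = a⁻¹ ∨ (g : KnotGroup) = b ∨
        (g : KnotGroup) = b⁻¹) → ψ g = 1 := by
  have hmem := mem_triangle_inter_flipped.2 ⟨1, one_pow 3, rfl⟩
  refine ⟨restrictToFibre (character (Exceptional.rep 1 (one_pow 3))),
    ⟨(Exceptional.rep 1 (one_pow 3)).comp fibreGroup.subtype, rfl⟩, ?_, ?_⟩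
  · ext ψ
    constructor
    · rintro ⟨χ, hχ, rfl⟩
      obtain ⟨ω, h, rfl⟩ := mem_triangle_inter_flipped.1 hχ
      funext g
      simp only [restrictToFibre, character_apply, Exceptional.rep_apply_fibre h g]
    · rintro rfl
      exact ⟨_, hmem, rfl⟩
  · have h₁ := triangleComponent_apply_a hmem.1
    have h₂ := flippedComponent_apply_b hmem.2
    rintro g (hg | hg | hg | hg) <;> rw [restrictToFibre, hg]
    exacts [h₁.1, h₁.2, h₂.1, h₂.2]

end FigEight

end

noncomputable section

namespace FigEight

open scoped Matrix
open MvPolynomial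

/-! ### The component `V₀` -/

/-- The words U⁻¹J, J·UJU⁻¹ and J·U²JU⁻² for t, b and a are those forced by an involution J that
inverts a and b. Both knot relations then follow from the commutation of J with one word, and
`generators_of_involution` supplies the converse. -/
theorem knot_relations_of_involution {H : Type*} [Group H] {J U : H} (hJ : J * J = 1)
    (h : J * (U * U * J * (U⁻¹ * J * U * U)) = U * U * J * (U⁻¹ * J * U * U) * J) :
    U⁻¹ * J * (J * (U * U * J * U⁻¹ * U⁻¹)) * (U⁻¹ * J)⁻¹ =
        J * (U * U * J * U⁻¹ * U⁻¹) * (J * (U * J * U⁻¹)) ∧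
      U⁻¹ * J * (J * (U * J * U⁻¹)) * (U⁻¹ * J)⁻¹ =
        J * (U * J * U⁻¹) * (J * (U * U * J * U⁻¹ * U⁻¹)) * (J * (U * J * U⁻¹)) := by
  have hi : J⁻¹ = J := inv_eq_of_mul_eq_one_left hJ
  have c (x : H) : J * (J * x) = x := by rw [← mul_assoc, hJ, one_mul]
  have h₁ : J * (U⁻¹ * (U⁻¹ * (J * (U * (J * (U⁻¹ * U⁻¹)))))) =
      U⁻¹ * (U⁻¹ * (J * (U * (J * (U⁻¹ * (U⁻¹ * J)))))) := by
    have := congrArg Inv.inv h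
    simp only [mul_inv_rev, hi, inv_inv, mul_assoc] at this
    exact this.symm
  have h₂ : J * (U⁻¹ * (U⁻¹ * (J * (U * (J * U⁻¹))))) =
      U⁻¹ * (U⁻¹ * (J * (U * (J * (U⁻¹ * (U⁻¹ * (J * U))))))) := by
    have := congrArg (· * U) h₁
    simpa only [mul_assoc, inv_mul_cancel, mul_one] using this
  constructor
  · simp only [mul_inv_rev, hi, inv_inv, mul_assoc, c, inv_mul_cancel_left]
    rw [h₂]
    simp only [mul_inv_cancel_left, c]
  · simp only [mul_inv_rev, hi, inv_inv, mul_assoc, c, inv_mul_cancel_left]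
    rw [h₂]
    simp only [mul_inv_cancel_left, c, inv_mul_cancel_left]

/-- The companion matrix with characteristic polynomial `λ³ + x λ² - w λ - 1`. -/
def companion (x w : ℂ) : SL3 :=
  ⟨!![0, 0, 1; 1, 0, w; 0, 1, -x], by simp [Matrix.det_fin_three]⟩

/-- The involution with eigenvalues `1, -1, -1` that has the first basis vector as an eigenvector
and acts as `-1` on the kernel of the linear form `(2, z, u)`. -/
def involution (z u : ℂ) : SL3 :=
  ⟨!![1, z, u; 0, -1, 0; 0, 0, -1], by simp [Matrix.det_fin_three]⟩

theorem coe_companion (x w : ℂ) : (companion x w : Matrix (Fin 3) (Fin 3) ℂ) =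
    !![0, 0, 1; 1, 0, w; 0, 1, -x] := rfl

theorem coe_companion_inv (x w : ℂ) :
    (((companion x w)⁻¹ : SL3) : Matrix (Fin 3) (Fin 3) ℂ) = !![-w, 1, 0; x, 0, 1; 1, 0, 0] := by
  rw [Matrix.SpecialLinearGroup.coe_inv, coe_companion, Matrix.adjugate_fin_three_of]
  refine of_fin_three_ext ?_ ?_ ?_ ?_ ?_ ?_ ?_ ?_ ?_ <;> ring

theorem coe_involution (z u : ℂ) : (involution z u : Matrix (Fin 3) (Fin 3) ℂ) =
    !![1, z, u; 0, -1, 0; 0, 0, -1] := rfl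

theorem involution_mul_self (z u : ℂ) : involution z u * involution z u = 1 := by
  refine Subtype.ext ?_
  simp only [Matrix.SpecialLinearGroup.coe_mul, Matrix.SpecialLinearGroup.coe_one, coe_involution,
    Matrix.mul_fin_three, Matrix.one_fin_three]
  refine of_fin_three_ext ?_ ?_ ?_ ?_ ?_ ?_ ?_ ?_ ?_ <;> ring

theorem coe_comm_left (x w z u : ℂ) :
    ((companion x w * companion x w * involution z u : SL3) :
      Matrix (Fin 3) (Fin 3) ℂ) =
      !![0, -1, x; 0, -w, -1 + w * x; 1, x + z, u - w - x ^ 2] := by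
  simp only [Matrix.SpecialLinearGroup.coe_mul, coe_companion, coe_involution, Matrix.mul_fin_three]
  refine of_fin_three_ext ?_ ?_ ?_ ?_ ?_ ?_ ?_ ?_ ?_ <;> ring

theorem coe_comm_right (x w z u : ℂ) :
    (((companion x w)⁻¹ * involution z u * companion x w * companion x w : SL3) :
      Matrix (Fin 3) (Fin 3) ℂ) =
      !![-u * w, u * w * x - 2 * w - w ^ 2 * z, -1 - u * w * x ^ 2 - u * w ^ 2 + 2 * w * x - w *
      z + w ^ 2 * x * z; -1 + u * x, -u * x ^ 2 + w * x * z + 2 * x, u * w * x + u * x ^ 3 - w -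
      w * x ^ 2 * z + x * z - 2 * x ^ 2; u, 1 - u * x + w * z, u * w + u * x ^ 2 - w * x * z - x
      + z] := by
  simp only [Matrix.SpecialLinearGroup.coe_mul, coe_companion, coe_companion_inv, coe_involution, Matrix.mul_fin_three]
  refine of_fin_three_ext ?_ ?_ ?_ ?_ ?_ ?_ ?_ ?_ ?_ <;> ring

/-- The element whose commutator with the involution gives the relation of the knot group. -/
def relator (x w z u : ℂ) : SL3 :=
  companion x w * companion x w * involution z u *
    ((companion x w)⁻¹ * involution z u * companion x w * companion x w)

theorem coe_relator (x w z u : ℂ) : (relator x w z u : Matrix (Fin 3) (Fin 3) ℂ) =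
      !![1, -x, w + x ^ 2; -u + w, -1 + u * x - w * x - w * z, -u * w - u * x ^ 2 + w * x * z + w
      * x ^ 2 + w ^ 2 + x - z; -2 * u * w + u * x * z + u ^ 2 - x - z, u + 2 * u * w * x + u * w
      * z - u * x ^ 2 * z - u ^ 2 * x - 3 * w + w * x * z ^ 2 - 2 * w ^ 2 * z + 2 * x * z + x ^
      2, -1 - 2 * u * w * x ^ 2 - 2 * u * w ^ 2 - u * x + u * x ^ 3 * z + u * z + u ^ 2 * w + u ^
      2 * x ^ 2 + 2 * w * x - w * x ^ 2 * z ^ 2 - 3 * w * z + 2 * w ^ 2 * x * z + x * z ^ 2 - 2 *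
      x ^ 2 * z - x ^ 3] := by
  rw [relator, Matrix.SpecialLinearGroup.coe_mul, coe_comm_left, coe_comm_right,
    Matrix.mul_fin_three]
  refine of_fin_three_ext ?_ ?_ ?_ ?_ ?_ ?_ ?_ ?_ ?_ <;> ring

theorem involution_comm {x w z : ℂ} (h : z * (x * w - 1) = x + w ^ 2) :
    involution z w * relator x w z w = relator x w z w * involution z w := by
  refine Subtype.ext ?_
  simp only [Matrix.SpecialLinearGroup.coe_mul, coe_relator, coe_involution, Matrix.mul_fin_three]
  refine of_fin_three_ext ?_ ?_ ?_ ?_ ?_ ?_ ?_ ?_ ?_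
  · linear_combination (w) * h
  · linear_combination (2 - w * x + w * z) * h
  · linear_combination (-w * x * z + w * x ^ 2 + w ^ 2 - 2 * x + z) * h
  · linear_combination (0) * h
  · linear_combination (0) * h
  · linear_combination (0) * h
  · linear_combination (-2) * h
  · linear_combination (-z) * h
  · linear_combination (-w) * h

/-- Two entries of the matrix equation suffice: entry (1, 0) gives u = w, and entry (2, 0) then
gives the equation of the surface. -/
theorem eq_of_involution_comm {x w z u : ℂ}
    (h : involution z u * relator x w z u = relator x w z u * involution z u) :
    u = w ∧ z * (x * w - 1) = x + w ^ 2 := by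
  have h := congrArg (fun g : SL3 => (g : Matrix (Fin 3) (Fin 3) ℂ)) h
  simp only [Matrix.SpecialLinearGroup.coe_mul, coe_relator, coe_involution,
    Matrix.mul_fin_three] at h
  have h₁ := congrFun (congrFun h 1) 0
  have h₂ := congrFun (congrFun h 2) 0
  simp only [Matrix.of_apply, Matrix.cons_val] at h₁ h₂
  have hu : u = w := by linear_combination h₁ / 2
  subst hu
  exact ⟨rfl, by linear_combination -h₂ / 2⟩

end FigEight

end

/-! ### The parameter surface of V₀ and its family of representations -/

noncomputable section

namespace FigEight

open scoped Matrix
open MvPolynomial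

/-- The parameter space of the component `V₀`, with coordinates `(w, x, z)`. -/
def symmetricSurface : Set (Fin 3 → ℂ) := {p | p 0 ^ 2 - p 1 * p 2 * p 0 + (p 1 + p 2) = 0}

theorem symmetricSurface_relation {p : Fin 3 → ℂ} (hp : p ∈ symmetricSurface) :
    p 2 * (p 1 * p 0 - 1) = p 1 + p 0 ^ 2 := by
  have hp : p 0 ^ 2 - p 1 * p 2 * p 0 + (p 1 + p 2) = 0 := hp
  linear_combination -hp

theorem mem_symmetricSurface {x w z : ℂ} (h : z * (x * w - 1) = x + w ^ 2) :
    ![w, x, z] ∈ symmetricSurface := by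
  change w ^ 2 - x * z * w + (x + z) = 0
  linear_combination -h

/-- The equation of the parameter space of `V₀`. -/
def symmetricEquation : MvPolynomial (Fin 3) ℂ := X 0 ^ 2 - X 1 * X 2 * X 0 + (X 1 + X 2)

theorem symmetricSurface_eq_zeroLocus :
    symmetricSurface = zeroLocus ℂ (Ideal.span {symmetricEquation}) := by
  ext p
  rw [zeroLocus_span]
  simp [symmetricSurface, symmetricEquation]

theorem prime_symmetricEquation : Prime symmetricEquation := by
  rw [← MulEquiv.prime_iff (finSuccEquiv ℂ 2).toMulEquiv]
  have e : (finSuccEquiv ℂ 2).toMulEquiv symmetricEquation =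
      Polynomial.X ^ 2 - Polynomial.C (X 0 * X 1) * Polynomial.X + Polynomial.C (X 0 + X 1) := by
    change finSuccEquiv ℂ 2 symmetricEquation = _
    have h1 : (1 : Fin 3) = Fin.succ 0 := rfl
    have h2 : (2 : Fin 3) = Fin.succ 1 := rfl
    simp only [symmetricEquation, map_add, map_sub, map_mul, map_pow, finSuccEquiv_X_zero, h1,
      h2, finSuccEquiv_X_succ]
  rw [e, ← UniqueFactorizationMonoid.irreducible_iff_prime]
  have hdeg : (Polynomial.X ^ 2 - Polynomial.C (X 0 * X 1) * Polynomial.X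
      + Polynomial.C (X 0 + X 1) : Polynomial (MvPolynomial (Fin 2) ℂ)).natDegree = 2 := by
    compute_degree!
  have hm : (Polynomial.X ^ 2 - Polynomial.C (X 0 * X 1) * Polynomial.X
      + Polynomial.C (X 0 + X 1) : Polynomial (MvPolynomial (Fin 2) ℂ)).Monic := by monicity!
  rw [hm.irreducible_iff_roots_eq_zero_of_degree_le_three hdeg.ge (by rw [hdeg]; norm_num),
    Multiset.eq_zero_iff_forall_notMem]
  intro r hr
  have hr := (Polynomial.mem_roots'.1 hr).2
  -- A factorisation would give a root of the quadratic in w. Setting z = 0 would then make -x a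
  -- square in ℂ[x].
  have h := congrArg (aeval (R := ℂ) ![Polynomial.X, (0 : Polynomial ℂ)]) hr
  simp at h
  have hd := congrArg Polynomial.natDegree (eq_neg_iff_add_eq_zero.2 h)
  rw [Polynomial.natDegree_neg, Polynomial.natDegree_X, Polynomial.natDegree_pow] at hd
  omega

theorem isIrreducibleAlgebraicSet_symmetricSurface :
    IsIrreducibleAlgebraicSet symmetricSurface := by
  rw [symmetricSurface_eq_zeroLocus]
  exact isIrreducibleAlgebraicSet_of_prime prime_symmetricEquation

/-- The representations that give the component `V₀`. -/
def symmetricRep {p : Fin 3 → ℂ} (hp : p ∈ symmetricSurface) : KnotGroup →* SL3 :=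
  knotLift _ _ _
    (knot_relations_of_involution (involution_mul_self (p 2) (p 0))
      (involution_comm (symmetricSurface_relation hp))).1
    (knot_relations_of_involution (involution_mul_self (p 2) (p 0))
      (involution_comm (symmetricSurface_relation hp))).2

section

variable {p : Fin 3 → ℂ} (hp : p ∈ symmetricSurface)

@[simp] theorem symmetricRep_a : symmetricRep hp a = involution (p 2) (p 0) *
    (companion (p 1) (p 0) * companion (p 1) (p 0) * involution (p 2) (p 0) *
      (companion (p 1) (p 0))⁻¹ * (companion (p 1) (p 0))⁻¹) := knotLift_a _ _

@[simp] theorem symmetricRep_b : symmetricRep hp b = involution (p 2) (p 0) *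
    (companion (p 1) (p 0) * involution (p 2) (p 0) * (companion (p 1) (p 0))⁻¹) := knotLift_b _ _

@[simp] theorem symmetricRep_t : symmetricRep hp t =
    (companion (p 1) (p 0))⁻¹ * involution (p 2) (p 0) := knotLift_t _ _

theorem tr_inv_of_involution {J C : SL3} (hJ : J * J = 1) (hC : C * C = 1) :
    tr (J * C) = tr (J * C)⁻¹ := by
  rw [mul_inv_rev, inv_eq_of_mul_eq_one_left hJ, inv_eq_of_mul_eq_one_left hC, tr_mul_comm]

theorem character_symmetricRep_a :
    character (symmetricRep hp) a = character (symmetricRep hp) a⁻¹ := by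
  rw [character_apply, character_apply, map_inv, symmetricRep_a]
  have h := involution_mul_self (p 2) (p 0)
  refine tr_inv_of_involution h ?_
  generalize involution (p 2) (p 0) = J at *
  generalize companion (p 1) (p 0) = U
  calc U * U * J * U⁻¹ * U⁻¹ * (U * U * J * U⁻¹ * U⁻¹) = U * U * (J * J) * U⁻¹ * U⁻¹ := by group
    _ = 1 := by rw [h]; group

theorem character_symmetricRep_b :
    character (symmetricRep hp) b = character (symmetricRep hp) b⁻¹ := by
  rw [character_apply, character_apply, map_inv, symmetricRep_b]
  have h := involution_mul_self (p 2) (p 0)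
  refine tr_inv_of_involution h ?_
  generalize involution (p 2) (p 0) = J at *
  generalize companion (p 1) (p 0) = U
  calc U * J * U⁻¹ * (U * J * U⁻¹) = U * (J * J) * U⁻¹ := by group
    _ = 1 := by rw [h]; group

end

/-- Inverses are adjugates because all determinants are one, so the entries remain polynomial. The
resulting character map is polynomial on all of ℂ³, although it is tied to a representation only on
the surface. -/
theorem exists_polynomialMatrix_symmetricRep (g : KnotGroup) :
    ∃ M : Matrix (Fin 3) (Fin 3) (MvPolynomial (Fin 3) ℂ), ∀ (p : Fin 3 → ℂ)
      (hp : p ∈ symmetricSurface),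
      (symmetricRep hp g : Matrix (Fin 3) (Fin 3) ℂ) = (eval p).mapMatrix M := by
  let J : Matrix (Fin 3) (Fin 3) (MvPolynomial (Fin 3) ℂ) := !![1, X 2, X 0; 0, -1, 0; 0, 0, -1]
  let U : Matrix (Fin 3) (Fin 3) (MvPolynomial (Fin 3) ℂ) := !![0, 0, 1; 1, 0, X 0; 0, 1, -X 1]
  have hJ (p : Fin 3 → ℂ) :
      (involution (p 2) (p 0) : Matrix (Fin 3) (Fin 3) ℂ) = (eval p).mapMatrix J := by
    ext i j
    fin_cases i <;> fin_cases j <;> simp [J, coe_involution]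
  have hU (p : Fin 3 → ℂ) :
      (companion (p 1) (p 0) : Matrix (Fin 3) (Fin 3) ℂ) = (eval p).mapMatrix U := by
    ext i j
    fin_cases i <;> fin_cases j <;> simp [U, coe_companion]
  have hg : g ∈ Subgroup.closure {a, t} := by rw [closure_a_t]; trivial
  induction hg using Subgroup.closure_induction with
  | mem g hg =>
    rcases hg with rfl | rfl
    · refine ⟨J * (U * U * J * U.adjugate * U.adjugate), fun p hp => ?_⟩
      simp only [symmetricRep_a, Matrix.SpecialLinearGroup.coe_mul,
        Matrix.SpecialLinearGroup.coe_inv, hJ, hU, map_mul, RingHom.map_adjugate]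
    · refine ⟨U.adjugate * J, fun p hp => ?_⟩
      simp only [symmetricRep_t, Matrix.SpecialLinearGroup.coe_mul,
        Matrix.SpecialLinearGroup.coe_inv, hJ, hU, map_mul, RingHom.map_adjugate]
  | one => exact ⟨1, fun p hp => by simp⟩
  | mul g h _ _ hg hh =>
    obtain ⟨M, hM⟩ := hg
    obtain ⟨N, hN⟩ := hh
    exact ⟨M * N, fun p hp => by
      rw [map_mul, map_mul, Matrix.SpecialLinearGroup.coe_mul, hM, hN]⟩
  | inv g _ hg =>
    obtain ⟨M, hM⟩ := hg
    exact ⟨M.adjugate, fun p hp => by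
      rw [map_inv, Matrix.SpecialLinearGroup.coe_inv, hM, RingHom.map_adjugate]⟩

/-- The polynomial map from the parameter space of `V₀` to the character variety. -/
def symmetricCharacter (p : Fin 3 → ℂ) : KnotGroup → ℂ :=
  fun g => eval p (exists_polynomialMatrix_symmetricRep g).choose.trace

theorem isPolynomialMap_symmetricCharacter : IsPolynomialMap symmetricCharacter :=
  ⟨_, fun _ _ => rfl⟩

theorem symmetricCharacter_eq {p : Fin 3 → ℂ} (hp : p ∈ symmetricSurface) :
    symmetricCharacter p = character (symmetricRep hp) := by
  funext g
  rw [character, (exists_polynomialMatrix_symmetricRep g).choose_spec p hp, symmetricCharacter]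
  simp [Matrix.trace]

/-- The component of characters that are symmetric on the fibre. -/
def symmetricComponent : Set (KnotGroup → ℂ) :=
  zariskiClosure (symmetricCharacter '' symmetricSurface)

/-- This version of `IsIrreducibleAlgebraicSet.image` does not require the image to be closed. V₀
needs it because it is defined as a closure. -/
theorem IsIrreducibleAlgebraicSet.zariskiClosure_image {σ τ : Type*} {F : (σ → ℂ) → (τ → ℂ)}
    (hF : IsPolynomialMap F) {V : Set (σ → ℂ)} (hV : IsIrreducibleAlgebraicSet V) :
    IsIrreducibleAlgebraicSet (zariskiClosure (F '' V)) := by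
  refine ⟨isAlgebraicSet_zariskiClosure _, (hV.2.1.image F).mono (subset_zariskiClosure _),
    fun A B hA hB hAB => ?_⟩
  rcases hV.2.2 _ _ (hF.isAlgebraicSet_preimage hA) (hF.isAlgebraicSet_preimage hB)
    (fun x hx => hAB (subset_zariskiClosure _ ⟨x, hx, rfl⟩)) with h | h
  · exact Or.inl (zariskiClosure_min (Set.image_subset_iff.2 h) hA)
  · exact Or.inr (zariskiClosure_min (Set.image_subset_iff.2 h) hB)

theorem isIrreducibleAlgebraicSet_symmetricComponent :
    IsIrreducibleAlgebraicSet symmetricComponent :=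
  isIrreducibleAlgebraicSet_symmetricSurface.zariskiClosure_image
    isPolynomialMap_symmetricCharacter

theorem symmetricComponent_apply {χ : KnotGroup → ℂ} (h : χ ∈ symmetricComponent) :
    χ a = χ a⁻¹ ∧ χ b = χ b⁻¹ := by
  have hc (g k : KnotGroup) (e : ∀ (p : Fin 3 → ℂ) (hp : p ∈ symmetricSurface),
      character (symmetricRep hp) g = character (symmetricRep hp) k) : χ g = χ k := by
    have := mem_zariskiClosure.1 h (X g - X k) (by
      rintro _ ⟨p, hp, rfl⟩
      rw [symmetricCharacter_eq hp]
      simp [e p hp])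
    simpa [sub_eq_zero] using this
  exact ⟨hc _ _ fun _ hp => character_symmetricRep_a hp,
    hc _ _ fun _ hp => character_symmetricRep_b hp⟩

end FigEight

end

/-! ### Matrices of the symmetric representations, and special and generic points of V₀ -/

noncomputable section

namespace FigEight

open scoped Matrix
open MvPolynomial

theorem coe_symmetricRep_a {p : Fin 3 → ℂ} (hp : p ∈ symmetricSurface) :
    (symmetricRep hp a : Matrix (Fin 3) (Fin 3) ℂ) =
      !![p 1 * p 0 - 1, p 1, p 0; 0, 1, 0; -p 1, p 0 - p 1 * p 2, -1] := by
  have h := symmetricSurface_relation hp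
  rw [symmetricRep_a]
  generalize p 0 = w at *
  generalize p 1 = x at *
  generalize p 2 = z at *
  rw [Matrix.SpecialLinearGroup.coe_mul, Matrix.SpecialLinearGroup.coe_mul,
    Matrix.SpecialLinearGroup.coe_mul, coe_comm_left, coe_companion_inv, coe_involution]
  simp only [Matrix.mul_fin_three]
  refine of_fin_three_ext ?_ ?_ ?_ ?_ ?_ ?_ ?_ ?_ ?_
  · linear_combination (-w) * h
  · linear_combination h
  · ring
  · ring
  · ring
  · ring
  · linear_combination h
  · ring
  · ring

theorem coe_symmetricRep_a_inv {p : Fin 3 → ℂ} (hp : p ∈ symmetricSurface) :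
    (((symmetricRep hp a)⁻¹ : SL3) : Matrix (Fin 3) (Fin 3) ℂ) =
      !![-1, -p 2, -p 0; 0, 1, 0; p 1, p 0, p 1 * p 0 - 1] := by
  have h := symmetricSurface_relation hp
  rw [Matrix.SpecialLinearGroup.coe_inv, coe_symmetricRep_a, Matrix.adjugate_fin_three_of]
  refine of_fin_three_ext ?_ ?_ ?_ ?_ ?_ ?_ ?_ ?_ ?_
  · ring
  · linear_combination -h
  · ring
  · ring
  · ring
  · ring
  · ring
  · linear_combination p 1 * h
  · ring

theorem coe_symmetricRep_b {p : Fin 3 → ℂ} (hp : p ∈ symmetricSurface) :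
    (symmetricRep hp b : Matrix (Fin 3) (Fin 3) ℂ) =
      !![-1 - p 0 * p 2 + p 1 * p 2 ^ 2, p 2, -p 0 + p 2 ^ 2; p 0 - p 1 * p 2, -1, -p 2;
        0, 0, 1] := by
  rw [symmetricRep_b]
  simp only [Matrix.SpecialLinearGroup.coe_mul, coe_companion, coe_companion_inv, coe_involution,
    Matrix.mul_fin_three]
  refine of_fin_three_ext ?_ ?_ ?_ ?_ ?_ ?_ ?_ ?_ ?_ <;> ring

theorem coe_symmetricRep_t {p : Fin 3 → ℂ} (hp : p ∈ symmetricSurface) :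
    (symmetricRep hp t : Matrix (Fin 3) (Fin 3) ℂ) =
      !![-p 0, -1 - p 0 * p 2, -p 0 ^ 2; p 1, p 1 * p 2, -1 + p 0 * p 1; 1, p 2, p 0] := by
  rw [symmetricRep_t]
  simp only [Matrix.SpecialLinearGroup.coe_mul, coe_companion_inv, coe_involution,
    Matrix.mul_fin_three]
  refine of_fin_three_ext ?_ ?_ ?_ ?_ ?_ ?_ ?_ ?_ ?_ <;> ring

theorem coe_symmetricRep_t_inv {p : Fin 3 → ℂ} (hp : p ∈ symmetricSurface) :
    (((symmetricRep hp t)⁻¹ : SL3) : Matrix (Fin 3) (Fin 3) ℂ) =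
      !![p 2, p 0, 1 - p 0 * p 1 + p 0 * p 2; -1, 0, -p 0; 0, -1, p 1] := by
  rw [Matrix.SpecialLinearGroup.coe_inv, coe_symmetricRep_t, Matrix.adjugate_fin_three_of]
  refine of_fin_three_ext ?_ ?_ ?_ ?_ ?_ ?_ ?_ ?_ ?_ <;> ring

theorem character_symmetricRep_apply_a {p : Fin 3 → ℂ} (hp : p ∈ symmetricSurface) :
    character (symmetricRep hp) a = p 1 * p 0 - 1 := by
  rw [character, coe_symmetricRep_a, Matrix.trace_fin_three_of]
  ring

theorem character_symmetricRep_apply_b {p : Fin 3 → ℂ} (hp : p ∈ symmetricSurface) :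
    character (symmetricRep hp) b = p 1 * p 2 ^ 2 - p 0 * p 2 - 1 := by
  rw [character, coe_symmetricRep_b, Matrix.trace_fin_three_of]
  ring

/-! ### The exceptional characters lie on `V₀` -/

/-- The conditions on KL follow from those on a, since K = K⁻² and K⁻²L is conjugate to the image of
a. -/
theorem isTriangleRep_of_tr {ρ : KnotGroup →* SL3} (ha : tr (ρ a) = 1) (ha' : tr (ρ a)⁻¹ = 1)
    (hk : tr (ρ (a⁻¹ * t)) = 0) (hk' : tr (ρ (a⁻¹ * t))⁻¹ = 0)
    (hl : tr (ρ (a⁻¹ * t * t)) = 0) (hl' : tr (ρ (a⁻¹ * t * t))⁻¹ = 0) : IsTriangleRep ρ := by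
  have h3 : (ρ (a⁻¹ * t)) ^ 3 = 1 := sq_eq_of_tr hk hk'
  have hkk : (ρ (a⁻¹ * t))⁻¹ * (ρ (a⁻¹ * t))⁻¹ = ρ (a⁻¹ * t) := by
    rw [← mul_inv_rev, inv_eq_iff_mul_eq_one, ← pow_three', h3]
  refine ⟨hk, hk', hl, hl', ?_, ?_⟩
  · rw [← ha]
    nth_rewrite 1 [← hkk]
    simp only [map_mul, map_inv]
    exact tr_eq_of_conj ((ρ a)⁻¹ * ρ t) (by group)
  · rw [← ha']
    nth_rewrite 1 [← hkk]
    simp only [map_mul, map_inv]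
    exact tr_inv_eq_of_conj ((ρ a)⁻¹ * ρ t) (by group)

theorem Exceptional.mem_image_symmetricSurface {ω : ℂ} (h : ω ^ 3 = 1) :
    character (rep ω h) ∈ symmetricCharacter '' symmetricSurface := by
  have i₂ := Complex.I_sq
  -- On this family χ(t⁻¹) = x + z, χ(t) = xz and χ(a) = xw - 1. The values 2ω², 2ω and 1 determine
  -- x and z up to order, and then w = 2/x.
  have hp : ![ω * (1 - Complex.I), ω ^ 2 * (1 + Complex.I), ω ^ 2 * (1 - Complex.I)] ∈
      symmetricSurface := by
    refine mem_symmetricSurface ?_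
    linear_combination (ω ^ 2 * (1 - Complex.I) * (1 - Complex.I ^ 2)) * h +
      (-ω ^ 2 * (2 - Complex.I)) * i₂
  refine ⟨_, hp, ?_⟩
  rw [symmetricCharacter_eq hp]
  have ha : character (symmetricRep hp) a = 1 := by
    rw [character_symmetricRep_apply_a]
    simp only [Matrix.cons_val]
    linear_combination (1 - Complex.I ^ 2) * h - i₂
  have hb : character (symmetricRep hp) b = 1 := by
    rw [character_symmetricRep_apply_b]
    simp only [Matrix.cons_val]
    linear_combination (2 - 2 * Complex.I * ω ^ 3 + 2 * ω ^ 3) * h +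
      (Complex.I * ω ^ 6 - ω ^ 3 - ω ^ 6) * i₂
  have hT : IsTriangleRep (symmetricRep hp) := by
    refine isTriangleRep_of_tr ha ?_ ?_ ?_ ?_ ?_
    · rw [character_symmetricRep_a] at ha
      rwa [← map_inv]
    all_goals
      simp only [map_mul, map_inv, mul_inv_rev, inv_inv, tr, Matrix.SpecialLinearGroup.coe_mul,
        coe_symmetricRep_a, coe_symmetricRep_a_inv, coe_symmetricRep_t, coe_symmetricRep_t_inv,
        Matrix.mul_fin_three, Matrix.trace_fin_three_of, Matrix.cons_val]
    · linear_combination (-2 * Complex.I * ω + 2 * ω) * h + (Complex.I * ω ^ 4 - ω ^ 4) * i₂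
    · linear_combination (4 * ω ^ 2) * h + (-ω ^ 2 - 2 * ω ^ 5) * i₂
    · linear_combination (-2 * Complex.I * ω ^ 2 - 4 * Complex.I * ω ^ 5 - 2 * ω ^ 2
        + 4 * ω ^ 5) * h + (-Complex.I * ω ^ 5 + 3 * Complex.I * ω ^ 8 + Complex.I ^ 2 * ω ^ 8
        - Complex.I ^ 3 * ω ^ 8 - ω ^ 2 + 3 * ω ^ 5 - 3 * ω ^ 8) * i₂
    · linear_combination (Complex.I * ω ^ 4 - 2 * Complex.I ^ 2 * ω ^ 7 - 5 * ω ^ 4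
        + 2 * ω ^ 7) * i₂
  refine eq_of_param_eq ⟨_, hT, rfl⟩ ⟨_, isTriangleRep_rep h, rfl⟩ ?_
  rw [param_rep, param₁, ← character_symmetricRep_b, hb, character, character, map_inv,
    coe_symmetricRep_t, coe_symmetricRep_t_inv, Matrix.trace_fin_three_of,
    Matrix.trace_fin_three_of]
  simp only [Matrix.cons_val]
  congr 2
  · ring
  · linear_combination (ω * (1 - Complex.I ^ 2)) * h - ω * i₂

/-! ### Generic points of `V₀` -/

/-- A commutator acts as 1 on a common eigenvector. In a reducible representation the longitude
therefore has eigenvalues 1, λ, λ⁻¹, and its trace equals that of its inverse. -/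
theorem isIrreducibleRep_of_longitude {ρ : KnotGroup →* SL3}
    (h : character ρ longitude ≠ character ρ longitude⁻¹) : IsIrreducibleRep ρ := by
  have key : ∀ σ : KnotGroup →* SL3, HasCommonEigenvector σ →
      character σ longitude = character σ longitude⁻¹ := by
    intro σ hσ
    obtain ⟨v, hv, c, hc, -⟩ := hσ.exists_monoidHom
    have hl : c longitude = 1 := by
      have e₁ : c a * c a⁻¹ = 1 := by rw [← map_mul]; simp
      have e₂ : c b * c b⁻¹ = 1 := by rw [← map_mul]; simp
      simp only [longitude, map_mul]
      linear_combination c b * c b⁻¹ * e₁ + e₂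
    have hv1 : (σ longitude : Matrix (Fin 3) (Fin 3) ℂ) *ᵥ v = v := by rw [hc, hl, one_smul]
    have hv2 : (((σ longitude)⁻¹ : SL3) : Matrix (Fin 3) (Fin 3) ℂ) *ᵥ v = v := by
      conv_lhs => rw [← hv1]
      rw [Matrix.mulVec_mulVec, ← Matrix.SpecialLinearGroup.coe_mul, inv_mul_cancel]
      simp
    have e := congrArg (· *ᵥ v) (coe_mul_mul_self (σ longitude) 1)
    simp only [Matrix.add_mulVec, Matrix.sub_mulVec, Matrix.neg_mulVec, Matrix.smul_mulVec,
      ← Matrix.mulVec_mulVec, hv1, hv2, Matrix.SpecialLinearGroup.coe_one, Matrix.one_mulVec,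
      mul_one, tr_one] at e
    have e' : (tr (σ longitude) - tr (σ longitude)⁻¹) • v = 0 := by
      rw [← sub_eq_zero.2 e.symm]
      module
    rw [smul_eq_zero, or_iff_left hv, sub_eq_zero] at e'
    rw [character_apply, character_apply, e', map_inv]
  by_contra hρ
  rcases hasCommonEigenvector_of_not_irreducible hρ with h' | h'
  · exact h (key ρ h')
  · have := key _ h'
    rw [character_apply, character_apply, tr_dualRep, tr_dualRep, inv_inv] at this
    exact h this.symm

theorem symmetricComponent_subset :
    symmetricComponent ⊆ zariskiClosure (irredCharacters KnotGroup) := by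
  have hcl := isAlgebraicSet_zariskiClosure (irredCharacters KnotGroup)
  refine zariskiClosure_min ?_ hcl
  rw [Set.image_subset_iff]
  set A : Set (Fin 3 → ℂ) := symmetricCharacter ⁻¹'
    {χ | eval χ (X longitude : MvPolynomial KnotGroup ℂ) = eval χ (X longitude⁻¹)} with hA
  have hAalg : IsAlgebraicSet A :=
    isPolynomialMap_symmetricCharacter.isAlgebraicSet_preimage (isAlgebraicSet_setOf_eq _ _)
  have hnot : ¬ symmetricSurface ⊆ A := by
    intro hsub
    have hp : ![1, 0, -1] ∈ symmetricSurface := mem_symmetricSurface (by norm_num)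
    have := hsub hp
    rw [hA, Set.mem_preimage, symmetricCharacter_eq hp] at this
    simp only [Set.mem_ofPred_eq, eval_X, character, longitude, mul_inv_rev, map_mul, map_inv,
      inv_inv, Matrix.SpecialLinearGroup.coe_mul, coe_symmetricRep_a, coe_symmetricRep_a_inv,
      coe_symmetricRep_b, Matrix.SpecialLinearGroup.coe_inv (symmetricRep hp b),
      Matrix.adjugate_fin_three_of, Matrix.mul_fin_three, Matrix.trace_fin_three_of,
      Matrix.cons_val] at this
    norm_num at this
  refine (isIrreducibleAlgebraicSet_symmetricSurface.subset_zariskiClosure_diff hAalg hnot).trans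
    (zariskiClosure_min ?_ (isPolynomialMap_symmetricCharacter.isAlgebraicSet_preimage hcl))
  rintro p ⟨hp, hpA⟩
  refine subset_zariskiClosure _ ⟨symmetricRep hp, isIrreducibleRep_of_longitude ?_,
    symmetricCharacter_eq hp⟩
  rw [hA, Set.mem_preimage, symmetricCharacter_eq hp] at hpA
  simpa using hpA

end FigEight

end

noncomputable section

namespace FigEight

open scoped Matrix
open MvPolynomial

/-! ### Irreducible representations with symmetric characters on the fibre -/

/-- An intertwiner of irreducible representations is injective. -/
theorem IsIrreducibleRep.mulVec_injective {G : Type*} [Group G] {ρ σ : G →* SL3}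
    (hρ : IsIrreducibleRep ρ) {J : Matrix (Fin 3) (Fin 3) ℂ} (hJ : J ≠ 0)
    (h : ∀ g, J * ρ g = σ g * J) {v : Fin 3 → ℂ} (hv : J *ᵥ v = 0) : v = 0 := by
  rcases hρ (LinearMap.ker J.mulVecLin) (fun g w hw => by
    rw [LinearMap.mem_ker, Matrix.mulVecLin_apply] at hw ⊢
    rw [Matrix.mulVec_mulVec, h, ← Matrix.mulVec_mulVec, hw, Matrix.mulVec_zero]) with hk | hk
  · have : v ∈ LinearMap.ker J.mulVecLin := by rw [LinearMap.mem_ker, Matrix.mulVecLin_apply, hv]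
    rwa [hk, Submodule.mem_bot] at this
  · refine absurd ?_ hJ
    ext i j
    have : Pi.single j 1 ∈ LinearMap.ker J.mulVecLin := by rw [hk]; trivial
    rw [LinearMap.mem_ker, Matrix.mulVecLin_apply, Matrix.mulVec_single_one] at this
    exact congrFun this i

theorem fibreInversion_fibreInversion (g : KnotGroup) : fibreInversion (fibreInversion g) = g := by
  have : fibreInversion.comp fibreInversion = MonoidHom.id KnotGroup :=
    knotGroup_hom_ext (by simp) (by simp)
  exact DFunLike.congr_fun this g

/-- The symmetric character is invariant under `fibreInversion`, so some nonzero J intertwines `ρ`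
with its twist. Because `fibreInversion` is an involution, J² commutes with `ρ` and is scalar by
Schur's lemma. -/
theorem exists_involution_intertwiner {ρ : KnotGroup →* SL3} (hρ : IsIrreducibleRep ρ)
    (ha : character ρ a = character ρ a⁻¹) (hb : character ρ b = character ρ b⁻¹) :
    ∃ J : SL3, J * J = 1 ∧ ∀ g, J * ρ g = ρ (fibreInversion g) * J := by
  have h₁ : ρ t * ρ a * (ρ t)⁻¹ = ρ a * ρ b := by simp only [← map_mul, ← map_inv, t_mul_a]
  have h₂ : ρ t * ρ b * (ρ t)⁻¹ = ρ b * ρ a * ρ b := by simp only [← map_mul, ← map_inv, t_mul_b]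
  have hc : character ρ = character (ρ.comp fibreInversion) := by
    refine character_eq_of_tenTraces_eq closure_a_t _ _ ?_
    simp only [MonoidHom.comp_apply, fibreInversion_a, fibreInversion_t, map_inv, map_mul]
    rw [tenTraces_fibreInversion h₁ h₂ (by simpa [character_apply] using ha)
      (by simpa [character_apply] using hb)]
  obtain ⟨J, hJ0, hJ⟩ := exists_intertwiner hρ
    (hρ.comp_of_surjective fibreInversion fibreInversion_surjective) hc
  simp only [MonoidHom.comp_apply] at hJ
  obtain ⟨z, hz⟩ := hρ.exists_eq_smul_one (J * J) fun g => by
    rw [mul_assoc, hJ, ← mul_assoc, hJ, fibreInversion_fibreInversion, mul_assoc]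
  have hinj : ∀ v, J *ᵥ v = 0 → v = 0 := fun v =>
    hρ.mulVec_injective (σ := ρ.comp fibreInversion) hJ0 hJ
  have hz0 : z ≠ 0 := by
    rintro rfl
    refine hJ0 ?_
    ext i j
    have := hinj (J *ᵥ Pi.single j 1) (by
      rw [Matrix.mulVec_mulVec, hz, zero_smul, Matrix.zero_mulVec])
    rw [Matrix.mulVec_single_one] at this
    exact congrFun this i
  obtain ⟨c, hc2⟩ := IsAlgClosed.exists_pow_nat_eq z⁻¹ (n := 2) (by norm_num)
  have hsq : (c • J) * (c • J) = 1 := by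
    rw [smul_mul_smul_comm, hz, smul_smul, ← sq, hc2, inv_mul_cancel₀ hz0, one_smul]
  have hdet : (c • J).det * (c • J).det = 1 := by rw [← Matrix.det_mul, hsq, Matrix.det_one]
  set d := (c • J).det with hd
  -- The determinant d is ±1. Multiplying by d keeps the square equal to 1 and makes the determinant
  -- d³ · d = 1.
  refine ⟨⟨d • (c • J), ?_⟩, ?_, ?_⟩
  · rw [Matrix.det_smul, ← hd, Fintype.card_fin]
    linear_combination (d * d + 1) * hdet
  · refine Subtype.ext ?_
    change (d • c • J) * (d • c • J) = 1
    rw [smul_mul_smul_comm, hsq, hdet, one_smul]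
  · intro g
    refine Subtype.ext ?_
    change (d • c • J) * (ρ g).1 = (ρ (fibreInversion g)).1 * (d • c • J)
    simp only [Matrix.smul_mul, Matrix.mul_smul, hJ g]

/-- The formulas for the generators of the knot group in terms of an involution that implements
`fibreInversion`. -/
theorem generators_of_involution {H : Type*} [Group H] {A B T J : H} (h₁ : T * A * T⁻¹ = A * B)
    (h₂ : T * B * T⁻¹ = B * A * B) (hJ : J * J = 1) (hA : J * A = A⁻¹ * J)
    (hB : J * B = B⁻¹ * J) (hT : J * T = T * B * J) :
    ∃ U : H, A = J * (U * U * J * U⁻¹ * U⁻¹) ∧ B = J * (U * J * U⁻¹) ∧ T = U⁻¹ * J ∧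
      J * (U * U * J * (U⁻¹ * J * U * U)) = U * U * J * (U⁻¹ * J * U * U) * J := by
  have hi : J⁻¹ = J := inv_eq_of_mul_eq_one_left hJ
  have hTJ : J * T * J = T * B := by rw [hT, mul_assoc, hJ, mul_one]
  have hBJ : J * B * J = B⁻¹ := by rw [hB, mul_assoc, hJ, mul_one]
  have hAJ : J * A * J = A⁻¹ := by rw [hA, mul_assoc, hJ, mul_one]
  have k₁ : (J * T⁻¹) * J * (J * T⁻¹)⁻¹ = J * B := by
    calc (J * T⁻¹) * J * (J * T⁻¹)⁻¹ = J * T⁻¹ * (J * T * J⁻¹) := by group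
      _ = J * T⁻¹ * (T * B) := by rw [hi, hTJ]
      _ = J * B := by group
  have k₂ : (J * T⁻¹) * (J * T⁻¹) * J * (J * T⁻¹)⁻¹ * (J * T⁻¹)⁻¹ = J * A := by
    calc (J * T⁻¹) * (J * T⁻¹) * J * (J * T⁻¹)⁻¹ * (J * T⁻¹)⁻¹
        = J * T⁻¹ * ((J * T⁻¹) * J * (J * T⁻¹)⁻¹) * (T * J⁻¹) := by group
      _ = J * T⁻¹ * (J * B * J⁻¹) * (J * T * J⁻¹) := by rw [k₁]; group
      _ = J * (T⁻¹ * B * T)⁻¹ * B := by rw [hi, hBJ, hTJ]; group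
      _ = J * A := by rw [t_inv_mul_b h₁ h₂]; group
  have k₃ : (J * T⁻¹) * (J * A) * (J * T⁻¹)⁻¹ = J * (B * A⁻¹ * A⁻¹) * B := by
    calc (J * T⁻¹) * (J * A) * (J * T⁻¹)⁻¹
        = J * T⁻¹ * (J * A * J⁻¹) * (J * T * J⁻¹) := by group
      _ = J * (T⁻¹ * A * T)⁻¹ * B := by rw [hi, hAJ, hTJ]; group
      _ = _ := by rw [t_inv_mul_a h₁ h₂]; group
  -- The choice U = JT⁻¹ is forced by T = U⁻¹J. The identities `k₁`, `k₂`, `k₃` compute the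
  -- conjugates of J by U, U² and U³.
  refine ⟨J * T⁻¹, ?_, ?_, by group, ?_⟩
  · rw [k₂, ← mul_assoc, hJ, one_mul]
  · rw [k₁, ← mul_assoc, hJ, one_mul]
  · generalize J * T⁻¹ = U at *
    have e : U * U * J * (U⁻¹ * J * U * U) = J * A * (J * B) * (U * U * U) := by
      rw [← k₁, ← k₂]; group
    have e' : (U * U * U) * J = J * (B * A⁻¹ * A⁻¹) * B * (U * U * U) := by
      rw [← k₃, ← k₂]; group
    rw [e, mul_assoc (J * A * (J * B)), e']
    calc J * (J * A * (J * B) * (U * U * U)) = (J * J) * A * (J * B) * (U * U * U) := by group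
      _ = A * J * B * (U * U * U) := by rw [hJ]; group
      _ = J * A⁻¹ * B * (U * U * U) := by
        rw [show A * J = J * A⁻¹ by
          rw [← hAJ]; simp only [← mul_assoc, hJ, one_mul]]
      _ = J * A * (J * B * J) * (B * A⁻¹ * A⁻¹) * B * (U * U * U) := by rw [hBJ]; group
      _ = _ := by group

end FigEight

end

/-! ### Consequences of irreducibility, and the rank one form of an involution -/

noncomputable section

namespace FigEight

open scoped Matrix
open MvPolynomial

theorem IsIrreducibleRep.exists_eq_smul_one_of_commute {ρ : KnotGroup →* SL3}
    (hρ : IsIrreducibleRep ρ) {M : Matrix (Fin 3) (Fin 3) ℂ} (ha : M * ρ a = ρ a * M)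
    (ht : M * ρ t = ρ t * M) : ∃ c : ℂ, M = c • 1 := by
  refine hρ.exists_eq_smul_one M fun g => ?_
  have hg : g ∈ Subgroup.closure {a, t} := by rw [closure_a_t]; trivial
  induction hg using Subgroup.closure_induction with
  | mem g hg => rcases hg with rfl | rfl <;> assumption
  | one => simp
  | mul g h _ _ hg hh =>
    rw [map_mul, Matrix.SpecialLinearGroup.coe_mul, ← mul_assoc, hg, mul_assoc, hh, mul_assoc]
  | inv g _ hg =>
    have e : (ρ g : Matrix (Fin 3) (Fin 3) ℂ) * ((ρ g)⁻¹ : SL3) = 1 := by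
      rw [← Matrix.SpecialLinearGroup.coe_mul, mul_inv_cancel, Matrix.SpecialLinearGroup.coe_one]
    have e' : ((ρ g)⁻¹ : SL3) * (ρ g : Matrix (Fin 3) (Fin 3) ℂ) = 1 := by
      rw [← Matrix.SpecialLinearGroup.coe_mul, inv_mul_cancel, Matrix.SpecialLinearGroup.coe_one]
    rw [map_inv]
    calc M * ((ρ g)⁻¹ : SL3) = ((ρ g)⁻¹ : SL3) * (ρ g * M) * ((ρ g)⁻¹ : SL3) := by
          rw [← mul_assoc, e', one_mul]
      _ = _ := by rw [← hg, mul_assoc, mul_assoc, e, mul_one]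

/-- If a acted trivially, the image of t would be central, hence scalar, and then every matrix would
commute with the image. This excludes the trivial involution, for which a acts as 1. -/
theorem IsIrreducibleRep.apply_a_ne_one {ρ : KnotGroup →* SL3} (hρ : IsIrreducibleRep ρ) :
    ρ a ≠ 1 := by
  intro ha
  have ha' : (ρ a : Matrix (Fin 3) (Fin 3) ℂ) = 1 := by rw [ha, Matrix.SpecialLinearGroup.coe_one]
  obtain ⟨c, hc⟩ := hρ.exists_eq_smul_one_of_commute (M := ρ t) (by rw [ha']; simp) rfl
  obtain ⟨d, hd⟩ := hρ.exists_eq_smul_one_of_commute (M := Matrix.single 0 0 1)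
    (by rw [ha']; simp) (by rw [hc]; simp)
  have h₀ := congrFun (congrFun hd 0) 0
  have h₁ := congrFun (congrFun hd 1) 1
  simp at h₀ h₁
  rw [← h₁] at h₀
  exact one_ne_zero h₀

/-- An involution in `SL(3, ℂ)` is trivial or `-1` plus a matrix of rank one. -/
theorem exists_rank_one_of_involution {J : SL3} (hJ : J * J = 1) (hJ1 : J ≠ 1) :
    ∃ v f : Fin 3 → ℂ, v ≠ 0 ∧ f ⬝ᵥ v = 2 ∧
      ∀ y, (J : Matrix (Fin 3) (Fin 3) ℂ) *ᵥ y = (f ⬝ᵥ y) • v - y := by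
  have hi : J⁻¹ = J := inv_eq_of_mul_eq_one_left hJ
  have hJm : (J : Matrix (Fin 3) (Fin 3) ℂ) * J = 1 := by
    rw [← Matrix.SpecialLinearGroup.coe_mul, hJ, Matrix.SpecialLinearGroup.coe_one]
  have hadj : (J : Matrix (Fin 3) (Fin 3) ℂ).adjugate = J := by
    rw [← Matrix.SpecialLinearGroup.coe_inv, hi]
  have htr : (J : Matrix (Fin 3) (Fin 3) ℂ).trace = -1 := by
    have e := mul_mul_self_eq (J : Matrix (Fin 3) (Fin 3) ℂ) 1
    rw [hadj] at e
    simp only [mul_one, one_mul, hJm, Matrix.trace_one, Fintype.card_fin] at e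
    have e' : (1 + (J : Matrix (Fin 3) (Fin 3) ℂ).trace) •
        ((J : Matrix (Fin 3) (Fin 3) ℂ) - 1) = 0 := by
      rw [← sub_eq_zero.2 e.symm]
      push_cast
      module
    rcases smul_eq_zero.1 e' with h | h
    · linear_combination h
    · exact absurd (Subtype.ext (sub_eq_zero.1 h)) hJ1
  set N : Matrix (Fin 3) (Fin 3) ℂ := J + 1 with hN
  -- The identity N x N = tr(N x) N for all x says that N = J + 1 has rank one. A column of N with
  -- nonzero diagonal entry serves as v, and the corresponding row, rescaled, as f.
  have hNN (x : Matrix (Fin 3) (Fin 3) ℂ) : N * x * N = (N * x).trace • N := by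
    have e := mul_mul_self_eq (J : Matrix (Fin 3) (Fin 3) ℂ) x
    rw [hadj, htr] at e
    rw [hN]
    simp only [add_mul, mul_add, one_mul, mul_one, e, Matrix.trace_add]
    module
  have hent (p i j q : Fin 3) : N p i * N j q = N j i * N p q := by
    have := congrFun (congrFun (hNN (Matrix.single i j 1)) p) q
    simpa [Matrix.mul_apply, Matrix.single_apply, Matrix.trace, Finset.sum_ite_eq, ite_and]
      using this
  have hNtr : N.trace = 2 := by
    rw [hN, Matrix.trace_add, htr, Matrix.trace_one]; norm_num
  obtain ⟨j, hj⟩ : ∃ j, N j j ≠ 0 := by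
    by_contra! h
    rw [Matrix.trace] at hNtr
    simp [h] at hNtr
  have hmul (y : Fin 3 → ℂ) : N *ᵥ y = ((fun q => N j q / N j j) ⬝ᵥ y) • fun p => N p j := by
    funext p
    simp only [Matrix.mulVec, dotProduct, Pi.smul_apply, smul_eq_mul, Finset.sum_mul]
    refine Finset.sum_congr rfl fun q _ => ?_
    field_simp
    linear_combination -(y q) * hent p j j q
  refine ⟨fun p => N p j, fun q => N j q / N j j, fun h => hj (congrFun h j), ?_, fun y => ?_⟩
  · rw [← hNtr, dotProduct, Matrix.trace]
    refine Finset.sum_congr rfl fun q _ => ?_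
    rw [Matrix.diag_apply]
    field_simp
    linear_combination hent q j j q
  · rw [← hmul, hN, Matrix.add_mulVec, Matrix.one_mulVec, add_sub_cancel_right]

end FigEight

end

/-! ### Normal form of symmetric representations in a Krylov basis -/

noncomputable section

namespace FigEight

open scoped Matrix
open MvPolynomial

/-- The matrix with columns `v`, `U v`, `U² v`. -/
def krylov (U : SL3) (v : Fin 3 → ℂ) : Matrix (Fin 3) (Fin 3) ℂ :=
  Matrix.of fun i j => ![v, (U : Matrix (Fin 3) (Fin 3) ℂ) *ᵥ v,
    (U : Matrix (Fin 3) (Fin 3) ℂ) *ᵥ (U : Matrix (Fin 3) (Fin 3) ℂ) *ᵥ v] j i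

theorem mulVec_mulVec_mulVec (U : SL3) (v : Fin 3 → ℂ) :
    (U : Matrix (Fin 3) (Fin 3) ℂ) *ᵥ (U : Matrix (Fin 3) (Fin 3) ℂ) *ᵥ
      (U : Matrix (Fin 3) (Fin 3) ℂ) *ᵥ v = v
        + tr U • (U : Matrix (Fin 3) (Fin 3) ℂ) *ᵥ (U : Matrix (Fin 3) (Fin 3) ℂ) *ᵥ v
        - tr U⁻¹ • (U : Matrix (Fin 3) (Fin 3) ℂ) *ᵥ v := by
  have e := congrArg (· *ᵥ ((U : Matrix (Fin 3) (Fin 3) ℂ) *ᵥ v)) (coe_mul_mul_self U 1)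
  have hinv : ((U⁻¹ : SL3) : Matrix (Fin 3) (Fin 3) ℂ) *ᵥ (U : Matrix (Fin 3) (Fin 3) ℂ) *ᵥ v
      = v := by
    rw [Matrix.mulVec_mulVec, ← Matrix.SpecialLinearGroup.coe_mul, inv_mul_cancel]
    simp
  simp only [Matrix.add_mulVec, Matrix.sub_mulVec, Matrix.neg_mulVec, Matrix.smul_mulVec,
    ← Matrix.mulVec_mulVec, hinv, Matrix.SpecialLinearGroup.coe_one, Matrix.one_mulVec, mul_one,
    tr_one] at e
  rw [e]
  module

theorem coe_mul_krylov (U : SL3) (v : Fin 3 → ℂ) :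
    (U : Matrix (Fin 3) (Fin 3) ℂ) * krylov U v =
      krylov U v * (companion (-tr U) (-tr U⁻¹) : SL3) := by
  ext i j
  fin_cases j
  · change ((U : Matrix (Fin 3) (Fin 3) ℂ) *ᵥ v) i = _
    simp [Matrix.mul_apply, Fin.sum_univ_three, coe_companion, krylov]
  · change ((U : Matrix (Fin 3) (Fin 3) ℂ) *ᵥ (U : Matrix (Fin 3) (Fin 3) ℂ) *ᵥ v) i = _
    simp [Matrix.mul_apply, Fin.sum_univ_three, coe_companion, krylov]
  · change ((U : Matrix (Fin 3) (Fin 3) ℂ) *ᵥ (U : Matrix (Fin 3) (Fin 3) ℂ) *ᵥ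
      (U : Matrix (Fin 3) (Fin 3) ℂ) *ᵥ v) i = _
    rw [mulVec_mulVec_mulVec]
    simp [Matrix.mul_apply, Fin.sum_univ_three, coe_companion, krylov]
    ring

theorem involution_mul_krylov {J U : SL3} {v f : Fin 3 → ℂ} (hf : f ⬝ᵥ v = 2)
    (hJ : ∀ y, (J : Matrix (Fin 3) (Fin 3) ℂ) *ᵥ y = (f ⬝ᵥ y) • v - y) :
    (J : Matrix (Fin 3) (Fin 3) ℂ) * krylov U v =
      krylov U v * (involution (f ⬝ᵥ (U : Matrix (Fin 3) (Fin 3) ℂ) *ᵥ v)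
        (f ⬝ᵥ (U : Matrix (Fin 3) (Fin 3) ℂ) *ᵥ (U : Matrix (Fin 3) (Fin 3) ℂ) *ᵥ v) : SL3) := by
  ext i j
  fin_cases j
  · change ((J : Matrix (Fin 3) (Fin 3) ℂ) *ᵥ v) i = _
    rw [hJ, hf]
    simp [Matrix.mul_apply, Fin.sum_univ_three, coe_involution, krylov]
    ring
  · change ((J : Matrix (Fin 3) (Fin 3) ℂ) *ᵥ (U : Matrix (Fin 3) (Fin 3) ℂ) *ᵥ v) i = _
    rw [hJ]
    simp [Matrix.mul_apply, Fin.sum_univ_three, coe_involution, krylov]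
    ring
  · change ((J : Matrix (Fin 3) (Fin 3) ℂ) *ᵥ (U : Matrix (Fin 3) (Fin 3) ℂ) *ᵥ
      (U : Matrix (Fin 3) (Fin 3) ℂ) *ᵥ v) i = _
    rw [hJ]
    simp [Matrix.mul_apply, Fin.sum_univ_three, coe_involution, krylov]
    ring

/-- The elements of `SL(3, ℂ)` that preserve the column space of `S` invertibly. -/
def columnStabilizer (S : Matrix (Fin 3) (Fin 3) ℂ) : Subgroup SL3 where
  carrier := {g | ∃ M : SL3, (g : Matrix (Fin 3) (Fin 3) ℂ) * S = S * M}
  one_mem' := ⟨1, by simp⟩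
  mul_mem' := by
    rintro g h ⟨M, hM⟩ ⟨N, hN⟩
    exact ⟨M * N, by rw [Matrix.SpecialLinearGroup.coe_mul, Matrix.SpecialLinearGroup.coe_mul,
      mul_assoc, hN, ← mul_assoc, hM, mul_assoc]⟩
  inv_mem' := by
    rintro g ⟨M, hM⟩
    refine ⟨M⁻¹, ?_⟩
    have e : ((g⁻¹ : SL3) : Matrix (Fin 3) (Fin 3) ℂ) * g = 1 := by
      rw [← Matrix.SpecialLinearGroup.coe_mul, inv_mul_cancel, Matrix.SpecialLinearGroup.coe_one]
    have e' : (M : Matrix (Fin 3) (Fin 3) ℂ) * (M⁻¹ : SL3) = 1 := by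
      rw [← Matrix.SpecialLinearGroup.coe_mul, mul_inv_cancel, Matrix.SpecialLinearGroup.coe_one]
    calc ((g⁻¹ : SL3) : Matrix (Fin 3) (Fin 3) ℂ) * S
        = (g⁻¹ : SL3) * (S * M) * (M⁻¹ : SL3) := by
          rw [mul_assoc, mul_assoc, e', mul_one]
      _ = _ := by rw [← hM, ← mul_assoc, e, one_mul]

/-- The column space of `S` is a nonzero invariant subspace, so it is everything. For the Krylov
matrix this says that v, Uv, U²v is a basis. -/
theorem IsIrreducibleRep.isUnit_of_columnStabilizer {ρ : KnotGroup →* SL3}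
    (hρ : IsIrreducibleRep ρ) {S : Matrix (Fin 3) (Fin 3) ℂ} (hS : S ≠ 0)
    (ha : ρ a ∈ columnStabilizer S) (ht : ρ t ∈ columnStabilizer S) : IsUnit S := by
  have hall (g : KnotGroup) : ρ g ∈ columnStabilizer S := by
    have : Subgroup.closure {a, t} ≤ (columnStabilizer S).comap ρ := by
      rw [Subgroup.closure_le]
      rintro _ (rfl | rfl)
      · exact ha
      · exact ht
    rw [closure_a_t] at this
    exact this (Subgroup.mem_top g)
  rw [← Matrix.mulVec_surjective_iff_isUnit]
  rcases hρ (LinearMap.range S.mulVecLin) (by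
    rintro g _ ⟨y, rfl⟩
    obtain ⟨M, hM⟩ := hall g
    refine ⟨(M : Matrix (Fin 3) (Fin 3) ℂ) *ᵥ y, ?_⟩
    rw [Matrix.mulVecLin_apply, Matrix.mulVecLin_apply, Matrix.mulVec_mulVec,
      Matrix.mulVec_mulVec, hM]) with h | h
  · refine absurd ?_ hS
    ext i j
    have : S.mulVecLin (Pi.single j 1) ∈ LinearMap.range S.mulVecLin := ⟨_, rfl⟩
    rw [h, Submodule.mem_bot, Matrix.mulVecLin_apply, Matrix.mulVec_single_one] at this
    exact congrFun this i
  · exact LinearMap.range_eq_top.1 h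

/-- An invertible matrix can be scaled to determinant one. -/
theorem exists_smul_eq_coe {S : Matrix (Fin 3) (Fin 3) ℂ} (hS : IsUnit S) :
    ∃ (c : ℂ) (s : SL3), (s : Matrix (Fin 3) (Fin 3) ℂ) = c • S := by
  have hd : S.det ≠ 0 := ((Matrix.isUnit_iff_isUnit_det S).1 hS).ne_zero
  obtain ⟨c, hc⟩ := IsAlgClosed.exists_pow_nat_eq S.det⁻¹ (n := 3) (by norm_num)
  refine ⟨c, ⟨c • S, ?_⟩, rfl⟩
  rw [Matrix.det_smul, Fintype.card_fin, hc, inv_mul_cancel₀ hd]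

/-- In the Krylov basis U is a companion matrix and J the standard involution, so the one remaining
relation becomes the equation of the surface. The representation is then conjugate to a member of
the explicit family. -/
theorem IsIrreducibleRep.character_mem_image_symmetricSurface {ρ : KnotGroup →* SL3}
    (hρ : IsIrreducibleRep ρ) (ha : character ρ a = character ρ a⁻¹)
    (hb : character ρ b = character ρ b⁻¹) :
    character ρ ∈ symmetricCharacter '' symmetricSurface := by
  obtain ⟨J, hJ, hJρ⟩ := exists_involution_intertwiner hρ ha hb
  have h₁ : ρ t * ρ a * (ρ t)⁻¹ = ρ a * ρ b := by simp only [← map_mul, ← map_inv, t_mul_a]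
  have h₂ : ρ t * ρ b * (ρ t)⁻¹ = ρ b * ρ a * ρ b := by simp only [← map_mul, ← map_inv, t_mul_b]
  obtain ⟨U, hA, hB, hT, hX⟩ := generators_of_involution h₁ h₂ hJ
    (by rw [hJρ, fibreInversion_a, map_inv]) (by rw [hJρ, fibreInversion_b, map_inv])
    (by rw [hJρ, fibreInversion_t, map_mul])
  have hJ1 : J ≠ 1 := by
    rintro rfl
    exact hρ.apply_a_ne_one (by rw [hA]; group)
  obtain ⟨v, f, hv, hf, hJv⟩ := exists_rank_one_of_involution hJ hJ1
  have eU := coe_mul_krylov U v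
  have eJ := involution_mul_krylov (U := U) hf hJv
  set S := krylov U v with hS
  have hJS : J ∈ columnStabilizer S := ⟨_, eJ⟩
  have hUS : U ∈ columnStabilizer S := ⟨_, eU⟩
  have hS0 : S ≠ 0 := by
    intro h
    refine hv ?_
    funext i
    exact congrFun (congrFun h i) 0
  have hunit : IsUnit S := hρ.isUnit_of_columnStabilizer hS0
    (by
      rw [hA]
      exact mul_mem hJS (mul_mem (mul_mem (mul_mem (mul_mem hUS hUS) hJS) (inv_mem hUS))
        (inv_mem hUS)))
    (by rw [hT]; exact mul_mem (inv_mem hUS) hJS)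
  obtain ⟨c, s, hs⟩ := exists_smul_eq_coe hunit
  generalize f ⬝ᵥ (U : Matrix (Fin 3) (Fin 3) ℂ) *ᵥ v = z at eJ
  generalize f ⬝ᵥ (U : Matrix (Fin 3) (Fin 3) ℂ) *ᵥ (U : Matrix (Fin 3) (Fin 3) ℂ) *ᵥ v = u at eJ
  generalize -tr U = x at eU
  generalize -tr U⁻¹ = w at eU
  have cU : U = s * companion x w * s⁻¹ := by
    rw [eq_mul_inv_iff_mul_eq]
    refine Subtype.ext ?_
    rw [Matrix.SpecialLinearGroup.coe_mul, Matrix.SpecialLinearGroup.coe_mul, hs, Matrix.mul_smul,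
      Matrix.smul_mul, eU]
  have cJ : J = s * involution z u * s⁻¹ := by
    rw [eq_mul_inv_iff_mul_eq]
    refine Subtype.ext ?_
    rw [Matrix.SpecialLinearGroup.coe_mul, Matrix.SpecialLinearGroup.coe_mul, hs, Matrix.mul_smul,
      Matrix.smul_mul, eJ]
  have hcomm : involution z u * relator x w z u = relator x w z u * involution z u := by
    have := congrArg (fun g => s⁻¹ * g * s) hX
    rw [cU, cJ] at this
    rw [relator]
    convert this using 1 <;> group
  obtain ⟨rfl, hR⟩ := eq_of_involution_comm hcomm
  have hp := mem_symmetricSurface hR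
  refine ⟨_, hp, ?_⟩
  rw [symmetricCharacter_eq hp]
  have : ρ = (MulAut.conj s).toMonoidHom.comp (symmetricRep hp) := by
    refine knotGroup_hom_ext ?_ ?_
    · rw [hA, cU, cJ]
      simp only [MonoidHom.comp_apply, symmetricRep_a, MulEquiv.toMonoidHom_eq_coe,
        MonoidHom.coe_coe, MulAut.conj_apply, Matrix.cons_val]
      group
    · rw [hT, cU, cJ]
      simp only [MonoidHom.comp_apply, symmetricRep_t, MulEquiv.toMonoidHom_eq_coe,
        MonoidHom.coe_coe, MulAut.conj_apply, Matrix.cons_val]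
      group
  funext g
  rw [this, character_apply, character_apply]
  exact (tr_conj s (symmetricRep hp g)).symm

end FigEight

end

/-! ### Decomposition of the set of irreducible characters and intersections of the components -/

noncomputable section

namespace FigEight

open scoped Matrix

open MvPolynomial

/-- If χ is asymmetric at b, `tr_fibre_relations` gives χ(a) = χ(a⁻¹) = 1. If it is symmetric at b
but not at a, then χ(b) = χ(b⁻¹) = 1, and `flip` reduces this to the former case. -/
theorem irredCharacters_subset :
    irredCharacters KnotGroup ⊆ symmetricComponent ∪ triangleComponent ∪ flippedComponent := by
  have key : ∀ ρ : KnotGroup →* SL3, character ρ a = 1 → character ρ a⁻¹ = 1 →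
      (character ρ b ≠ 1 ∨ character ρ b⁻¹ ≠ 1) → character ρ ∈ triangleComponent := by
    have main : ∀ ρ : KnotGroup →* SL3, character ρ a = 1 → character ρ a⁻¹ = 1 →
        character ρ b ≠ 1 → IsTriangleRep ρ := by
      intro ρ ha ha' hb
      rw [character_apply] at ha ha' hb
      rw [map_inv] at ha'
      have h₁ : ρ t * ρ a * (ρ t)⁻¹ = ρ a * ρ b := by simp only [← map_mul, ← map_inv, t_mul_a]
      have h₂ : ρ t * ρ b * (ρ t)⁻¹ = ρ b * ρ a * ρ b := by
        simp only [← map_mul, ← map_inv, t_mul_b]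
      obtain ⟨e₁, e₂, e₃, e₄⟩ := tr_eq_zero_of_tr_eq_one h₁ h₂ ha ha' hb
      exact isTriangleRep_of_tr ha ha' (by simpa using e₁) (by simpa using e₂) (by simpa using e₃)
        (by simpa using e₄)
    rintro ρ ha ha' (hb | hb)
    · exact ⟨ρ, main ρ ha ha' hb, rfl⟩
    -- When only χ(b⁻¹) is known to differ from 1, the argument is applied to the contragredient
    -- representation and dualised back.
    · have hd : ∀ g, character (dualRep ρ) g = character ρ g⁻¹ := fun g => tr_dualRep ρ g
      refine ⟨dualRep (dualRep ρ), (main (dualRep ρ) ?_ ?_ ?_).dualRep, ?_⟩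
      · rw [hd, ha']
      · rw [hd, inv_inv, ha]
      · rwa [hd]
      · funext g
        rw [character_apply, character_apply, tr_dualRep, tr_dualRep, inv_inv]
  rintro _ ⟨ρ, hρ, rfl⟩
  by_cases hs : character ρ a = character ρ a⁻¹ ∧ character ρ b = character ρ b⁻¹
  · exact Or.inl (Or.inl (subset_zariskiClosure _
      (hρ.character_mem_image_symmetricSurface hs.1 hs.2)))
  have h₁ : ρ t * ρ a * (ρ t)⁻¹ = ρ a * ρ b := by simp only [← map_mul, ← map_inv, t_mul_a]
  have h₂ : ρ t * ρ b * (ρ t)⁻¹ = ρ b * ρ a * ρ b := by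
    simp only [← map_mul, ← map_inv, t_mul_b]
  have hrel := tr_fibre_relations h₁ h₂
  simp only [← map_inv, ← character_apply] at hrel
  obtain ⟨r₁, r₂, r₃⟩ := hrel
  by_cases hb : character ρ b = character ρ b⁻¹
  · have ha : character ρ a ≠ character ρ a⁻¹ := fun ha => hs ⟨ha, hb⟩
    have hb₁ : character ρ b = 1 :=
      (sub_eq_zero.1 ((mul_eq_zero.1 r₃).resolve_left (sub_ne_zero.2 ha))).symm
    refine Or.inr ?_
    have e : character (ρ.comp flip.toMonoidHom) = character ρ ∘ flip := rfl
    have ea : (character ρ ∘ flip) a = character ρ b := by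
      rw [Function.comp_apply, flip_a, character_apply_conj]
    have ea' : (character ρ ∘ flip) a⁻¹ = character ρ b⁻¹ := by
      rw [Function.comp_apply, map_inv, flip_a, show (a * b * a⁻¹)⁻¹ = a * b⁻¹ * a⁻¹ by group,
        character_apply_conj]
    have eb : (character ρ ∘ flip) b = character ρ a⁻¹ := by rw [Function.comp_apply, flip_b]
    have eb' : (character ρ ∘ flip) b⁻¹ = character ρ a := by
      rw [Function.comp_apply, map_inv, flip_b, inv_inv]
    change character ρ ∘ flip ∈ triangleComponent
    rw [← e]
    refine key _ ?_ ?_ ?_ <;> rw [e]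
    · rw [ea, hb₁]
    · rw [ea', ← hb, hb₁]
    · rw [eb, eb']
      by_contra! h
      exact ha (h.2.trans h.1.symm)
  · have hb' := sub_ne_zero.2 hb
    refine Or.inl (Or.inr (key ρ (sub_eq_zero.1 ((mul_eq_zero.1 r₁).resolve_left hb')).symm
      (sub_eq_zero.1 ((mul_eq_zero.1 r₂).resolve_left hb')).symm ?_))
    by_contra! h
    exact hb (h.1.trans h.2.symm)

theorem isPolynomialMap_param₂ : IsPolynomialMap param₂ := isAlgebraicIso_flippedComponent.1

theorem isAlgebraicSet_exceptionalPoints : IsAlgebraicSet exceptionalPoints :=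
  isAlgebraicSet_of_finite (by simp [exceptionalPoints])

/-- A character on the triangle component that lies on neither of the other two components. -/
def genericCharacter : KnotGroup → ℂ := triangleCharacter ![0, 0, -1 + 2 * Complex.I]

/-- At ν = ν̄ = 0 the quadratic is ζ² + 2ζ + 5, with distinct roots -1 ± 2i. So χ(b) ≠ χ(b⁻¹) there,
which separates V₁ from V₀. -/
theorem genericCharacter_mem : genericCharacter ∈ triangleComponent ∧
    param₁ genericCharacter = ![0, 0, -1 + 2 * Complex.I] := by
  refine triangleCharacter_mem ?_
  simp only [hypersurface, Set.mem_ofPred_eq, Matrix.cons_val]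
  linear_combination 4 * Complex.I_sq

theorem param₁_genericCharacter_notMem : param₁ genericCharacter ∉ exceptionalPoints := by
  rw [genericCharacter_mem.2, mem_exceptionalPoints]
  rintro ⟨ω, -, e⟩
  have := congrArg Complex.im (congrFun e 2)
  simp at this

theorem genericCharacter_apply_b_inv : genericCharacter b⁻¹ = -1 + 2 * Complex.I :=
  congrFun genericCharacter_mem.2 2

theorem genericCharacter_apply_b : genericCharacter b = -1 - 2 * Complex.I := by
  rw [triangleComponent_apply_b genericCharacter_mem.1, genericCharacter_mem.2]
  simp only [Matrix.cons_val]
  ring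

theorem genericCharacter_comp_flip_mem : genericCharacter ∘ flip.symm ∈ flippedComponent := by
  change (genericCharacter ∘ flip.symm) ∘ flip ∈ triangleComponent
  convert genericCharacter_mem.1 using 1
  funext g
  simp

theorem param₂_genericCharacter_comp_flip :
    param₂ (genericCharacter ∘ flip.symm) = ![0, 0, -1 + 2 * Complex.I] := by
  rw [← param₁_comp_flip, ← genericCharacter_mem.2]
  congr 1
  funext g
  simp

theorem triangleComponent_subset_zariskiClosure :
    triangleComponent ⊆ zariskiClosure (irredCharacters KnotGroup) := by
  refine (isIrreducibleAlgebraicSet_triangleComponent.subset_zariskiClosure_diff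
    (isPolynomialMap_param₁.isAlgebraicSet_preimage isAlgebraicSet_exceptionalPoints)
    fun h => param₁_genericCharacter_notMem (h genericCharacter_mem.1)).trans ?_
  exact zariskiClosure_min (fun χ h => subset_zariskiClosure _ ((mem_irredCharacters_iff h.1).2 h.2))
    (isAlgebraicSet_zariskiClosure _)

theorem flippedComponent_subset_zariskiClosure :
    flippedComponent ⊆ zariskiClosure (irredCharacters KnotGroup) := by
  refine (isIrreducibleAlgebraicSet_flippedComponent.subset_zariskiClosure_diff
    (isPolynomialMap_param₂.isAlgebraicSet_preimage isAlgebraicSet_exceptionalPoints)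
    fun h => param₁_genericCharacter_notMem ?_).trans ?_
  · have := h genericCharacter_comp_flip_mem
    rwa [Set.mem_preimage, param₂_genericCharacter_comp_flip, ← genericCharacter_mem.2] at this
  exact zariskiClosure_min
    (fun χ h => subset_zariskiClosure _ ((mem_irredCharacters_iff_of_flipped h.1).2 h.2))
    (isAlgebraicSet_zariskiClosure _)

theorem zariskiClosure_irredCharacters :
    zariskiClosure (irredCharacters KnotGroup) =
      symmetricComponent ∪ triangleComponent ∪ flippedComponent :=
  (zariskiClosure_min irredCharacters_subset
    ((isIrreducibleAlgebraicSet_symmetricComponent.1.union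
      isAlgebraicSet_triangleComponent).union
      isIrreducibleAlgebraicSet_flippedComponent.1)).antisymm
    (Set.union_subset (Set.union_subset symmetricComponent_subset
      triangleComponent_subset_zariskiClosure) flippedComponent_subset_zariskiClosure)

/-- The three components of the closure of the set of irreducible characters. -/
def component : Fin 3 → Set (KnotGroup → ℂ) :=
  ![symmetricComponent, triangleComponent, flippedComponent]

theorem isIrreducibleAlgebraicSet_component (i : Fin 3) :
    IsIrreducibleAlgebraicSet (component i) := by
  fin_cases i
  · exact isIrreducibleAlgebraicSet_symmetricComponent
  · exact isIrreducibleAlgebraicSet_triangleComponent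
  · exact isIrreducibleAlgebraicSet_flippedComponent

theorem genericCharacter_apply_ne : genericCharacter b ≠ genericCharacter b⁻¹ := by
  rw [genericCharacter_apply_b, genericCharacter_apply_b_inv]
  intro h
  have := congrArg Complex.im h
  norm_num at this

theorem genericCharacter_comp_flip_apply_a :
    (genericCharacter ∘ flip.symm) a = genericCharacter b⁻¹ := by
  rw [Function.comp_apply, ← inv_inv a, ← flip_b, ← map_inv, MulEquiv.symm_apply_apply]

theorem genericCharacter_comp_flip_apply_a_inv :
    (genericCharacter ∘ flip.symm) a⁻¹ = genericCharacter b := by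
  rw [Function.comp_apply, ← flip_b, MulEquiv.symm_apply_apply]

theorem genericCharacter_apply_b_inv_ne_one : genericCharacter b⁻¹ ≠ 1 := by
  rw [genericCharacter_apply_b_inv]
  intro h
  have := congrArg Complex.im h
  norm_num at this

theorem exists_mem_symmetricComponent :
    ∃ χ ∈ symmetricComponent, χ a ≠ 1 ∧ χ b ≠ 1 := by
  have hp : (![0, 0, 0] : Fin 3 → ℂ) ∈ symmetricSurface := mem_symmetricSurface (by ring)
  refine ⟨_, subset_zariskiClosure _ ⟨_, hp, rfl⟩, ?_⟩
  rw [symmetricCharacter_eq hp, character_symmetricRep_apply_a hp,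
    character_symmetricRep_apply_b hp]
  norm_num

theorem eq_of_component_subset (i j : Fin 3) (h : component i ⊆ component j) : i = j := by
  obtain ⟨χ, hχ, hχa, hχb⟩ := exists_mem_symmetricComponent
  fin_cases i <;> fin_cases j
  · rfl
  · exact absurd (triangleComponent_apply_a (h hχ)).1 hχa
  · exact absurd (flippedComponent_apply_b (h hχ)).1 hχb
  · exact absurd (symmetricComponent_apply (h genericCharacter_mem.1)).2 genericCharacter_apply_ne
  · rfl
  · exact absurd (flippedComponent_apply_b (h genericCharacter_mem.1)).2
      genericCharacter_apply_b_inv_ne_one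
  · have := (symmetricComponent_apply (h genericCharacter_comp_flip_mem)).1
    rw [genericCharacter_comp_flip_apply_a, genericCharacter_comp_flip_apply_a_inv] at this
    exact absurd this.symm genericCharacter_apply_ne
  · have := (triangleComponent_apply_a (h genericCharacter_comp_flip_mem)).1
    rw [genericCharacter_comp_flip_apply_a] at this
    exact absurd this genericCharacter_apply_b_inv_ne_one
  · rfl

theorem irredComponents_zariskiClosure_irredCharacters :
    irredComponents (zariskiClosure (irredCharacters KnotGroup)) = Set.range component := by
  rw [zariskiClosure_irredCharacters]
  exact irredComponents_union_three isIrreducibleAlgebraicSet_component eq_of_component_subset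

theorem triangle_inter_flipped_subset :
    triangleComponent ∩ flippedComponent ⊆ symmetricComponent := by
  intro χ h
  obtain ⟨ω, hω, rfl⟩ := mem_triangle_inter_flipped.1 h
  exact subset_zariskiClosure _ (Exceptional.mem_image_symmetricSurface hω)

/-- The two roots of the quadratic are χ(b) and χ(b⁻¹). -/
theorem discriminant_param₁ {χ : KnotGroup → ℂ} (h : χ ∈ triangleComponent) :
    discriminant (param₁ χ) = (χ b - χ b⁻¹) ^ 2 := by
  have hH : _ = (0 : ℂ) := param_mem_hypersurface h
  rw [triangleComponent_apply_b h, show χ b⁻¹ = param₁ χ 2 from rfl, discriminant]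
  linear_combination -4 * hH

theorem mem_symmetricComponent_of_mem_irredCharacters {χ : KnotGroup → ℂ}
    (h : χ ∈ irredCharacters KnotGroup) (ha : χ a = χ a⁻¹) (hb : χ b = χ b⁻¹) :
    χ ∈ symmetricComponent := by
  obtain ⟨ρ, hρ, rfl⟩ := h
  exact subset_zariskiClosure _ (hρ.character_mem_image_symmetricSurface ha hb)

/-- Where the discriminant vanishes the character is symmetric on a and b. If it is irreducible, the
classification of symmetric irreducible characters puts it on V₀. The exceptional points are covered
by V₁ ∩ V₂ ⊆ V₀. -/
theorem triangle_inter_symmetric :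
    triangleComponent ∩ symmetricComponent =
      {χ ∈ triangleComponent | discriminant (param₁ χ) = 0} := by
  ext χ
  refine and_congr_right fun h => ⟨fun h₀ => ?_, fun hd => ?_⟩
  · rw [discriminant_param₁ h, (symmetricComponent_apply h₀).2, sub_self, zero_pow two_ne_zero]
  · by_cases he : param₁ χ ∈ exceptionalPoints
    · rw [← param₁_image_inter] at he
      obtain ⟨χ', h', e⟩ := he
      rw [← eq_of_param_eq h'.1 h e]
      exact triangle_inter_flipped_subset h'
    · rw [discriminant_param₁ h] at hd
      have ha := triangleComponent_apply_a h
      exact mem_symmetricComponent_of_mem_irredCharacters ((mem_irredCharacters_iff h).2 he)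
        (ha.1.trans ha.2.symm) (sub_eq_zero.1 (pow_eq_zero_iff two_ne_zero |>.1 hd))

theorem discriminant_param₂ {χ : KnotGroup → ℂ} (h : χ ∈ flippedComponent) :
    discriminant (param₂ χ) = (χ a⁻¹ - χ a) ^ 2 := by
  rw [← param₁_comp_flip, discriminant_param₁ h, Function.comp_apply, Function.comp_apply, map_inv,
    flip_b, inv_inv]

theorem flipped_inter_symmetric :
    flippedComponent ∩ symmetricComponent =
      {χ ∈ flippedComponent | discriminant (param₂ χ) = 0} := by
  ext χ
  refine and_congr_right fun h => ⟨fun h₀ => ?_, fun hd => ?_⟩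
  · rw [discriminant_param₂ h, (symmetricComponent_apply h₀).1, sub_self, zero_pow two_ne_zero]
  · by_cases he : param₂ χ ∈ exceptionalPoints
    · rw [← param₂_image_inter] at he
      obtain ⟨χ', h', e⟩ := he
      obtain ⟨-, -, G, -, -, hG, -⟩ := isAlgebraicIso_flippedComponent
      rw [← hG χ h, ← e, hG χ' h'.2]
      exact triangle_inter_flipped_subset h'
    · rw [discriminant_param₂ h] at hd
      have hb := flippedComponent_apply_b h
      exact mem_symmetricComponent_of_mem_irredCharacters
        ((mem_irredCharacters_iff_of_flipped h).2 he)
        (sub_eq_zero.1 (pow_eq_zero_iff two_ne_zero |>.1 hd)).symm (hb.1.trans hb.2.symm)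

end FigEight

end

theorem proposition10p2 :
    ∃ V : Fin 3 → Set (FigEight.KnotGroup → ℂ),
      -- the closure of the irreducible characters has exactly three components `V 0`, `V 1`, `V 2`
      Function.Injective V ∧
      FigEight.irredComponents
        (FigEight.zariskiClosure (FigEight.irredCharacters FigEight.KnotGroup)) = Set.range V ∧
      -- which are labelled as follows
      (∀ χ ∈ V 0, χ FigEight.a = χ (FigEight.a⁻¹) ∧ χ FigEight.b = χ (FigEight.b⁻¹)) ∧
      (∀ χ ∈ V 1, χ FigEight.a = 1 ∧ χ (FigEight.a⁻¹) = 1) ∧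
      (∀ χ ∈ V 2, χ FigEight.b = 1 ∧ χ (FigEight.b⁻¹) = 1) ∧
      -- factorization through the Dehn fillings
      FigEight.FactorsThroughFilling (V 1) (-3) ∧
      FigEight.FactorsThroughFilling (V 2) 3 ∧
      -- isomorphism with the hypersurface
      FigEight.IsAlgebraicIso FigEight.param₁ (V 1) FigEight.hypersurface ∧
      FigEight.IsAlgebraicIso FigEight.param₂ (V 2) FigEight.hypersurface ∧
      -- all characters are irreducible except for three points
      (∀ χ ∈ V 1, χ ∈ FigEight.irredCharacters FigEight.KnotGroup ↔
        FigEight.param₁ χ ∉ FigEight.exceptionalPoints) ∧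
      (∀ χ ∈ V 2, χ ∈ FigEight.irredCharacters FigEight.KnotGroup ↔
        FigEight.param₂ χ ∉ FigEight.exceptionalPoints) ∧
      -- these three points correspond to the intersection of `V 1` and `V 2`
      FigEight.param₁ '' (V 1 ∩ V 2) = FigEight.exceptionalPoints ∧
      FigEight.param₂ '' (V 1 ∩ V 2) = FigEight.exceptionalPoints ∧
      V 1 ∩ V 2 = V 0 ∩ V 1 ∩ V 2 ∧
      -- the intersections with `V 0` are the zero loci of the discriminant
      V 1 ∩ V 0 = {χ ∈ V 1 | FigEight.discriminant (FigEight.param₁ χ) = 0} ∧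
      V 2 ∩ V 0 = {χ ∈ V 2 | FigEight.discriminant (FigEight.param₂ χ) = 0} ∧
      -- the restriction to the fibre maps `V 1 ∩ V 2` onto a single point
      ∃ ψ ∈ FigEight.characters FigEight.fibreGroup,
        FigEight.restrictToFibre '' (V 1 ∩ V 2) = {ψ} ∧
        ∀ g : FigEight.fibreGroup,
          ((g : FigEight.KnotGroup) = FigEight.a ∨ (g : FigEight.KnotGroup) = FigEight.a⁻¹ ∨
            (g : FigEight.KnotGroup) = FigEight.b ∨ (g : FigEight.KnotGroup) = FigEight.b⁻¹) →
          ψ g = 1 := by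
  exact ⟨FigEight.component, fun i j h => FigEight.eq_of_component_subset i j h.subset,
    FigEight.irredComponents_zariskiClosure_irredCharacters,
    fun _ h => FigEight.symmetricComponent_apply h,
    fun _ h => FigEight.triangleComponent_apply_a h,
    fun _ h => FigEight.flippedComponent_apply_b h,
    FigEight.factorsThroughFilling_triangleComponent,
    FigEight.factorsThroughFilling_flippedComponent,
    FigEight.isAlgebraicIso_triangleComponent, FigEight.isAlgebraicIso_flippedComponent,
    fun _ h => FigEight.mem_irredCharacters_iff h,
    fun _ h => FigEight.mem_irredCharacters_iff_of_flipped h,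
    FigEight.param₁_image_inter, FigEight.param₂_image_inter,
    Set.Subset.antisymm
      (fun _ h => ⟨⟨FigEight.triangle_inter_flipped_subset h, h.1⟩, h.2⟩) fun _ h => ⟨h.1.2, h.2⟩,
    FigEight.triangle_inter_symmetric, FigEight.flipped_inter_symmetric,
    FigEight.restrictToFibre_image_inter⟩
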